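/- In a finite directed acyclic graph (DAG) $G=(V,E)$ call the nodes of indegree $0$ the inputs and the nodes of outdegree $0$ the outputs; the length of a directed path is its number of edges. For integers $k_1,k_2\ge 0$ and real $d$, $G$ is $(k_1,k_2,d)$-ST-robust if for every $D\subseteq V$ with $|D|\le k_1$ there is a subgraph $H$ of $G-D$ that contains at least $k_2$ inputs of $G$ and at least $k_2$ outputs of $G$, such that for every input $s$ of $G$ in $H$ and every output $t$ of $G$ in $H$ there is a path in $H$ from $s$ to $t$ of length at least $d$. For $0<c\le 1$, a DAG with exactly $n$ inputs and exactly $n$ outputs is $c$-maximally ST-robust with depth $d$ if it is $(k,n-k,d)$-ST-robust for every integer $k$ with $0\le k\le cn$. For every $\varepsilon>0$ there exist constants $0<c\le 1$ and $c_\varepsilon$, depending only on $\varepsilon$, and a family of DAGs $\{M_n^\varepsilon\}_{n=1}^\infty$ such that for every $n\ge 1$ the graph $M_n^\varepsilon$ has exactly $n$ inputs and $n$ outputs, is $c$-maximally ST-robust with depth $d=n^{1-\varepsilon}$, has at most $c_\varepsilon n$ nodes, and has maximum indegree at most $c_\varepsilon$. -/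

import Mathlib

/-- A finite directed acyclic graph. -/
structure DAG where
  /-- the set of nodes -/
  V : Type
  [fintypeV : Fintype V]
  /-- the directed edges -/
  toDigraph : Digraph V
  /-- there is no directed cycle (in particular no loop) -/
  acyclic : ∀ v : V, ¬ Relation.TransGen toDigraph.Adj v v

attribute [instance] DAG.fintypeV

namespace DAG

/-- The inputs of a DAG: the nodes without incoming edges. -/
def inputs (G : DAG) : Set G.V := {v | ∀ u, ¬ G.toDigraph.Adj u v}

/-- The outputs of a DAG: the nodes without outgoing edges. -/
def outputs (G : DAG) : Set G.V := {v | ∀ w, ¬ G.toDigraph.Adj v w}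

/-- The indegree of a node. -/
noncomputable def indegree (G : DAG) (v : G.V) : ℕ := {u | G.toDigraph.Adj u v}.ncard

/-- A subgraph of a DAG: a set of nodes, and a set of edges of `G` between these nodes. -/
structure Subgraph (G : DAG) where
  /-- the nodes of the subgraph -/
  verts : Set G.V
  /-- the edges of the subgraph -/
  Adj : G.V → G.V → Prop
  adj_sub : ∀ {u v}, Adj u v → G.toDigraph.Adj u v
  fst_mem : ∀ {u v}, Adj u v → u ∈ verts
  snd_mem : ∀ {u v}, Adj u v → v ∈ verts

/-- The subgraph `H` contains a directed path from `s` to `t` with at least `d` edges.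
A directed walk in a DAG never repeats a node, so that walks and paths are the same. -/
def Subgraph.HasPathOfLengthGE {G : DAG} (H : G.Subgraph) (s t : G.V) (d : ℝ) : Prop :=
  s ∈ H.verts ∧ t ∈ H.verts ∧
    ∃ p : RelSeries {e : G.V × G.V | H.Adj e.1 e.2},
      p.head = s ∧ p.last = t ∧ d ≤ (p.length : ℝ)

/-- `G` is `(k₁, k₂, d)`-ST-robust: after the deletion of any set `D` of at most `k₁` nodes there
is a subgraph `H` of `G - D` with at least `k₂` inputs and at least `k₂` outputs of `G`, in which
each of these inputs is joined to each of these outputs by a path of length at least `d`.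
For `d = 0` this is `(k₁, k₂)`-ST-robustness. -/
def IsSTRobust (G : DAG) (k₁ k₂ : ℕ) (d : ℝ) : Prop :=
  ∀ D : Finset G.V, D.card ≤ k₁ →
    ∃ H : G.Subgraph, (∀ v ∈ D, v ∉ H.verts) ∧
      k₂ ≤ (G.inputs ∩ H.verts).ncard ∧
      k₂ ≤ (G.outputs ∩ H.verts).ncard ∧
      ∀ s ∈ G.inputs ∩ H.verts, ∀ t ∈ G.outputs ∩ H.verts, H.HasPathOfLengthGE s t d

/-- `G` has exactly `n` inputs and `n` outputs, and is `c`-maximally ST-robust with depth `d`: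
it is `(k, n - k, d)`-ST-robust for every `0 ≤ k ≤ c n`, where `0 < c ≤ 1` (so that `k ≤ n`). -/
def IsMaximallySTRobust (G : DAG) (n : ℕ) (c d : ℝ) : Prop :=
  0 < c ∧ c ≤ 1 ∧ G.inputs.ncard = n ∧ G.outputs.ncard = n ∧
    ∀ k : ℕ, (k : ℝ) ≤ c * n → G.IsSTRobust k (n - k) d

end DAG

namespace STRobust

open Finset

/-! The graph is a series composition: inputs, a net, a depth-robust graph, a second net, outputs.
All parts are built from constant-degree expanders, which exist by a union bound over tuples of
random permutations (`exists_isExpander`).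

Depth-robust graph (`exists_depthRobust`). A node is a point of the cube `{0,1}^S` together with a
position in `Fin S`; the position selects boundedly many scales at which edges may leave, which
keeps the degree constant. Take a height function that falls along the edges inside a dense set `Q`,
and replace it by its median `g` over the positions of each cube point. Expansion of the suffixes
forces, for each prefix, a threshold separating the `g`-values of the two halves of the subcube, up
to few exceptions. Hence `g` reverses the lexicographic order except at few coordinates per point.
Fixing these coordinates and the values there by pigeonhole leaves about `2 ^ ((1 - ε) S)` points
with distinct medians, so some walk is that long.

Core (`half_core`, `core_robust`). The nodes are pairs (cluster, position); clusters are joined as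
in a depth-robust graph and positions by an expander. Along a walk of clusters of logarithmic
length, a node outside small bad sets floods almost a whole cluster. Transposing edges turn a
flooded cluster into one reached position in most clusters of the next copy, and flooding again
reaches 3/4 of that copy. Doing this from both ends, the two reached sets meet in the middle copy.
So deleting `c n` nodes costs only `κ n` terminals.

Net (`isNet_step`, `exists_isNet`). To make the loss proportional to the number of deleted nodes,
the core is placed in parallel with a net for half as many terminals, attached through expanders.
Many deletions are handled by the core, few by the smaller net. The sizes form a geometric series
and the degrees do not accumulate.

Assembly (`assembly_robust`). A last expander layer reduces the loss `C k` of a net to at most `k`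
(`card_terminals`). At least half of the middle nodes are undeleted and attached to good terminals
of both nets, so they contain one long walk; every surviving input reaches its start and its end
reaches every surviving output. -/

/-- `Steps R k a b`: there is a walk with exactly `k` steps of `R` from `a` to `b`. -/
def Steps {α : Type*} (R : α → α → Prop) : ℕ → α → α → Prop
  | 0, a, b => a = b
  | k + 1, a, b => ∃ c, R a c ∧ Steps R k c b

/-- Every `a` has at most `k` successors under `E`. -/
def OutDegLE {α β : Type*} (k : ℕ) (E : α → β → Prop) : Prop :=
  ∀ a, ∃ s : Finset β, s.card ≤ k ∧ ∀ b, E a b → b ∈ s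

/-- A symmetric relation of bounded degree in which small sets expand by the factor `A` and
sets larger than a `1 / A` fraction see each other. -/
structure IsExpander {α : Type*} [Fintype α] (A δ : ℕ) (E : α → α → Prop) : Prop where
  symm : ∀ x y, E x y → E y x
  deg : OutDegLE δ E
  edge : ∀ X Y : Finset α, Fintype.card α < A * X.card + Y.card →
    Fintype.card α < A * Y.card → ∃ x ∈ X, ∃ y ∈ Y, E x y

/-! ### Walks and degree bounds. -/

section Basic

variable {α β γ : Type*}

theorem Steps.trans {R : α → α → Prop} : ∀ {k l : ℕ} {a b c : α},
    Steps R k a b → Steps R l b c → Steps R (k + l) a c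
  | 0, l, a, b, c, h, h' => by
      have h : a = b := h
      subst h; simpa using h'
  | k + 1, l, a, b, c, h, h' => by
      obtain ⟨d, hd, hk⟩ := h
      rw [Nat.add_right_comm]
      exact ⟨d, hd, hk.trans h'⟩

theorem Steps.mono {R R' : α → α → Prop} (hR : ∀ a b, R a b → R' a b) :
    ∀ {k : ℕ} {a b : α}, Steps R k a b → Steps R' k a b
  | 0, _, _, h => h
  | _ + 1, _, _, ⟨d, hd, hk⟩ => ⟨d, hR _ _ hd, Steps.mono hR hk⟩

theorem Steps.single {R : α → α → Prop} {a b : α} (h : R a b) : Steps R 1 a b := ⟨b, h, rfl⟩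

theorem Steps.lift {R : α → α → Prop} {R' : β → β → Prop} (f : α → β)
    (hR : ∀ a b, R a b → R' (f a) (f b)) :
    ∀ {k : ℕ} {a b : α}, Steps R k a b → Steps R' k (f a) (f b)
  | 0, _, _, h => congrArg f h
  | _ + 1, _, _, ⟨d, hd, hk⟩ => ⟨f d, hR _ _ hd, Steps.lift f hR hk⟩

theorem Steps.flip {R : α → α → Prop} : ∀ {k : ℕ} {a b : α},
    Steps R k a b → Steps (fun x y => R y x) k b a
  | 0, _, _, h => Eq.symm h
  | _ + 1, _, _, ⟨_, hd, hk⟩ => hk.flip.trans (Steps.single hd)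

/-- A walk can be cut at every intermediate length. -/
theorem Steps.split {R : α → α → Prop} : ∀ {k l : ℕ} {a c : α},
    Steps R (k + l) a c → ∃ b, Steps R k a b ∧ Steps R l b c
  | 0, l, a, c, h => ⟨a, rfl, by simpa using h⟩
  | k + 1, l, a, c, h => by
      rw [Nat.add_right_comm] at h
      obtain ⟨d, hd, hk⟩ := h
      obtain ⟨b, h1, h2⟩ := Steps.split hk
      exact ⟨b, ⟨d, hd, h1⟩, h2⟩

theorem exists_steps_of_reflTransGen {R : α → α → Prop} {a b : α}
    (h : Relation.ReflTransGen R a b) : ∃ k, Steps R k a b := by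
  induction h with
  | refl => exact ⟨0, rfl⟩
  | tail _ hbc ih =>
    obtain ⟨k, hk⟩ := ih
    exact ⟨k + 1, hk.trans (Steps.single hbc)⟩

theorem OutDegLE.mono {k l : ℕ} {E : α → β → Prop} (h : OutDegLE k E) (hkl : k ≤ l) :
    OutDegLE l E := fun a => by
  obtain ⟨s, hs, h'⟩ := h a
  exact ⟨s, hs.trans hkl, h'⟩

theorem OutDegLE.sub {k : ℕ} {E E' : α → β → Prop} (h : OutDegLE k E)
    (hE : ∀ a b, E' a b → E a b) : OutDegLE k E' := fun a => by
  obtain ⟨s, hs, h'⟩ := h a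
  exact ⟨s, hs, fun b hb => h' b (hE a b hb)⟩

theorem OutDegLE.or {k l : ℕ} {E E' : α → β → Prop} (h : OutDegLE k E) (h' : OutDegLE l E') :
    OutDegLE (k + l) (fun a b => E a b ∨ E' a b) := fun a => by
  classical
  obtain ⟨s, hs, hE⟩ := h a
  obtain ⟨s', hs', hE'⟩ := h' a
  exact ⟨s ∪ s', (card_union_le _ _).trans (by omega), fun b hb => by
    rcases hb with hb | hb
    · exact mem_union_left _ (hE b hb)
    · exact mem_union_right _ (hE' b hb)⟩

theorem OutDegLE.comp {k l : ℕ} {E : α → β → Prop} {E' : β → γ → Prop} (h : OutDegLE k E)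
    (h' : OutDegLE l E') : OutDegLE (k * l) (fun a c => ∃ b, E a b ∧ E' b c) := fun a => by
  classical
  obtain ⟨s, hs, hE⟩ := h a
  choose f hf hE' using h'
  refine ⟨s.biUnion f, (card_biUnion_le_card_mul s f l fun b _ => hf b).trans
    (Nat.mul_le_mul_right l hs), ?_⟩
  rintro c ⟨b, hb, hc⟩
  exact mem_biUnion.2 ⟨b, hE b hb, hE' b c hc⟩

theorem outDegLE_of_fun (f : α → β) : OutDegLE 1 (fun a b => f a = b) := fun a =>
  ⟨{f a}, by simp, fun b hb => by simp [hb]⟩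

theorem outDegLE_of_injective {f : β → α} (hf : Function.Injective f) :
    OutDegLE 1 (fun a b => f b = a) := fun a => by
  by_cases h : ∃ b, f b = a
  · obtain ⟨b, hb⟩ := h
    exact ⟨{b}, by simp, fun b' hb' => by
      rw [mem_singleton]; exact hf (hb'.trans hb.symm)⟩
  · exact ⟨∅, by simp, fun b hb => absurd ⟨b, hb⟩ h⟩

theorem OutDegLE.prod {α' β' : Type*} {k l : ℕ} {E : α → β → Prop} {E' : α' → β' → Prop}
    (h : OutDegLE k E) (h' : OutDegLE l E') :
    OutDegLE (k * l) (fun (a : α × α') (b : β × β') => E a.1 b.1 ∧ E' a.2 b.2) := fun a => by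
  obtain ⟨s, hs, hE⟩ := h a.1
  obtain ⟨s', hs', hE'⟩ := h' a.2
  exact ⟨s ×ˢ s', by rw [card_product]; exact Nat.mul_le_mul hs hs', fun b hb =>
    mem_product.2 ⟨hE _ hb.1, hE' _ hb.2⟩⟩

theorem wellFounded_flip_of_finite [Finite α] {E : α → α → Prop} (h : WellFounded E) :
    WellFounded (fun a b => E b a) := by
  have : Std.Irrefl (fun a b => Relation.TransGen E b a) :=
    ⟨fun a ha => h.transGen.irrefl.irrefl a ha⟩
  have : IsTrans α (fun a b => Relation.TransGen E b a) := ⟨fun a b c hab hbc => hbc.trans hab⟩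
  exact Subrelation.wf (fun {a b} hab => Relation.TransGen.single hab)
    (Finite.wellFounded_of_trans_of_irrefl (fun a b => Relation.TransGen E b a))

end Basic

/-! ### Expanders from random permutations. -/

section Expander

variable {α : Type*} [Fintype α]

-- A random permutation maps `X` into `Z` with probability at most `(|Z| / n) ^ |X|`. In the
-- induction step, composing with the transposition of `a` and a point `b` outside `X` turns a
-- permutation good for `insert a X` into one good for `X` that also sends `b` into `Z`. This
-- injection yields the factor `(|Z| - |X|) / (n - |X|)`, which is at most `|Z| / n`.
open Classical in
theorem card_perm_maps_le (X Z : Finset α) :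
    (univ.filter fun σ : Equiv.Perm α => ∀ a ∈ X, σ a ∈ Z).card * Fintype.card α ^ X.card ≤
      (Fintype.card α).factorial * Z.card ^ X.card := by
  induction X using Finset.induction_on with
  | empty => simp [Fintype.card_perm]
  | insert a X ha ih =>
    set N := (univ.filter fun σ : Equiv.Perm α => ∀ a ∈ X, σ a ∈ Z) with hN
    set N' := (univ.filter fun σ : Equiv.Perm α => ∀ b ∈ insert a X, σ b ∈ Z) with hN'
    have hz : Z.card ≤ Fintype.card α := card_le_univ _
    have hx : X.card < Fintype.card α := by
      have := card_le_univ (insert a X)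
      rw [card_insert_of_notMem ha] at this
      omega
    have key : N'.card * (Fintype.card α - X.card) ≤ N.card * (Z.card - X.card) := by
      have h1 : N'.card * (Fintype.card α - X.card) = (N' ×ˢ Xᶜ).card := by
        rw [card_product, card_compl]
      have h2 : (N.sigma fun σ => Xᶜ.filter fun b => σ b ∈ Z).card =
          N.card * (Z.card - X.card) := by
        rw [card_sigma]
        apply sum_const_nat
        intro σ hσ
        have hσ' : ∀ a ∈ X, σ a ∈ Z := by simpa [hN] using hσ
        have : (Xᶜ.filter fun b => σ b ∈ Z) = (Z.map σ.symm.toEmbedding) \ X := by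
          ext b
          simp only [mem_filter, mem_compl, mem_sdiff, mem_map, Equiv.coe_toEmbedding]
          constructor
          · rintro ⟨h, h'⟩; exact ⟨⟨σ b, h', by simp⟩, h⟩
          · rintro ⟨⟨c, hc, rfl⟩, h⟩; exact ⟨h, by simpa using hc⟩
        rw [this, card_sdiff_of_subset, card_map]
        intro b hb
        exact mem_map.2 ⟨σ b, hσ' b hb, by simp⟩
      rw [h1, ← h2]
      refine card_le_card_of_injOn (fun p => ⟨p.1 * Equiv.swap a p.2, p.2⟩) ?_ ?_
      · rintro ⟨σ, b⟩ h
        simp only [coe_product, Set.mem_prod, mem_coe, hN', mem_filter, mem_univ, true_and,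
          mem_compl] at h
        obtain ⟨h, hb⟩ := h
        refine mem_coe.2 (mem_sigma.2 ⟨mem_filter.2 ⟨mem_univ _, fun c hc => ?_⟩,
          mem_filter.2 ⟨mem_compl.2 hb, by simpa using h a (mem_insert_self _ _)⟩⟩)
        rw [Equiv.Perm.mul_apply, Equiv.swap_apply_of_ne_of_ne]
        · exact h c (mem_insert_of_mem hc)
        · rintro rfl; exact ha hc
        · rintro rfl; exact hb hc
      · rintro ⟨σ, b⟩ _ ⟨σ', b'⟩ _ h
        simp only [Sigma.mk.injEq, heq_eq_eq] at h
        obtain ⟨h, rfl⟩ := h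
        simpa using h
    have hstep : N'.card * Fintype.card α ≤ N.card * Z.card := by
      have hpos : 0 < Fintype.card α - X.card := by omega
      refine Nat.le_of_mul_le_mul_right ?_ hpos
      calc N'.card * Fintype.card α * (Fintype.card α - X.card)
          = N'.card * (Fintype.card α - X.card) * Fintype.card α := by ring
        _ ≤ N.card * (Z.card - X.card) * Fintype.card α := Nat.mul_le_mul_right _ key
        _ = N.card * ((Z.card - X.card) * Fintype.card α) := by ring
        _ ≤ N.card * (Z.card * (Fintype.card α - X.card)) := by
            apply Nat.mul_le_mul_left
            rw [Nat.sub_mul, Nat.mul_sub]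
            apply Nat.sub_le_sub_left
            rw [mul_comm]
            exact Nat.mul_le_mul_left _ hz
        _ = _ := by ring
    rw [card_insert_of_notMem ha, pow_succ, pow_succ]
    calc N'.card * (Fintype.card α ^ X.card * Fintype.card α)
        = (N'.card * Fintype.card α) * Fintype.card α ^ X.card := by ring
      _ ≤ (N.card * Z.card) * Fintype.card α ^ X.card := Nat.mul_le_mul_right _ hstep
      _ = (N.card * Fintype.card α ^ X.card) * Z.card := by ring
      _ ≤ ((Fintype.card α).factorial * Z.card ^ X.card) * Z.card := Nat.mul_le_mul_right _ ih
      _ = _ := by ring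

theorem choose_le_exp_pow (n z : ℕ) (hz : 0 < z) :
    (n.choose z : ℝ) ≤ (Real.exp 1 * n / z) ^ z := by
  have hz' : (0 : ℝ) < z := by exact_mod_cast hz
  have h1 : (n.choose z : ℝ) ≤ (n : ℝ) ^ z / z.factorial := Nat.choose_le_pow_div z n
  have h2 : (z : ℝ) ^ z / z.factorial ≤ Real.exp z :=
    Real.pow_div_factorial_le_exp (z : ℝ) hz'.le z
  have h3 : (0 : ℝ) < z.factorial := by exact_mod_cast z.factorial_pos
  refine h1.trans ?_
  have h4 : Real.exp z = Real.exp 1 ^ z := by rw [← Real.exp_nat_mul]; simp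
  rw [h4] at h2
  rw [div_pow, mul_pow, div_le_div_iff₀ h3 (by positivity)]
  rw [div_le_iff₀ h3] at h2
  calc (n : ℝ) ^ z * (z : ℝ) ^ z ≤ (n : ℝ) ^ z * (Real.exp 1 ^ z * z.factorial) := by gcongr
    _ = _ := by ring

/-- The number of random permutations which is needed for an expander. -/
theorem exists_exponent (A : ℕ) (hA : 2 ≤ A) : ∃ t : ℕ, 1 ≤ t ∧ ∀ n x z : ℕ, 1 ≤ x → 1 ≤ z →
    z ≤ A * x → A * z ≤ (A - 1) * n →
    (n.choose x : ℝ) * n.choose z * ((z : ℝ) / n) ^ (x * t) ≤ (1 / 4) ^ x * (1 / 4) ^ z := by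
  have hA' : (2 : ℝ) ≤ A := by exact_mod_cast hA
  set e := Real.exp 1 with he
  have he1 : 1 ≤ e := by rw [he]; exact Real.one_le_exp (by norm_num)
  set θ : ℝ := 1 - 1 / A with hθ
  have hθ1 : θ < 1 := by
    have : (0 : ℝ) < 1 / A := by positivity
    linarith
  have hθ0 : 0 < θ := by
    have : (1 : ℝ) / A ≤ 1 / 2 := one_div_le_one_div_of_le (by norm_num) hA'
    linarith
  set K : ℝ := 4 * (e * A) * (4 * e) ^ A with hK
  have hK0 : 0 < K := by positivity
  obtain ⟨t', ht'⟩ := exists_pow_lt_of_lt_one (inv_pos.2 hK0) hθ1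
  -- With `q = z / n`, the binomial bounds contribute at most `q ^ (-(A + 1) x)`, which `A + 1`
  -- permutations cancel. The remaining `t'` permutations beat the constant `K ^ x`, because `q ≤ θ
  -- < 1`.
  refine ⟨A + 1 + t', by omega, fun n x z hx hz hzx hzn => ?_⟩
  have hn : 0 < n := by
    rcases Nat.eq_zero_or_pos n with rfl | h
    · simp at hzn; omega
    · exact h
  have hn' : (0 : ℝ) < n := by exact_mod_cast hn
  have hx' : (0 : ℝ) < x := by exact_mod_cast hx
  have hz' : (0 : ℝ) < z := by exact_mod_cast hz
  set q : ℝ := (z : ℝ) / n with hq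
  have hq0 : 0 < q := by positivity
  have hqθ : q ≤ θ := by
    have : ((A * z : ℕ) : ℝ) ≤ ((A - 1 : ℕ) * n : ℕ) := by exact_mod_cast hzn
    push_cast [Nat.cast_sub (by omega : 1 ≤ A)] at this
    rw [hq, div_le_iff₀ hn', hθ]
    have hA0 : (0 : ℝ) < A := by linarith
    have h2 : (1 - 1 / (A : ℝ)) * n = ((A - 1) * n) / A := by field_simp
    rw [h2, le_div_iff₀ hA0]
    linarith
  have hq1 : q ≤ 1 := hqθ.trans hθ1.le
  have hzx' : (z : ℝ) ≤ A * x := by exact_mod_cast hzx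
  have hCz : (n.choose z : ℝ) ≤ (e / q) ^ z := by
    refine (choose_le_exp_pow n z hz).trans_eq ?_
    rw [hq, ← he]; congr 1; field_simp
  have hCx : (n.choose x : ℝ) ≤ (e * A / q) ^ x := by
    refine (choose_le_exp_pow n x hx).trans ?_
    apply pow_le_pow_left₀ (by positivity)
    rw [hq, div_div_eq_mul_div, div_le_div_iff₀ hx' hz']
    have : e * n * z ≤ e * n * (A * x) := by gcongr
    calc e * n * z ≤ e * n * (A * x) := this
      _ = _ := by ring
  have h4z : (4 : ℝ) ^ z * (e / q) ^ z ≤ ((4 * e / q) ^ A) ^ x := by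
    rw [← mul_pow, ← pow_mul, ← mul_div_assoc]
    apply pow_le_pow_right₀ _ hzx
    rw [le_div_iff₀ hq0]
    linarith
  have hmain : 4 ^ x * (e * A / q) ^ x * ((4 * e / q) ^ A) ^ x * q ^ (x * (A + 1 + t')) ≤ 1 := by
    have : 4 ^ x * (e * A / q) ^ x * ((4 * e / q) ^ A) ^ x * q ^ (x * (A + 1 + t')) =
        (K * q ^ t') ^ x := by
      rw [mul_comm x, pow_mul q, ← mul_pow, ← mul_pow, ← mul_pow]
      congr 1
      rw [hK, pow_add, pow_add, div_pow]
      field_simp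
    rw [this]
    apply pow_le_one₀ (by positivity)
    calc K * q ^ t' ≤ K * θ ^ t' := by gcongr
      _ ≤ K * K⁻¹ := by gcongr
      _ = 1 := mul_inv_cancel₀ hK0.ne'
  rw [one_div, inv_pow, inv_pow, ← mul_inv, ← one_div, le_div_iff₀ (by positivity)]
  calc (n.choose x : ℝ) * n.choose z * q ^ (x * (A + 1 + t')) * (4 ^ x * 4 ^ z)
      ≤ (e * A / q) ^ x * (e / q) ^ z * q ^ (x * (A + 1 + t')) * (4 ^ x * 4 ^ z) := by gcongr
    _ = 4 ^ x * (e * A / q) ^ x * (4 ^ z * (e / q) ^ z) * q ^ (x * (A + 1 + t')) := by ring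
    _ ≤ 4 ^ x * (e * A / q) ^ x * ((4 * e / q) ^ A) ^ x * q ^ (x * (A + 1 + t')) := by gcongr
    _ ≤ 1 := hmain

-- Union bound over the pairs `(X, Z)` violating expansion: if every tuple of permutations were bad,
-- the bad events would cover all `(n!) ^ t` tuples, but they account for at most a quarter of them.
open Classical in
theorem exists_good_perms (A : ℕ) (hA : 2 ≤ A) : ∃ t : ℕ, ∀ (α : Type) [Fintype α],
    ∃ σ : Fin t → Equiv.Perm α, ∀ X Z : Finset α, Z.card < A * X.card →
      A * Z.card < (A - 1) * Fintype.card α → ∃ i, ∃ x ∈ X, σ i x ∉ Z := by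
  obtain ⟨t, ht1, ht⟩ := exists_exponent A hA
  refine ⟨t, fun α _ => ?_⟩
  set n := Fintype.card α with hn
  by_contra! hcon
  let good : Finset (Finset α × Finset α) := univ.filter fun p =>
    p.2.card < A * p.1.card ∧ A * p.2.card < (A - 1) * n
  let N : Finset α × Finset α → Finset (Equiv.Perm α) := fun p =>
    univ.filter fun σ => ∀ a ∈ p.1, σ a ∈ p.2
  have hcover : (univ : Finset (Fin t → Equiv.Perm α)) ⊆
      good.biUnion fun p => Fintype.piFinset fun _ => N p := by
    intro σ _
    obtain ⟨X, Z, h1, h2, h3⟩ := hcon σ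
    refine mem_biUnion.2 ⟨(X, Z), mem_filter.2 ⟨mem_univ _, h1, h2⟩, ?_⟩
    rw [Fintype.mem_piFinset]
    exact fun i => mem_filter.2 ⟨mem_univ _, h3 i⟩
  have hcard := (card_le_card hcover).trans card_biUnion_le
  have h0 : (univ : Finset (Fin t → Equiv.Perm α)).card = n.factorial ^ t := by
    rw [card_univ, Fintype.card_fun, Fintype.card_perm, Fintype.card_fin]
  rw [h0] at hcard
  simp only [Fintype.card_piFinset_const] at hcard
  have hfac : (0 : ℝ) < n.factorial := by exact_mod_cast n.factorial_pos
  -- Dividing by the number of sets of a given size makes the sum over all sets a geometric series,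
  -- at most `1/3`. Size `0` gets weight zero, since `X` is nonempty and no permutation maps it into
  -- an empty `Z`.
  let w : ℕ → ℝ := fun x => if x = 0 then 0 else (1 / 4 : ℝ) ^ x / n.choose x
  have hw0 : ∀ x, 0 ≤ w x := fun x => by
    simp only [w]; split_ifs
    · exact le_rfl
    · positivity
  have hterm : ∀ p ∈ good, ((N p).card : ℝ) ^ t ≤
      (n.factorial : ℝ) ^ t * (w p.1.card * w p.2.card) := by
    rintro ⟨X, Z⟩ hp
    obtain ⟨-, h1, h2⟩ := mem_filter.1 hp
    simp only at h1 h2 ⊢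
    have hX : X.card ≠ 0 := by rintro h; rw [h] at h1; omega
    have hXn : X.card ≤ n := card_le_univ X
    have hZn : Z.card ≤ n := card_le_univ Z
    have hn0 : (0 : ℝ) < n := by
      have : 0 < n := by omega
      exact_mod_cast this
    by_cases hZ : Z.card = 0
    · have : N (X, Z) = ∅ := by
        rw [Finset.card_eq_zero] at hZ
        obtain ⟨a, ha⟩ := Finset.card_ne_zero.1 hX
        ext σ
        simp only [N, hZ, mem_filter, mem_univ, true_and, notMem_empty, iff_false]
        exact fun h => h a ha
      rw [this, Finset.card_empty, Nat.cast_zero, zero_pow (by omega)]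
      have := hw0 X.card
      have := hw0 Z.card
      positivity
    · have hk : ((N (X, Z)).card : ℝ) ≤ n.factorial * ((Z.card : ℝ) / n) ^ X.card := by
        have := card_perm_maps_le X Z
        have h' : ((N (X, Z)).card : ℝ) * (n : ℝ) ^ X.card ≤
            (n.factorial : ℝ) * (Z.card : ℝ) ^ X.card := by exact_mod_cast this
        rw [div_pow, ← mul_div_assoc, le_div_iff₀ (by positivity)]
        exact h'
      have hk' := ht n X.card Z.card (by omega) (by omega) h1.le h2.le
      have hcX : (0 : ℝ) < n.choose X.card := by exact_mod_cast Nat.choose_pos hXn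
      have hcZ : (0 : ℝ) < n.choose Z.card := by exact_mod_cast Nat.choose_pos hZn
      calc ((N (X, Z)).card : ℝ) ^ t ≤ (n.factorial * ((Z.card : ℝ) / n) ^ X.card) ^ t := by
            gcongr
        _ = (n.factorial : ℝ) ^ t * ((Z.card : ℝ) / n) ^ (X.card * t) := by
            rw [mul_pow, ← pow_mul]
        _ ≤ _ := by
            apply mul_le_mul_of_nonneg_left _ (by positivity)
            simp only [w, if_neg hX, if_neg hZ]
            rw [div_mul_div_comm, le_div_iff₀ (by positivity)]
            linarith
  have hsum : ∑ X : Finset α, w X.card ≤ 1 / 2 := by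
    have h1 : ∑ X : Finset α, w X.card = ∑ m ∈ range (n + 1), n.choose m • w m := by
      rw [← Finset.powerset_univ, Finset.sum_powerset_apply_card]
      rfl
    rw [h1, Finset.sum_range_succ']
    simp only [w, if_pos, smul_zero, add_zero]
    have h2 : ∀ m ∈ range n, n.choose (m + 1) • (if m + 1 = 0 then 0 else
        (1 / 4 : ℝ) ^ (m + 1) / n.choose (m + 1)) ≤ (1 / 4) ^ m * (1 / 4) := by
      intro m hm
      have : (0 : ℝ) < n.choose (m + 1) := by
        exact_mod_cast Nat.choose_pos (by simpa using hm)
      rw [if_neg (by omega), nsmul_eq_mul, mul_div_cancel₀ _ this.ne', pow_succ]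
    refine (Finset.sum_le_sum h2).trans ?_
    rw [← Finset.sum_mul]
    have h3 : ∑ m ∈ range n, (1 / 4 : ℝ) ^ m ≤ (1 - 1 / 4)⁻¹ := by
      rw [← tsum_geometric_of_lt_one (by norm_num) (by norm_num)]
      exact (summable_geometric_of_lt_one (by norm_num) (by norm_num)).sum_le_tsum _
        (fun i _ => by positivity)
    norm_num at h3 ⊢
    linarith
  have hcard' : (n.factorial : ℝ) ^ t ≤ ∑ p ∈ good, ((N p).card : ℝ) ^ t := by
    exact_mod_cast hcard
  have : (n.factorial : ℝ) ^ t ≤ (n.factorial : ℝ) ^ t * (1 / 2 * (1 / 2)) := by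
    calc (n.factorial : ℝ) ^ t ≤ ∑ p ∈ good, ((N p).card : ℝ) ^ t := hcard'
      _ ≤ ∑ p ∈ good, (n.factorial : ℝ) ^ t * (w p.1.card * w p.2.card) := sum_le_sum hterm
      _ ≤ ∑ p : Finset α × Finset α, (n.factorial : ℝ) ^ t * (w p.1.card * w p.2.card) := by
          apply sum_le_sum_of_subset_of_nonneg (subset_univ _)
          intro p _ _
          have := hw0 p.1.card
          have := hw0 p.2.card
          positivity
      _ = (n.factorial : ℝ) ^ t * ((∑ X : Finset α, w X.card) * ∑ Z : Finset α, w Z.card) := by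
          rw [← mul_sum, Fintype.sum_prod_type, Finset.sum_mul_sum]
      _ ≤ _ := by
          have : 0 ≤ ∑ X : Finset α, w X.card := sum_nonneg fun X _ => hw0 _
          gcongr
  have hpos : (0 : ℝ) < (n.factorial : ℝ) ^ t := by positivity
  linarith

theorem exists_isExpander (A : ℕ) : ∃ δ : ℕ, ∀ (α : Type) [Fintype α],
    ∃ E : α → α → Prop, IsExpander A δ E := by
  classical
  obtain ⟨t, ht⟩ := exists_good_perms (A + 2) (by omega)
  refine ⟨t + t, fun α _ => ?_⟩
  obtain ⟨σ, hσ⟩ := ht α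
  refine ⟨fun x y => (∃ i, σ i x = y) ∨ ∃ i, σ i y = x, fun x y h => h.symm, ?_, ?_⟩
  · refine OutDegLE.or (fun a => ?_) (fun a => ?_)
    · exact ⟨univ.image fun i => σ i a, card_image_le.trans (by simp),
        fun b ⟨i, hi⟩ => mem_image.2 ⟨i, mem_univ _, hi⟩⟩
    · exact ⟨univ.image fun i => (σ i).symm a, card_image_le.trans (by simp),
        fun b ⟨i, hi⟩ => mem_image.2 ⟨i, mem_univ _, by rw [← hi]; simp⟩⟩
  · intro X Y h1 h2
    have hY : Yᶜ.card + Y.card = Fintype.card α := by rw [card_compl]; have := card_le_univ Y; omega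
    obtain ⟨i, x, hx, hi⟩ := hσ X Yᶜ (by
        have : A * X.card ≤ (A + 2) * X.card := Nat.mul_le_mul_right _ (by omega)
        omega) (by
        have : A + 2 - 1 = A + 1 := by omega
        rw [this, ← hY]
        have h3 : A * Y.card + A * Yᶜ.card = A * Fintype.card α := by rw [← hY]; ring
        have h4 : A * Y.card ≤ A * Fintype.card α := by rw [← hY]; gcongr; omega
        nlinarith)
    exact ⟨x, hx, σ i x, by simpa using hi, Or.inl ⟨i, rfl⟩⟩

end Expander

/-! ### Medians, thresholds and pigeonhole. -/

section Combinatorics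

theorem exists_median {ι : Type*} (F : Finset ι) (f : ι → ℕ) :
    ∃ g, F.card ≤ 2 * (F.filter fun p => g ≤ f p).card ∧
      F.card ≤ 2 * (F.filter fun p => f p ≤ g).card := by
  rcases F.eq_empty_or_nonempty with rfl | hF
  · exact ⟨0, by simp⟩
  set P : ℕ → Prop := fun t => F.card ≤ 2 * (F.filter fun p => t ≤ f p).card with hP
  have h0 : P 0 := by simp only [hP]; rw [filter_true_of_mem (by simp)]; omega
  classical
  have hb : ∀ t, P t → t ≤ F.sup f := by
    intro t ht
    by_contra hlt
    have : F.filter (fun p => t ≤ f p) = ∅ :=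
      filter_eq_empty_iff.2 fun p hp hle => hlt (hle.trans (le_sup (f := f) hp))
    simp only [hP, this, card_empty] at ht
    have := hF.card_pos
    omega
  refine ⟨Nat.findGreatest P (F.sup f), Nat.findGreatest_spec (Nat.zero_le _) h0, ?_⟩
  set g := Nat.findGreatest P (F.sup f)
  have hg : ¬ P (g + 1) := fun h => by
    have := Nat.le_findGreatest (hb _ h) h
    omega
  have hcard := card_filter_add_card_filter_not (s := F) (fun p => f p ≤ g)
  have hs : (F.filter fun p => ¬ f p ≤ g) = F.filter fun p => g + 1 ≤ f p := by
    ext p; simp only [mem_filter, not_le, Nat.succ_le_iff]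
  rw [hs] at hcard
  simp only [hP] at hg
  omega

/-- The least `t` at which more than `K` values of `a` are `≤ t` works: minimality bounds the values
below `t`, and `h` bounds the values of `b` from `t` on. If no such `t` exists, any number above all
values does. -/
theorem exists_threshold {ι κ : Type*} (A : Finset ι) (B : Finset κ) (a : ι → ℕ) (b : κ → ℕ)
    (K : ℕ) (h : ∀ t, (A.filter fun x => a x ≤ t).card ≤ K ∨
      (B.filter fun x => t ≤ b x).card ≤ K) :
    ∃ t, (A.filter fun x => a x < t).card ≤ K ∧ (B.filter fun x => t ≤ b x).card ≤ K := by
  classical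
  by_cases hex : ∃ t, ¬ (A.filter fun x => a x ≤ t).card ≤ K
  · refine ⟨Nat.find hex, ?_, (h _).resolve_left (Nat.find_spec hex)⟩
    rcases Nat.eq_zero_or_pos (Nat.find hex) with h0 | h0
    · rw [h0]; simp
    · have := Nat.find_min hex (m := Nat.find hex - 1) (by omega)
      rw [not_not] at this
      refine (card_le_card fun x hx => ?_).trans this
      rw [mem_filter] at hx ⊢
      exact ⟨hx.1, by omega⟩
  · push Not at hex
    refine ⟨max (A.sup a) (B.sup b) + 1, (card_le_card fun x hx => ?_).trans
      (hex (max (A.sup a) (B.sup b))), ?_⟩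
    · rw [mem_filter] at hx ⊢
      exact ⟨hx.1, by omega⟩
    · rw [filter_false_of_mem]
      · simp
      · intro x hx
        have := le_sup (f := b) hx
        omega

/-- The number of partial assignments with few assigned coordinates. -/
theorem card_partial_assignments_le (S K : ℕ) (y : ℝ) (hy : 0 < y) (hy1 : y ≤ 1) :
    ((univ.filter fun c : Fin S → Option Bool =>
      (univ.filter fun i => c i ≠ none).card ≤ K).card : ℝ) * y ^ K ≤ (1 + 2 * y) ^ S := by
  -- Weight each assigned coordinate by `y`: the total weight is `(1 + 2y) ^ S`, and an assignment
  -- with at most `K` assigned coordinates weighs at least `y ^ K`.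
  have h := Finset.prod_univ_sum (fun _ : Fin S => (univ : Finset (Option Bool)))
    (fun _ o => if o ≠ none then y else 1)
  have h1 : ∑ o : Option Bool, (if o ≠ none then y else 1) = 1 + 2 * y := by
    rw [Fintype.sum_option]; simp
  simp only [h1, prod_const, card_univ, Fintype.card_fin, Fintype.piFinset_univ] at h
  rw [h, ← nsmul_eq_mul, ← sum_const]
  refine (sum_le_sum fun c hc => ?_).trans
    (sum_le_sum_of_subset_of_nonneg (subset_univ _) fun c _ _ => ?_)
  · rw [prod_ite]
    simp only [prod_const, one_pow, mul_one]
    exact pow_le_pow_of_le_one hy.le hy1 (mem_filter.1 hc).2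
  · exact prod_nonneg fun i _ => by split_ifs <;> linarith

/-- Pigeonhole on the partial assignment that records `u` on `Exc u`; it determines both the
exceptional set and the values there. -/
theorem exists_large_fibre {S K : ℕ} (G : Finset (Fin S → Bool))
    (Exc : (Fin S → Bool) → Finset (Fin S)) (hE : ∀ u ∈ G, (Exc u).card ≤ K)
    (y : ℝ) (hy : 0 < y) (hy1 : y ≤ 1) :
    ∃ F ⊆ G, (G.card : ℝ) * y ^ K ≤ F.card * (1 + 2 * y) ^ S ∧
      ∀ u ∈ F, ∀ v ∈ F, Exc u = Exc v ∧ ∀ i ∈ Exc u, u i = v i := by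
  classical
  let code : (Fin S → Bool) → Fin S → Option Bool := fun u i =>
    if i ∈ Exc u then some (u i) else none
  have hcode : ∀ u i, code u i ≠ none ↔ i ∈ Exc u := fun u i => by
    simp only [code]; split_ifs with h <;> simp [h]
  set T := univ.filter fun c : Fin S → Option Bool =>
      (univ.filter fun i => c i ≠ none).card ≤ K with hT
  have hmap : ∀ u ∈ G, code u ∈ T := by
    intro u hu
    rw [hT, mem_filter]
    refine ⟨mem_univ _, ?_⟩
    have : (univ.filter fun i => code u i ≠ none) = Exc u := by ext i; simp [hcode]
    rw [this]
    exact hE u hu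
  have hTne : T.Nonempty := ⟨fun _ => none, by simp [hT]⟩
  have hTpos : (0 : ℝ) < T.card := by exact_mod_cast hTne.card_pos
  have hT' := card_partial_assignments_le S K y hy hy1
  rw [← hT] at hT'
  obtain ⟨c, hc, hle⟩ := exists_le_card_fiber_of_nsmul_le_card_of_maps_to (M := ℝ)
    (b := (G.card : ℝ) / T.card) hmap hTne
    (by rw [nsmul_eq_mul, mul_div_cancel₀ _ hTpos.ne'])
  refine ⟨G.filter fun u => code u = c, filter_subset _ _, ?_, ?_⟩
  · rw [div_le_iff₀ hTpos] at hle
    calc (G.card : ℝ) * y ^ K ≤ ((G.filter fun u => code u = c).card * T.card) * y ^ K := by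
          gcongr
      _ = (G.filter fun u => code u = c).card * (T.card * y ^ K) := by ring
      _ ≤ _ := by gcongr
  · intro u hu v hv
    have huv : code u = code v := (mem_filter.1 hu).2.trans (mem_filter.1 hv).2.symm
    have hEE : Exc u = Exc v := by
      ext i; rw [← hcode, ← hcode, huv]
    refine ⟨hEE, fun i hi => ?_⟩
    have h1 : code u i = some (u i) := if_pos hi
    have h2 : code v i = some (v i) := if_pos (hEE ▸ hi)
    rw [huv, h2] at h1
    exact (Option.some.inj h1).symm

end Combinatorics

/-! ### The cube graph. -/

section Cube

/-- The point of the cube with prefix `π` before `i`, value `b` at `i` and suffix `s` after `i`. -/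
def glue {S : ℕ} (i : Fin S) (π : {j // j < i} → Bool) (b : Bool) (s : {j // i < j} → Bool) :
    Fin S → Bool :=
  fun j => if h : j < i then π ⟨j, h⟩ else if h : i < j then s ⟨j, h⟩ else b

theorem glue_lt {S : ℕ} {i : Fin S} {π : {j // j < i} → Bool} {b : Bool}
    {s : {j // i < j} → Bool} {j : Fin S} (h : j < i) : glue i π b s j = π ⟨j, h⟩ := dif_pos h

theorem glue_self {S : ℕ} {i : Fin S} {π : {j // j < i} → Bool} {b : Bool}
    {s : {j // i < j} → Bool} : glue i π b s i = b := by simp [glue]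

theorem glue_gt {S : ℕ} {i : Fin S} {π : {j // j < i} → Bool} {b : Bool}
    {s : {j // i < j} → Bool} {j : Fin S} (h : i < j) : glue i π b s j = s ⟨j, h⟩ := by
  rw [glue, dif_neg h.not_gt, dif_pos h]

theorem eq_glue {S : ℕ} (i : Fin S) (u : Fin S → Bool) :
    u = glue i (fun j => u j) (u i) (fun j => u j) := by
  funext j
  rcases lt_trichotomy j i with h | rfl | h
  · rw [glue_lt h]
  · rw [glue_self]
  · rw [glue_gt h]

theorem card_prefix_mul_card_suffix {S : ℕ} (i : Fin S) :
    2 * (Fintype.card ({j // j < i} → Bool) * Fintype.card ({j // i < j} → Bool)) = 2 ^ S := by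
  let e : (({j // j < i} → Bool) × Bool × ({j // i < j} → Bool)) ≃ (Fin S → Bool) :=
    { toFun := fun t => glue i t.1 t.2.1 t.2.2
      invFun := fun u => (fun j => u j, u i, fun j => u j)
      left_inv := fun t => by
        refine Prod.ext ?_ (Prod.ext ?_ ?_)
        · funext j; exact glue_lt j.2
        · exact glue_self
        · funext j; exact glue_gt j.2
      right_inv := fun u => (eq_glue i u).symm }
  have := Fintype.card_congr e
  rw [Fintype.card_prod, Fintype.card_prod, Fintype.card_bool] at this
  rw [(Fintype.card_fun : Fintype.card (Fin S → Bool) = _), Fintype.card_bool,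
    Fintype.card_fin] at this
  rw [← this]
  simp only [Fintype.card_fun, Fintype.card_bool]
  ring

/-- A numbering of the cube which increases along the edges at every scale is ordered at every
scale, up to few exceptions. -/
theorem exists_exceptions {S A δ : ℕ} (hA : 0 < A)
    {Ex : ∀ i : Fin S, ({j // i < j} → Bool) → ({j // i < j} → Bool) → Prop}
    (hEx : ∀ i, IsExpander A δ (Ex i)) (g : (Fin S → Bool) → ℕ)
    (P0 P1 : Fin S → (Fin S → Bool) → Prop)
    (hg : ∀ i u v, (∀ j < i, u j = v j) → u i = false → v i = true → P0 i u → P1 i v →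
      Ex i (fun j => u j) (fun j => v j) → g v < g u) :
    ∃ N : Fin S → Finset (Fin S → Bool), (∀ i, A * (N i).card ≤ 2 ^ S) ∧
      ∀ i u v, (∀ j < i, u j = v j) → u i = false → v i = true → P0 i u → P1 i v →
        u ∉ N i → v ∉ N i → g v < g u := by
  classical
  have key : ∀ (i : Fin S) (π : {j // j < i} → Bool), ∃ t : ℕ,
      ((univ.filter fun s => P0 i (glue i π false s)).filter
        fun s => g (glue i π false s) < t).card ≤ Fintype.card ({j // i < j} → Bool) / A ∧
      ((univ.filter fun s => P1 i (glue i π true s)).filter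
        fun s => t ≤ g (glue i π true s)).card ≤ Fintype.card ({j // i < j} → Bool) / A := by
    intro i π
    apply exists_threshold
    intro t
    by_contra! hcon
    obtain ⟨h1, h2⟩ := hcon
    rw [Nat.div_lt_iff_lt_mul hA, mul_comm] at h1 h2
    obtain ⟨x, hx, y, hy, hxy⟩ := (hEx i).edge _ _ (h1.trans_le (Nat.le_add_right _ _)) h2
    simp only [mem_filter, mem_univ, true_and] at hx hy
    have := hg i (glue i π false x) (glue i π true y)
      (fun j hj => by rw [glue_lt hj, glue_lt hj]) glue_self glue_self hx.1 hy.1 (by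
        convert hxy using 1
        · funext j; exact glue_gt j.2
        · funext j; exact glue_gt j.2)
    exact absurd (hx.2.trans hy.2) this.not_ge
  choose t ht0 ht1 using key
  let pre : ∀ i : Fin S, (Fin S → Bool) → {j // j < i} → Bool := fun i u j => u j
  refine ⟨fun i => univ.filter fun u => (u i = false ∧ P0 i u ∧ g u < t i (pre i u)) ∨
    (u i = true ∧ P1 i u ∧ t i (pre i u) ≤ g u), fun i => ?_, ?_⟩
  · simp only [filter_or]
    set M := Fintype.card ({j // i < j} → Bool) with hM
    have hlow : (univ.filter fun u => u i = false ∧ P0 i u ∧ g u < t i (pre i u)).card ≤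
        Fintype.card ({j // j < i} → Bool) * (M / A) := by
      calc _ ≤ (univ.sigma fun π : {j // j < i} → Bool =>
              (univ.filter fun s => P0 i (glue i π false s)).filter
                fun s => g (glue i π false s) < t i π).card := by
            refine card_le_card_of_injOn (fun u => ⟨pre i u, fun j => u j⟩) ?_ ?_
            · intro u hu
              simp only [coe_filter, mem_univ, true_and, Set.mem_ofPred_eq] at hu
              have := eq_glue i u
              rw [hu.1] at this
              refine mem_coe.2 (mem_sigma.2 ⟨mem_univ _, ?_⟩)
              rw [mem_filter, mem_filter]
              simp only [pre]
              rw [← this]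
              exact ⟨⟨mem_univ _, hu.2.1⟩, hu.2.2⟩
            · intro u hu v hv huv
              simp only [coe_filter, mem_univ, true_and, Set.mem_ofPred_eq] at hu hv
              simp only [Sigma.mk.injEq, heq_eq_eq] at huv
              rw [eq_glue i u, eq_glue i v, hu.1, hv.1]
              congr 1
              · exact huv.1
              · exact huv.2
        _ ≤ _ := by
            rw [card_sigma]
            refine (sum_le_card_nsmul _ _ _ fun π _ => ht0 i π).trans_eq ?_
            rw [card_univ, smul_eq_mul]
    have hhigh : (univ.filter fun u => u i = true ∧ P1 i u ∧ t i (pre i u) ≤ g u).card ≤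
        Fintype.card ({j // j < i} → Bool) * (M / A) := by
      calc _ ≤ (univ.sigma fun π : {j // j < i} → Bool =>
              (univ.filter fun s => P1 i (glue i π true s)).filter
                fun s => t i π ≤ g (glue i π true s)).card := by
            refine card_le_card_of_injOn (fun u => ⟨pre i u, fun j => u j⟩) ?_ ?_
            · intro u hu
              simp only [coe_filter, mem_univ, true_and, Set.mem_ofPred_eq] at hu
              have := eq_glue i u
              rw [hu.1] at this
              refine mem_coe.2 (mem_sigma.2 ⟨mem_univ _, ?_⟩)
              rw [mem_filter, mem_filter]
              simp only [pre]
              rw [← this]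
              exact ⟨⟨mem_univ _, hu.2.1⟩, hu.2.2⟩
            · intro u hu v hv huv
              simp only [coe_filter, mem_univ, true_and, Set.mem_ofPred_eq] at hu hv
              simp only [Sigma.mk.injEq, heq_eq_eq] at huv
              rw [eq_glue i u, eq_glue i v, hu.1, hv.1]
              congr 1
              · exact huv.1
              · exact huv.2
        _ ≤ _ := by
            rw [card_sigma]
            refine (sum_le_card_nsmul _ _ _ fun π _ => ht1 i π).trans_eq ?_
            rw [card_univ, smul_eq_mul]
    have hMA : A * (M / A) ≤ M := Nat.mul_div_le M A
    calc _ ≤ A * (Fintype.card ({j // j < i} → Bool) * (M / A) +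
            Fintype.card ({j // j < i} → Bool) * (M / A)) :=
          Nat.mul_le_mul_left _ ((card_union_le _ _).trans (Nat.add_le_add hlow hhigh))
      _ = 2 * (Fintype.card ({j // j < i} → Bool) * (A * (M / A))) := by ring
      _ ≤ 2 * (Fintype.card ({j // j < i} → Bool) * M) := by gcongr
      _ = 2 ^ S := card_prefix_mul_card_suffix i
  · intro i u v huv hu hv h0 h1 hNu hNv
    have hpre : pre i u = pre i v := funext fun j => huv j j.2
    have h2 : ¬ g u < t i (pre i u) := fun h => hNu (by
      rw [mem_filter]; exact ⟨mem_univ _, Or.inl ⟨hu, h0, h⟩⟩)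
    have h3 : ¬ t i (pre i v) ≤ g v := fun h => hNv (by
      rw [mem_filter]; exact ⟨mem_univ _, Or.inr ⟨hv, h1, h⟩⟩)
    rw [hpre] at h2
    omega

/-- The edges of the depth-robust graph: the nodes are pairs of a point of the cube and a
position; the first coordinate `i` in which the two points differ is flipped from `0` to `1`,
both positions are joined to `i` by `Γ`, and the suffixes are joined by `Ex i`. -/
def CubeEdge {S : ℕ} (Γ : Fin S → Fin S → Prop)
    (Ex : ∀ i : Fin S, ({j // i < j} → Bool) → ({j // i < j} → Bool) → Prop)
    (x y : (Fin S → Bool) × Fin S) : Prop :=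
  ∃ i, (∀ j < i, x.1 j = y.1 j) ∧ x.1 i = false ∧ y.1 i = true ∧ Γ x.2 i ∧ Γ y.2 i ∧
    Ex i (fun j => x.1 j) (fun j => y.1 j)

variable {S δ δ' A B : ℕ} {Γ : Fin S → Fin S → Prop}
  {Ex : ∀ i : Fin S, ({j // i < j} → Bool) → ({j // i < j} → Bool) → Prop}

/-- The first differing coordinate rises from `0` to `1`, so edges increase the lexicographic order.
-/
theorem wellFounded_cubeEdge : WellFounded (CubeEdge Γ Ex) := by
  refine Subrelation.wf (r := InvImage (fun a b : Lex (Fin S → Bool) => a < b)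
    (fun x : (Fin S → Bool) × Fin S => toLex x.1)) ?_ (InvImage.wf _ wellFounded_lt)
  rintro x y ⟨i, h1, h2, h3, -⟩
  refine ⟨i, h1, ?_⟩
  show x.1 i < y.1 i
  rw [h2, h3]; decide

theorem outDegLE_suffix {i : Fin S} {E : ({j // i < j} → Bool) → ({j // i < j} → Bool) → Prop}
    (hE : OutDegLE δ E) (b : Bool) :
    OutDegLE δ (fun u v : Fin S → Bool => (∀ j < i, u j = v j) ∧ v i = b ∧
      E (fun j => u j) (fun j => v j)) := by
  classical
  intro u
  obtain ⟨s, hs, h⟩ := hE (fun j => u j)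
  refine ⟨s.image fun w => glue i (fun j => u j) b w, card_image_le.trans hs, ?_⟩
  rintro v ⟨h1, h2, h3⟩
  refine mem_image.2 ⟨_, h _ h3, ?_⟩
  rw [← h2]
  conv_rhs => rw [eq_glue i v]
  congr 1
  funext j; exact h1 j j.2

theorem outDegLE_scale {α β ι : Type*} {k l : ℕ} {E : α → ι → Prop} {E' : ι → α → β → Prop}
    (h : OutDegLE k E) (h' : ∀ i, OutDegLE l (E' i)) :
    OutDegLE (k * l) (fun a c => ∃ b, E a b ∧ E' b a c) := fun a => by
  classical
  obtain ⟨s, hs, hE⟩ := h a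
  choose f hf hE' using fun i => h' i a
  refine ⟨s.biUnion f, (card_biUnion_le_card_mul s f l fun b _ => hf b).trans
    (Nat.mul_le_mul_right l hs), ?_⟩
  rintro c ⟨b, hb, hc⟩
  exact mem_biUnion.2 ⟨b, hE b hb, hE' b c hc⟩

/-- The scale `i` is one of `δ` neighbours of the position of `x`; without positions there would be
`S` scales. The suffix and the new position then have `δ'` and `δ` choices. -/
theorem outDegLE_cubeEdge (hΓ : IsExpander B δ Γ) (hEx : ∀ i, IsExpander A δ' (Ex i)) :
    OutDegLE (δ * (δ' * δ)) (CubeEdge Γ Ex) := by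
  have hp : OutDegLE δ (fun (x : (Fin S → Bool) × Fin S) i => Γ x.2 i) := fun x => hΓ.deg x.2
  have hi : ∀ i : Fin S, OutDegLE δ (fun (_ : Fin S) q => Γ i q) := fun i _ => hΓ.deg i
  refine (outDegLE_scale hp fun i => (outDegLE_suffix (hEx i).deg true).prod (hi i)).sub ?_
  rintro x y ⟨i, h1, -, h3, h4, h5, h6⟩
  exact ⟨i, h4, ⟨h1, h3, h6⟩, hΓ.symm _ _ h5⟩

theorem inDegLE_cubeEdge (hΓ : IsExpander B δ Γ) (hEx : ∀ i, IsExpander A δ' (Ex i)) :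
    OutDegLE (δ * (δ' * δ)) (fun x y => CubeEdge Γ Ex y x) := by
  have hp : OutDegLE δ (fun (x : (Fin S → Bool) × Fin S) i => Γ x.2 i) := fun x => hΓ.deg x.2
  have hi : ∀ i : Fin S, OutDegLE δ (fun (_ : Fin S) q => Γ i q) := fun i _ => hΓ.deg i
  refine (outDegLE_scale hp fun i => (outDegLE_suffix (hEx i).deg false).prod (hi i)).sub ?_
  rintro x y ⟨i, h1, h2, -, h4, h5, h6⟩
  exact ⟨i, h5, ⟨fun j hj => (h1 j hj).symm, h2, (hEx i).symm _ _ h6⟩, hΓ.symm _ _ h4⟩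

end Cube

/-! ### Long walks in dense subsets of the cube graph. -/

/-- The edges of `R` with both ends in `Q`. -/
def Within {α : Type*} (Q : Finset α) (R : α → α → Prop) (a b : α) : Prop :=
  a ∈ Q ∧ b ∈ Q ∧ R a b

section DepthRobust

/-- A set which misses a set of labels under an expander is small or sees few labels. -/
theorem card_unseen_le {S B δ : ℕ} {Γ : Fin S → Fin S → Prop} (hΓ : IsExpander B δ Γ)
    (L Y : Finset (Fin S)) (hL : S < B * L.card) (hY : ∀ p ∈ L, ∀ i ∈ Y, ¬ Γ p i) :
    B * Y.card ≤ S := by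
  by_contra! h
  obtain ⟨x, hx, y, hy, hxy⟩ := hΓ.edge L Y (by rw [Fintype.card_fin]; omega)
    (by rwa [Fintype.card_fin])
  exact hY x hx y hy hxy

variable {S δ δ' A B : ℕ} {Γ : Fin S → Fin S → Prop}
  {Ex : ∀ i : Fin S, ({j // i < j} → Bool) → ({j // i < j} → Bool) → Prop}

/-- The core of the depth-robustness proof: a set `Q` of nodes with a height function that
decreases along the edges inside `Q` has large height. -/
theorem exists_large_height (hΓ : IsExpander B δ Γ) (hEx : ∀ i, IsExpander A δ' (Ex i))
    (hS : 1 ≤ S) {β η y : ℝ} (hβ : 0 < β) (hy : 0 < y) (hy1 : y ≤ 1)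
    (hBβ : 4 < B * β) (hBη : 1 ≤ B * η) (hA : 4 ≤ A * (β * η)) {K : ℕ} (hK : ⌊3 * η * S⌋₊ ≤ K)
    (Q : Finset ((Fin S → Bool) × Fin S))
    (hQ : β * (2 ^ S * S) ≤ Q.card) (h : (Fin S → Bool) × Fin S → ℕ)
    (hh : ∀ a b, Within Q (CubeEdge Γ Ex) a b → h b < h a) :
    ∃ a ∈ Q, β / 4 * 2 ^ S * y ^ K ≤ (h a + 1) * (1 + 2 * y) ^ S := by
  classical
  have hS' : (0 : ℝ) < S := by exact_mod_cast hS
  have hB0 : (0 : ℝ) < B := by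
    rcases Nat.eq_zero_or_pos B with rfl | hB
    · simp at hBβ; linarith
    · exact_mod_cast hB
  have hA0 : 0 < A := by
    rcases Nat.eq_zero_or_pos A with rfl | hA'
    · simp at hA; linarith
    · exact hA'
  have hA0' : (0 : ℝ) < A := by exact_mod_cast hA0
  let q : (Fin S → Bool) → Finset (Fin S) := fun u => univ.filter fun p => (u, p) ∈ Q
  -- The median makes the position irrelevant: an edge from a position in `L u` to one in `U v`
  -- gives `g v ≤ h (v, p') < h (u, p) ≤ g u`, and both sets contain at least half of the positions
  -- in `Q`.
  have hmed := fun u => exists_median (q u) (fun p => h (u, p))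
  choose g hg1 hg2 using hmed
  let U : (Fin S → Bool) → Finset (Fin S) := fun u => (q u).filter fun p => g u ≤ h (u, p)
  let L : (Fin S → Bool) → Finset (Fin S) := fun u => (q u).filter fun p => h (u, p) ≤ g u
  let P0 : Fin S → (Fin S → Bool) → Prop := fun i u => ∃ p ∈ L u, Γ p i
  let P1 : Fin S → (Fin S → Bool) → Prop := fun i u => ∃ p ∈ U u, Γ p i
  obtain ⟨N, hN, hN'⟩ := exists_exceptions hA0 hEx g P0 P1 (by
    rintro i u v huv hu hv ⟨p, hp, hpi⟩ ⟨p', hp', hpi'⟩ hE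
    simp only [L, U, q, mem_filter, mem_univ, true_and] at hp hp'
    have := hh (u, p) (v, p') ⟨hp.1, hp'.1, i, huv, hu, hv, hpi, hpi', hE⟩
    omega)
  let good : Finset (Fin S → Bool) := univ.filter fun u => β / 2 * S ≤ (q u).card
  have hgood : β / 2 * 2 ^ S ≤ good.card := by
    have h1 : (Q.card : ℝ) = ∑ u, ((q u).card : ℝ) := by
      rw [← Nat.cast_sum, Nat.cast_inj]
      rw [card_eq_sum_card_fiberwise (f := Prod.fst) (t := univ) (by simp)]
      refine sum_congr rfl fun u _ => ?_
      refine card_nbij' (fun x => x.2) (fun p => (u, p)) ?_ ?_ ?_ ?_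
      · rintro ⟨v, p⟩ hx
        simp only [coe_filter, Set.mem_ofPred_eq] at hx
        obtain ⟨hx, rfl⟩ := hx
        simpa [q] using hx
      · intro p hp
        simpa [q] using hp
      · rintro ⟨v, p⟩ hx
        simp only [coe_filter, Set.mem_ofPred_eq] at hx
        obtain ⟨hx, rfl⟩ := hx
        rfl
      · intro p hp; rfl
    have h2 : ∀ u, ((q u).card : ℝ) ≤ (if u ∈ good then (S : ℝ) else 0) + β / 2 * S := by
      intro u
      split_ifs with hu
      · have : (q u).card ≤ S := (card_le_univ _).trans_eq (Fintype.card_fin S)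
        have : ((q u).card : ℝ) ≤ S := by exact_mod_cast this
        have : 0 ≤ β / 2 * S := by positivity
        linarith
      · have : ¬ β / 2 * S ≤ ((q u).card : ℝ) := fun h => hu (by
          rw [mem_filter]; exact ⟨mem_univ _, h⟩)
        linarith
    have h3 : (Q.card : ℝ) ≤ good.card * S + 2 ^ S * (β / 2 * S) := by
      rw [h1]
      refine (sum_le_sum fun u _ => h2 u).trans_eq ?_
      rw [sum_add_distrib, sum_ite_mem, univ_inter, sum_const, sum_const, card_univ]
      simp
    have h4 : β * (2 ^ S * S) ≤ good.card * S + 2 ^ S * (β / 2 * S) := hQ.trans h3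
    have h5 : β / 2 * 2 ^ S * S ≤ good.card * S := by linarith
    exact le_of_mul_le_mul_right h5 hS'
  -- Markov's inequality: `A * ∑ |N i| ≤ S * 2 ^ S` and `4 ≤ A * (β * η)` leave at most `β / 4 * 2 ^
  -- S` points with more than `η * S` exceptions.
  let few : Finset (Fin S → Bool) :=
    univ.filter fun u => ((univ.filter fun i => u ∈ N i).card : ℝ) ≤ η * S
  have hfew : ((fewᶜ).card : ℝ) ≤ β / 4 * 2 ^ S := by
    have h1 : ∑ u, ((univ.filter fun i => u ∈ N i).card : ℝ) = ∑ i, ((N i).card : ℝ) := by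
      have := sum_card_bipartiteAbove_eq_sum_card_bipartiteBelow
        (s := (univ : Finset (Fin S → Bool))) (t := (univ : Finset (Fin S))) (fun u i => u ∈ N i)
      simp only [bipartiteAbove, bipartiteBelow, filter_univ_mem] at this
      exact_mod_cast this
    have h2 : A * ∑ i, ((N i).card : ℝ) ≤ S * 2 ^ S := by
      rw [mul_sum]
      refine (sum_le_card_nsmul univ _ (2 ^ S : ℝ) fun i _ => ?_).trans_eq ?_
      · exact_mod_cast hN i
      · simp
    have h3 : ((fewᶜ).card : ℝ) * (η * S) ≤ ∑ i, ((N i).card : ℝ) := by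
      rw [← h1, ← nsmul_eq_mul]
      refine (card_nsmul_le_sum fewᶜ (fun u => ((univ.filter fun i => u ∈ N i).card : ℝ)) _
        fun u hu => ?_).trans (sum_le_sum_of_subset_of_nonneg (subset_univ _)
          fun _ _ _ => by positivity)
      simp only [few, mem_compl, mem_filter, mem_univ, true_and, not_le] at hu
      exact hu.le
    have h4 : ((fewᶜ).card : ℝ) * (A * η) * S ≤ 2 ^ S * S := by
      calc _ = A * (((fewᶜ).card : ℝ) * (η * S)) := by ring
        _ ≤ A * ∑ i, ((N i).card : ℝ) := by gcongr
        _ ≤ _ := by linarith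
    have h5 : ((fewᶜ).card : ℝ) * (A * η) ≤ 2 ^ S := le_of_mul_le_mul_right h4 hS'
    have h6 : ((fewᶜ).card : ℝ) * 4 ≤ β * 2 ^ S := by
      calc ((fewᶜ).card : ℝ) * 4 ≤ (fewᶜ).card * (A * (β * η)) := by gcongr
        _ = β * ((fewᶜ).card * (A * η)) := by ring
        _ ≤ _ := by gcongr
    linarith
  set G := good ∩ few with hG
  have hGcard : β / 4 * 2 ^ S ≤ G.card := by
    have : good ⊆ G ∪ fewᶜ := fun u hu => by
      by_cases hf : u ∈ few
      · exact mem_union_left _ (mem_inter.2 ⟨hu, hf⟩)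
      · exact mem_union_right _ (mem_compl.2 hf)
    have : good.card ≤ G.card + fewᶜ.card := (card_le_card this).trans (card_union_le _ _)
    have : (good.card : ℝ) ≤ G.card + fewᶜ.card := by exact_mod_cast this
    linarith
  -- Three kinds of exceptional coordinates, each at most `η * S` in number for points of `G`; hence
  -- the bound `⌊3 * η * S⌋₊`.
  let Exc : (Fin S → Bool) → Finset (Fin S) := fun u =>
    (univ.filter fun i => ¬ P0 i u) ∪ (univ.filter fun i => ¬ P1 i u) ∪
      (univ.filter fun i => u ∈ N i)
  have hqgood : ∀ u ∈ good, β / 2 * S ≤ (q u).card := fun u hu => (mem_filter.1 hu).2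
  have hlarge : ∀ u ∈ good, ∀ V : Finset (Fin S), (q u).card ≤ 2 * V.card → S < B * V.card := by
    intro u hu V hV
    have h1 := hqgood u hu
    have h2 : ((q u).card : ℝ) ≤ 2 * V.card := by exact_mod_cast hV
    have h3 : (S : ℝ) < B * V.card := by
      have : β / 4 * S ≤ V.card := by linarith
      calc (S : ℝ) = 4 * (S / 4) := by ring
        _ < B * β * (S / 4) := by gcongr
        _ = B * (β / 4 * S) := by ring
        _ ≤ _ := by gcongr
    exact_mod_cast h3
  have hunseen : ∀ V Y : Finset (Fin S), S < B * V.card → (∀ p ∈ V, ∀ i ∈ Y, ¬ Γ p i) →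
      (Y.card : ℝ) ≤ η * S := by
    intro V Y hV hY
    have h1 := card_unseen_le hΓ V Y hV hY
    have h2 : (B : ℝ) * Y.card ≤ S := by exact_mod_cast h1
    have h3 : (B : ℝ) * Y.card ≤ B * (η * S) := by nlinarith
    exact le_of_mul_le_mul_left h3 hB0
  have hExc : ∀ u ∈ G, (Exc u).card ≤ K := by
    intro u hu
    obtain ⟨hu1, hu2⟩ := mem_inter.1 hu
    have h1 : ((univ.filter fun i => ¬ P0 i u).card : ℝ) ≤ η * S :=
      hunseen (L u) _ (hlarge u hu1 _ (hg2 u)) fun p hp i hi hpi =>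
        (mem_filter.1 hi).2 ⟨p, hp, hpi⟩
    have h2 : ((univ.filter fun i => ¬ P1 i u).card : ℝ) ≤ η * S :=
      hunseen (U u) _ (hlarge u hu1 _ (hg1 u)) fun p hp i hi hpi =>
        (mem_filter.1 hi).2 ⟨p, hp, hpi⟩
    have h3 : ((univ.filter fun i => u ∈ N i).card : ℝ) ≤ η * S := (mem_filter.1 hu2).2
    have h4 : ((Exc u).card : ℝ) ≤ (univ.filter fun i => ¬ P0 i u).card +
        (univ.filter fun i => ¬ P1 i u).card + (univ.filter fun i => u ∈ N i).card := by
      exact_mod_cast (card_union_le _ _).trans (Nat.add_le_add_right (card_union_le _ _) _)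
    exact (Nat.le_floor (by linarith)).trans hK
  obtain ⟨F, hFG, hF1, hF2⟩ := exists_large_fibre G Exc hExc y hy hy1
  -- Points of `F` agree on their common exceptional set, so a coordinate where they differ is
  -- exceptional for neither. Thus `g` is strictly monotone on `F` for the reversed lexicographic
  -- order.
  have hlt : ∀ u ∈ F, ∀ v ∈ F, ∀ i, (∀ j < i, u j = v j) → u i = false → v i = true →
      g v < g u := by
    intro u hu v hv i huv hi hi'
    obtain ⟨h1, h2⟩ := hF2 u hu v hv
    have hiu : i ∉ Exc u := fun hi'' => by
      have := h2 i hi''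
      rw [hi, hi'] at this
      exact Bool.false_ne_true this
    have hiv : i ∉ Exc v := h1 ▸ hiu
    simp only [Exc, mem_union, mem_filter, mem_univ, true_and, not_or, not_not] at hiu hiv
    exact hN' i u v huv hi hi' hiu.1.1 hiv.1.2 hiu.2 hiv.2
  have hinj : Set.InjOn g F := by
    intro u hu v hv huv
    by_contra hne
    have hex : ∃ i, u i ≠ v i := by
      by_contra! hcon
      exact hne (funext hcon)
    set D := univ.filter fun i => u i ≠ v i with hD
    have hDne : D.Nonempty := by
      obtain ⟨i, hi⟩ := hex
      exact ⟨i, by simpa [hD] using hi⟩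
    have hmin : u (D.min' hDne) ≠ v (D.min' hDne) := by
      exact (mem_filter.1 (D.min'_mem hDne)).2
    have hpre : ∀ j < D.min' hDne, u j = v j := by
      intro j hj
      by_contra hne'
      exact (D.min'_le j (by rw [hD]; simpa using hne')).not_gt hj
    cases hu0 : u (D.min' hDne) <;> cases hv0 : v (D.min' hDne)
    · exact hmin (hu0.trans hv0.symm)
    · have := hlt u hu v hv _ hpre hu0 hv0
      omega
    · have := hlt v hv u hu _ (fun j hj => (hpre j hj).symm) hv0 hu0
      omega
    · exact hmin (hu0.trans hv0.symm)
  have hFpos : 0 < F.card := by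
    by_contra h0
    have h0 : F.card = 0 := by omega
    rw [h0, Nat.cast_zero, zero_mul] at hF1
    have : (0 : ℝ) < G.card := lt_of_lt_of_le (by positivity) hGcard
    have : (0 : ℝ) < G.card * y ^ K := by positivity
    linarith
  have hbig : ∃ u ∈ F, F.card ≤ g u + 1 := by
    by_contra! hcon
    have h1 : F.card ≤ (range (F.card - 1)).card := by
      refine card_le_card_of_injOn g (fun u hu => ?_) hinj
      have := hcon u hu
      rw [coe_range, Set.mem_Iio]
      omega
    rw [card_range] at h1
    omega
  obtain ⟨u, hu, hFu⟩ := hbig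
  have hugood : u ∈ good := (mem_inter.1 (hFG hu)).1
  have hUpos : (U u).Nonempty := by
    have := hlarge u hugood _ (hg1 u)
    rw [← card_pos]
    by_contra h0
    have h0 : (U u).card = 0 := by omega
    simp only [U] at h0
    rw [h0] at this
    omega
  obtain ⟨p, hp⟩ := hUpos
  simp only [U, q, mem_filter, mem_univ, true_and] at hp
  refine ⟨(u, p), hp.1, ?_⟩
  have h1 : (F.card : ℝ) ≤ h (u, p) + 1 := by
    have : F.card ≤ h (u, p) + 1 := by omega
    exact_mod_cast this
  calc β / 4 * 2 ^ S * y ^ K ≤ G.card * y ^ K := by gcongr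
    _ ≤ F.card * (1 + 2 * y) ^ S := hF1
    _ ≤ _ := by gcongr

/-- If all walks are shorter than `T`, the length of the longest walk is a height function. -/
theorem exists_height {α : Type*} (R : α → α → Prop) (T : ℕ)
    (hT : ∀ k a b, Steps R k a b → k ≤ T) :
    ∃ h : α → ℕ, (∀ a b, R a b → h b < h a) ∧ ∀ a, ∃ b, Steps R (h a) a b := by
  classical
  refine ⟨fun a => Nat.findGreatest (fun k => ∃ b, Steps R k a b) T, fun a b hab => ?_, fun a => ?_⟩
  · obtain ⟨c, hc⟩ := Nat.findGreatest_spec (P := fun k => ∃ c, Steps R k b c) (Nat.zero_le T)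
      ⟨b, rfl⟩
    have hac : Steps R (Nat.findGreatest (fun k => ∃ c, Steps R k b c) T + 1) a c := ⟨b, hab, hc⟩
    exact Nat.le_findGreatest (P := fun k => ∃ c, Steps R k a c) (hT _ _ _ hac) ⟨c, hac⟩
  · exact Nat.findGreatest_spec (P := fun k => ∃ c, Steps R k a c) (Nat.zero_le T) ⟨a, rfl⟩

/-- For all `ε, β > 0` there are graphs of bounded degree on `S 2 ^ S` nodes in which every
`β`-fraction of the nodes contains a walk of length about `2 ^ ((1 - ε) S)`. -/
theorem exists_depthRobust (ε β : ℝ) (hε : 0 < ε) (hβ : 0 < β) : ∃ δ : ℕ, ∀ S : ℕ, 1 ≤ S →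
    ∃ H : (Fin S → Bool) × Fin S → (Fin S → Bool) × Fin S → Prop, WellFounded H ∧
      OutDegLE δ H ∧ OutDegLE δ (fun x y => H y x) ∧
      ∀ Q : Finset ((Fin S → Bool) × Fin S), β * (2 ^ S * S) ≤ Q.card →
        ∃ k a b, Steps (Within Q H) k a b ∧ β / 4 * 2 ^ ((1 - ε) * S) ≤ (k : ℝ) + 1 := by
  set z : ℝ := 2 ^ (ε / 2) with hz
  have hz1 : 1 < z := Real.one_lt_rpow (by norm_num) (by positivity)
  set y : ℝ := min 1 ((z - 1) / 2) with hy
  have hy0 : 0 < y := lt_min one_pos (by linarith)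
  have hy1 : y ≤ 1 := min_le_left _ _
  have hyz : 1 + 2 * y ≤ z := by
    have : y ≤ (z - 1) / 2 := min_le_right _ _
    linarith
  set l : ℝ := Real.logb 2 y⁻¹ with hl
  have hl0 : 0 ≤ l := Real.logb_nonneg (by norm_num) ((one_le_inv₀ hy0).2 hy1)
  -- The loss is `2 ^ (ε * S)`: half of it from `(1 + 2y) ^ S`, by the choice of `y`, and half from
  -- `y ^ K`, because `3 * η * l ≤ ε / 2`.
  set η : ℝ := ε / (6 * (l + 1)) with hη
  have hη0 : 0 < η := by positivity
  have hηl : 3 * η * l ≤ ε / 2 := by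
    rw [hη]
    have : 3 * (ε / (6 * (l + 1))) * l = ε / 2 * (l / (l + 1)) := by field_simp; ring
    rw [this]
    have : l / (l + 1) ≤ 1 := by rw [div_le_one (by positivity)]; linarith
    nlinarith
  obtain ⟨B, hB⟩ := exists_nat_gt (max (4 / β) (1 / η))
  obtain ⟨A, hA⟩ := exists_nat_ge (4 / (β * η))
  have hB1 : 4 < B * β := by
    have := (le_max_left _ _).trans_lt hB
    rwa [div_lt_iff₀ hβ] at this
  have hB2 : 1 ≤ B * η := by
    have := (le_max_right _ _).trans_lt hB
    rw [div_lt_iff₀ hη0] at this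
    exact this.le
  have hA1 : 4 ≤ A * (β * η) := by rwa [div_le_iff₀ (by positivity)] at hA
  obtain ⟨δ, hδ⟩ := exists_isExpander B
  obtain ⟨δ', hδ'⟩ := exists_isExpander A
  refine ⟨δ * (δ' * δ), fun S hS => ?_⟩
  obtain ⟨Γ, hΓ⟩ := hδ (Fin S)
  choose Ex hEx using fun i : Fin S => hδ' ({j // i < j} → Bool)
  refine ⟨CubeEdge Γ Ex, wellFounded_cubeEdge, outDegLE_cubeEdge hΓ hEx, inDegLE_cubeEdge hΓ hEx,
    fun Q hQ => ?_⟩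
  by_contra! hcon
  have hT : ∀ k a b, Steps (Within Q (CubeEdge Γ Ex)) k a b →
      k ≤ ⌈β / 4 * 2 ^ ((1 - ε) * S)⌉₊ := by
    intro k a b hk
    have h1 := hcon k a b hk
    have h2 := Nat.le_ceil (β / 4 * 2 ^ ((1 - ε) * S))
    have h3 : (k : ℝ) ≤ (⌈β / 4 * 2 ^ ((1 - ε) * S)⌉₊ : ℝ) := by linarith
    exact_mod_cast h3
  obtain ⟨h, hh, hh'⟩ := exists_height _ _ hT
  obtain ⟨a, haQ, ha⟩ := exists_large_height hΓ hEx hS hβ hy0 hy1 hB1 hB2 hA1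
    (K := ⌊3 * η * S⌋₊) le_rfl Q hQ h hh
  obtain ⟨b, hb⟩ := hh' a
  have hlt := hcon _ a b hb
  have hyK : (2 : ℝ) ^ (-(ε / 2 * S)) ≤ y ^ ⌊3 * η * S⌋₊ := by
    have h1 : y = 2 ^ (-l) := by
      rw [hl, Real.rpow_neg (by norm_num), Real.rpow_logb (by norm_num) (by norm_num)
        (inv_pos.2 hy0), inv_inv]
    rw [h1, ← Real.rpow_natCast, ← Real.rpow_mul (by norm_num)]
    apply Real.rpow_le_rpow_of_exponent_le (by norm_num)
    have h2 : (⌊3 * η * S⌋₊ : ℝ) ≤ 3 * η * S := Nat.floor_le (by positivity)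
    have h3 : l * ⌊3 * η * S⌋₊ ≤ l * (3 * η * S) := by gcongr
    have h4 : 3 * η * l * S ≤ ε / 2 * S := by gcongr
    linarith
  have hzS : (1 + 2 * y) ^ S ≤ (2 : ℝ) ^ (ε / 2 * S) := by
    rw [Real.rpow_mul (by norm_num), Real.rpow_natCast, ← hz]
    gcongr
  have hfin : β / 4 * 2 ^ S * 2 ^ (-(ε / 2 * S)) ≤ (h a + 1) * (2 : ℝ) ^ (ε / 2 * S) := by
    calc _ ≤ β / 4 * 2 ^ S * y ^ ⌊3 * η * S⌋₊ := by gcongr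
      _ ≤ (h a + 1) * (1 + 2 * y) ^ S := ha
      _ ≤ _ := by gcongr
  have heq : β / 4 * (2 : ℝ) ^ ((1 - ε) * S) * 2 ^ (ε / 2 * S) =
      β / 4 * 2 ^ S * 2 ^ (-(ε / 2 * S)) := by
    rw [mul_assoc, mul_assoc, ← Real.rpow_add (by norm_num), ← Real.rpow_natCast 2 S,
      ← Real.rpow_add (by norm_num)]
    congr 2; ring
  have hpos : (0 : ℝ) < 2 ^ (ε / 2 * S) := by positivity
  have : β / 4 * (2 : ℝ) ^ ((1 - ε) * S) * 2 ^ (ε / 2 * S) <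
      β / 4 * (2 : ℝ) ^ ((1 - ε) * S) * 2 ^ (ε / 2 * S) := by
    calc _ ≤ (h a + 1) * (2 : ℝ) ^ (ε / 2 * S) := heq.trans_le hfin
      _ < _ := by gcongr
  exact lt_irrefl _ this

end DepthRobust

/-! ### Flooding a cluster along a walk of clusters. -/

section Growth

variable {ρ : Type} [Fintype ρ] {A δ : ℕ} {Ex : ρ → ρ → Prop}

open Classical in
/-- A largest set `X` of at most `1 / A` of all points that does not double outside `B`. -/
theorem exists_maximal_nonexpanding (hEx : IsExpander A δ Ex) (hA : 8 ≤ A) (B : Finset ρ)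
    (hr : 0 < Fintype.card ρ) :
    ∃ X : Finset ρ, (4 * B.card ≤ Fintype.card ρ → A * X.card ≤ 2 * X.card + B.card) ∧
      ∀ Z : Finset ρ, Disjoint Z X → Z.Nonempty → A * (X.card + Z.card) ≤ Fintype.card ρ →
        2 * Z.card ≤ ((univ.filter fun y => ∃ x ∈ Z, Ex x y) \ B).card := by
  set T := univ.filter fun X : Finset ρ => A * X.card ≤ Fintype.card ρ ∧
    ((univ.filter fun y => ∃ x ∈ X, Ex x y) \ B).card ≤ 2 * X.card with hT
  have hTne : T.Nonempty := ⟨∅, by simp [hT]⟩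
  obtain ⟨X, hXT, hmax⟩ := exists_max_image T card hTne
  obtain ⟨-, hX1, hX2⟩ := mem_filter.1 hXT
  refine ⟨X, fun hB => ?_, fun Z hZX hZ hAZ => ?_⟩
  -- Together with `B`, the neighbours of `X` number at most `2|X| + |B|`. Were `A|X|` larger, the
  -- expander would provide an edge leaving this union.
  · set Γ := univ.filter fun y => ∃ x ∈ X, Ex x y with hΓ
    set Y := (Γ ∪ B)ᶜ with hY
    have hYc : Y.card + (Γ ∪ B).card = Fintype.card ρ := by
      rw [hY, card_compl]; have := card_le_univ (Γ ∪ B); omega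
    have hU : (Γ ∪ B).card = (Γ \ B).card + B.card := by
      rw [card_sdiff_add_card]
    have h1 : Fintype.card ρ < A * Y.card := by
      have h2 : 8 * X.card ≤ Fintype.card ρ := (Nat.mul_le_mul_right _ hA).trans hX1
      have h3 : 8 * Y.card ≤ A * Y.card := Nat.mul_le_mul_right _ hA
      omega
    by_contra hcon
    obtain ⟨x, hx, y, hy, hxy⟩ := hEx.edge X Y (by omega) h1
    rw [hY, mem_compl, mem_union, not_or] at hy
    exact hy.1 (mem_filter.2 ⟨mem_univ _, x, hx, hxy⟩)
  -- Otherwise `X ∪ Z` would be a larger non-doubling set.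
  · by_contra! hlt
    have hcard : (X ∪ Z).card = X.card + Z.card := card_union_of_disjoint hZX.symm
    have hmem : X ∪ Z ∈ T := by
      rw [hT, mem_filter, hcard]
      refine ⟨mem_univ _, hAZ, ?_⟩
      have hsub : ((univ.filter fun y => ∃ x ∈ X ∪ Z, Ex x y) \ B) ⊆
          ((univ.filter fun y => ∃ x ∈ X, Ex x y) \ B) ∪
          ((univ.filter fun y => ∃ x ∈ Z, Ex x y) \ B) := by
        intro y hy
        simp only [mem_sdiff, mem_filter, mem_univ, true_and, mem_union] at hy ⊢
        obtain ⟨⟨x, hx | hx, hxy⟩, hyB⟩ := hy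
        · exact Or.inl ⟨⟨x, hx, hxy⟩, hyB⟩
        · exact Or.inr ⟨⟨x, hx, hxy⟩, hyB⟩
      have := (card_le_card hsub).trans (card_union_le _ _)
      omega
    have := hmax _ hmem
    have := hZ.card_pos
    omega

/-- The parameters of a graph of clusters: the graph `H` of clusters has outdegree at most `d` and
contains a walk of length `L + 2` in every `β`-fraction of the clusters, and `Ex` is an expander
which joins the nodes of adjacent clusters. -/
structure IsClusterGraph (H Ex : ρ → ρ → Prop) (d A δ L : ℕ) (β : ℝ) : Prop where
  wf : WellFounded fun a b => H b a
  deg : OutDegLE d H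
  expander : IsExpander A δ Ex
  le_A : 2 * d + 16 ≤ A
  le_card : 4 * A ≤ Fintype.card ρ
  card_le : Fintype.card ρ ≤ 2 ^ L
  walk : ∀ Q : Finset ρ, β * Fintype.card ρ ≤ Q.card →
    ∃ a b, Steps (Within Q H) (L + 2) a b

variable {H : ρ → ρ → Prop} {d L : ℕ} {β : ℝ}

theorem IsClusterGraph.card_pos (h : IsClusterGraph H Ex d A δ L β) : 0 < Fintype.card ρ := by
  have := h.le_card
  have := h.le_A
  omega

open Classical in
/-- After the deletion of `D v` from the cluster `v`, all nodes outside few bad ones expand in all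
adjacent clusters with few deleted nodes. -/
theorem exists_bad_sets (h : IsClusterGraph H Ex d A δ L β) (D : ρ → Finset ρ) (c₁ : ℝ)
    (hc : 0 ≤ c₁) (hc' : c₁ ≤ 1 / 32) (U : Finset ρ)
    (hU : ∀ v ∈ U, ((D v).card : ℝ) ≤ c₁ * Fintype.card ρ) :
    ∃ Bad : ρ → Finset ρ, (∀ v, D v ⊆ Bad v) ∧
      (∀ v ∈ U, ((Bad v).card : ℝ) ≤ 2 * c₁ * Fintype.card ρ) ∧
      ∀ v v', v ∈ U → v' ∈ U → H v v' → ∀ Z : Finset ρ, Disjoint Z (Bad v) →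
        Z.card ≤ Fintype.card ρ / (2 * A) →
        2 * Z.card ≤ ((univ.filter fun y => ∃ x ∈ Z, Ex x y) \ Bad v').card := by
  set r := Fintype.card ρ with hr
  have hr0 : 0 < r := h.card_pos
  have hA16 : 16 ≤ A := by have := h.le_A; omega
  choose X hX1 hX2 using fun B => exists_maximal_nonexpanding h.expander (by omega) B hr0
  -- The recursion runs against the edges. A node of `v` is bad if it is deleted or lies, for some
  -- successor `v'` in `U`, in the maximal set that fails to double outside `Bad v'`.
  let Bad : ρ → Finset ρ := h.wf.fix fun v ih =>
    D v ∪ univ.biUnion fun v' => if hv : H v v' ∧ v' ∈ U then X (ih v' hv.1) else ∅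
  have hBad : ∀ v, Bad v = D v ∪ univ.biUnion fun v' => if H v v' ∧ v' ∈ U then X (Bad v') else ∅ := by
    intro v
    have := h.wf.fix_eq (fun v (ih : ∀ y, H v y → Finset ρ) =>
      D v ∪ univ.biUnion fun v' => if hv : H v v' ∧ v' ∈ U then X (ih v' hv.1) else ∅) v
    simp only [Bad]
    rw [this]
    simp only [dite_eq_ite]
  have hAd : (2 * d + 16 : ℝ) ≤ A := by exact_mod_cast h.le_A
  have hcard : ∀ v, v ∈ U → ((Bad v).card : ℝ) ≤ 2 * c₁ * r := by
    intro v
    induction v using h.wf.induction with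
    | _ v ih =>
    intro hv
    obtain ⟨s, hs, hs'⟩ := h.deg v
    have hsub : Bad v ⊆ D v ∪ (s.filter fun v' => H v v' ∧ v' ∈ U).biUnion fun v' => X (Bad v') := by
      rw [hBad]
      refine union_subset_union_right fun p hp => ?_
      obtain ⟨v', -, hv'⟩ := mem_biUnion.1 hp
      split_ifs at hv' with hH
      · exact mem_biUnion.2 ⟨v', mem_filter.2 ⟨hs' v' hH.1, hH⟩, hv'⟩
      · simp at hv'
    have hXb : ∀ v' ∈ s.filter fun v' => H v v' ∧ v' ∈ U,
        ((X (Bad v')).card : ℝ) ≤ 2 * c₁ * r / (A - 2) := by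
      intro v' hv'
      obtain ⟨-, hH, hvU⟩ := mem_filter.1 hv'
      have h1 := ih v' hH hvU
      have hr0' : (0 : ℝ) ≤ r := by positivity
      have h2 : 4 * (Bad v').card ≤ r := by
        have : (4 * (Bad v').card : ℝ) ≤ r := by nlinarith
        exact_mod_cast this
      have h3 : ((A * (X (Bad v')).card : ℕ) : ℝ) ≤ (2 * (X (Bad v')).card + (Bad v').card : ℕ) := by
        exact_mod_cast hX1 _ h2
      push_cast at h3
      rw [le_div_iff₀ (by linarith)]
      linarith
    have hdpos : (0 : ℝ) ≤ d := by positivity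
    calc ((Bad v).card : ℝ) ≤ (D v).card +
          ((s.filter fun v' => H v v' ∧ v' ∈ U).biUnion fun v' => X (Bad v')).card := by
            exact_mod_cast (card_le_card hsub).trans (card_union_le _ _)
      _ ≤ c₁ * r + d * (2 * c₁ * r / (A - 2)) := by
          apply add_le_add (hU v hv)
          refine (Nat.cast_le.2 card_biUnion_le).trans ?_
          push_cast
          refine (sum_le_card_nsmul _ _ _ hXb).trans ?_
          rw [nsmul_eq_mul]
          have h1 : (s.filter fun v' => H v v' ∧ v' ∈ U).card ≤ d :=
            (card_filter_le _ _).trans hs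
          have h2 : ((s.filter fun v' => H v v' ∧ v' ∈ U).card : ℝ) ≤ d := by exact_mod_cast h1
          have h3 : 0 ≤ 2 * c₁ * r / ((A : ℝ) - 2) := div_nonneg (by positivity) (by linarith)
          gcongr
      -- The at most `d` successors contribute `2 * c₁ * r / (A - 2)` each, and `2 * d ≤ A - 2`; so
      -- the recursion does not accumulate losses.
      _ ≤ c₁ * r + c₁ * r := by
          have h1 : 0 ≤ c₁ * r := by positivity
          have h2 : d * (2 * c₁ * r / ((A : ℝ) - 2)) ≤ c₁ * r := by
            rw [← mul_div_assoc, div_le_iff₀ (by linarith)]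
            nlinarith
          linarith
      _ = 2 * c₁ * r := by ring
  refine ⟨Bad, fun v => ?_, hcard, ?_⟩
  · rw [hBad]; exact subset_union_left
  · intro v v' hv hv' hH Z hZ hZc
    rcases Z.eq_empty_or_nonempty with rfl | hZne
    · simp
    have hXB : X (Bad v') ⊆ Bad v := by
      rw [hBad v]
      intro p hp
      refine mem_union_right _ (mem_biUnion.2 ⟨v', mem_univ _, ?_⟩)
      rw [if_pos ⟨hH, hv'⟩]
      exact hp
    refine hX2 (Bad v') Z (disjoint_of_subset_right hXB hZ) hZne ?_
    have h1 := hcard v' hv'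
    have hr0' : (0 : ℝ) ≤ r := by positivity
    have h2 : 4 * (Bad v').card ≤ r := by
      have : (4 * (Bad v').card : ℝ) ≤ r := by nlinarith
      exact_mod_cast this
    have h2' : 16 * (Bad v').card ≤ r := by
      have : (16 * (Bad v').card : ℝ) ≤ r := by nlinarith
      exact_mod_cast this
    have h3 := hX1 _ h2
    have h4 : 16 * (X (Bad v')).card ≤ A * (X (Bad v')).card := Nat.mul_le_mul_right _ hA16
    have h5 : A * Z.card * 2 ≤ r := by
      have := (Nat.le_div_iff_mul_le (by omega)).1 hZc
      calc A * Z.card * 2 = Z.card * (2 * A) := by ring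
        _ ≤ r := this
    rw [mul_add]
    omega

open Classical in
/-- A node outside the bad sets reaches nearly all nodes at the end of every walk of clusters. -/
theorem dense_of_steps (h : IsClusterGraph H Ex d A δ L β) {D Bad : ρ → Finset ρ} {c₁ : ℝ}
    (hc' : c₁ ≤ 1 / 32) {U : Finset ρ} (hDB : ∀ v, D v ⊆ Bad v)
    (hB : ∀ v ∈ U, ((Bad v).card : ℝ) ≤ 2 * c₁ * Fintype.card ρ)
    (hgrow : ∀ v v', v ∈ U → v' ∈ U → H v v' → ∀ Z : Finset ρ, Disjoint Z (Bad v) →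
        Z.card ≤ Fintype.card ρ / (2 * A) →
        2 * Z.card ≤ ((univ.filter fun y => ∃ x ∈ Z, Ex x y) \ Bad v').card)
    (P : ρ → ρ → Prop) (hP : ∀ v v' p p', H v v' → Ex p p' → p ∉ D v → p' ∉ D v' →
      P v p → P v' p') {v v' : ρ} (hs : Steps (Within U H) (L + 2) v v')
    (hv : ∃ p, p ∉ Bad v ∧ P v p) :
    (1 - 1 / A - 2 * c₁) * Fintype.card ρ ≤
      ((univ.filter fun p => p ∉ Bad v' ∧ P v' p).card : ℝ) := by
  set r := Fintype.card ρ with hr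
  have hr0 : 0 < r := h.card_pos
  have hr0' : (0 : ℝ) < r := by exact_mod_cast hr0
  have hA16 : 16 ≤ A := by have := h.le_A; omega
  have hA16' : (16 : ℝ) ≤ A := by exact_mod_cast hA16
  let s : ρ → Finset ρ := fun v => univ.filter fun p => p ∉ Bad v ∧ P v p
  -- The size up to which `hgrow` guarantees doubling; beyond it only the expander property is used.
  set K := r / (2 * A) with hK
  have hK1 : r ≤ 4 * A * K := by
    have h1 := Nat.div_add_mod r (2 * A)
    have h2 := Nat.mod_lt r (by omega : 0 < 2 * A)
    rw [← hK] at h1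
    have h3 : 1 ≤ K := by
      rw [hK, Nat.le_div_iff_mul_le (by omega)]
      have := h.le_card
      omega
    have h4 : 2 * A ≤ 2 * A * K := Nat.le_mul_of_pos_right _ h3
    have h5 : 4 * A * K = 2 * A * K + 2 * A * K := by ring
    omega
  have hdouble : ∀ v v', Within U H v v' → min (s v).card K * 2 ≤ (s v').card := by
    rintro v v' ⟨hv, hv', hH⟩
    obtain ⟨Z, hZs, hZc⟩ := exists_subset_card_eq (min_le_left (s v).card K)
    have hZB : Disjoint Z (Bad v) := by
      rw [disjoint_left]
      intro p hp
      exact (mem_filter.1 (hZs hp)).2.1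
    have := hgrow v v' hv hv' hH Z hZB (hZc ▸ min_le_right _ _)
    rw [hZc] at this
    rw [mul_comm]
    refine this.trans (card_le_card fun y hy => ?_)
    simp only [mem_sdiff, mem_filter, mem_univ, true_and] at hy
    obtain ⟨⟨x, hx, hxy⟩, hyB⟩ := hy
    have hx' := (mem_filter.1 (hZs hx)).2
    exact mem_filter.2 ⟨mem_univ _, hyB, hP v v' x y hH hxy (fun h => hx'.1 (hDB v h))
      (fun h => hyB (hDB v' h)) hx'.2⟩
  have hgrow' : ∀ k v v', Steps (Within U H) k v v' → min (2 ^ k * (s v).card) K ≤ (s v').card := by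
    intro k
    induction k with
    | zero => intro v v' hv; cases hv; simp
    | succ k ih =>
      rintro v v' ⟨c, hvc, hcv⟩
      have h1 := hdouble v c hvc
      have h2 := ih c v' hcv
      refine le_trans ?_ h2
      rcases le_total (s v).card K with hle | hle
      · rw [min_eq_left hle] at h1
        apply min_le_min_right
        calc 2 ^ (k + 1) * (s v).card = 2 ^ k * ((s v).card * 2) := by ring
          _ ≤ 2 ^ k * (s c).card := Nat.mul_le_mul_left _ h1
      · rw [min_eq_right hle] at h1
        refine (min_le_right _ _).trans (le_min ?_ le_rfl)
        calc K ≤ (s c).card := by omega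
          _ ≤ 2 ^ k * (s c).card := Nat.le_mul_of_pos_left _ (by positivity)
  -- If both alternatives failed, the expander would join `s v` to a point outside `s v' ∪ Bad v'`;
  -- but `P` propagates to that point.
  have hstep : ∀ v v', Within U H v v' → A * (s v).card ≤ (s v').card + (Bad v').card ∨
      A * r ≤ r + A * ((s v').card + (Bad v').card) := by
    rintro v v' ⟨hv, hv', hH⟩
    set Y := (s v' ∪ Bad v')ᶜ with hY
    have hYc : Y.card + (s v' ∪ Bad v').card = r := by
      rw [hY, card_compl]; have := card_le_univ (s v' ∪ Bad v'); omega
    have hle := card_union_le (s v') (Bad v')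
    by_contra! hcon
    obtain ⟨h1, h2⟩ := hcon
    have hYA : r < A * Y.card := by
      have h3 : A * (s v' ∪ Bad v').card ≤ A * ((s v').card + (Bad v').card) :=
        Nat.mul_le_mul_left _ hle
      have h4 : A * r = A * Y.card + A * (s v' ∪ Bad v').card := by rw [← hYc]; ring
      omega
    obtain ⟨x, hx, y, hy, hxy⟩ := h.expander.edge (s v) Y (by omega) hYA
    rw [hY, mem_compl, mem_union, not_or] at hy
    have hx' := (mem_filter.1 hx).2
    exact hy.1 (mem_filter.2 ⟨mem_univ _, hy.2, hP v v' x y hH hxy (fun h => hx'.1 (hDB v h))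
      (fun h => hy.2 (hDB v' h)) hx'.2⟩)
  -- As `r ≤ 2 ^ L`, the first `L` steps double the reached set up to `K`. One more step reaches `r
  -- / 8` nodes, and the last one all but `r / A` of the nodes outside `Bad`.
  obtain ⟨w, hw1, hw2⟩ := hs.split
  obtain ⟨w', hww', hw'⟩ := hw2
  obtain ⟨w'', hw'v', heq⟩ := hw'
  have heq : w'' = v' := heq
  subst heq
  have hsK : K ≤ (s w).card := by
    have h1 := hgrow' L v w hw1
    obtain ⟨p, hp⟩ := hv
    have h2 : 0 < (s v).card := Finset.card_pos.2 ⟨p, mem_filter.2 ⟨mem_univ _, hp⟩⟩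
    have h3 : K ≤ 2 ^ L * (s v).card := by
      calc K ≤ r := Nat.div_le_self _ _
        _ ≤ 2 ^ L := h.card_le
        _ ≤ _ := Nat.le_mul_of_pos_right _ h2
    rwa [min_eq_right h3] at h1
  have hB1 := hB w' hww'.2.1
  have hB2 := hB w'' hw'v'.2.1
  have h8 : (r : ℝ) / 8 ≤ (s w').card := by
    rcases hstep w w' hww' with h1 | h1
    · have h2 : (r : ℝ) ≤ 4 * A * K := by exact_mod_cast hK1
      have h3 : (A : ℝ) * (s w).card ≤ (s w').card + (Bad w').card := by exact_mod_cast h1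
      have h4 : (A : ℝ) * K ≤ A * (s w).card := by gcongr
      nlinarith
    · have h2 : (A : ℝ) * r ≤ r + A * ((s w').card + (Bad w').card) := by exact_mod_cast h1
      have h3 : (A : ℝ) * (r - (s w').card - (Bad w').card) ≤ r := by linarith
      by_contra! hlt
      have h4 : (13 / 16 : ℝ) * r ≤ r - (s w').card - (Bad w').card := by nlinarith
      have h5 : (16 : ℝ) * ((13 / 16 : ℝ) * r) ≤ A * (r - (s w').card - (Bad w').card) := by gcongr
      linarith
  rcases hstep w' w'' hw'v' with h1 | h1
  · have h3 : (A : ℝ) * (s w').card ≤ (s w'').card + (Bad w'').card := by exact_mod_cast h1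
    have h4 : (16 : ℝ) * (r / 8) ≤ A * (s w').card := by gcongr
    have h5 : (0 : ℝ) ≤ 1 / A * r := by positivity
    show _ ≤ ((s w'').card : ℝ)
    nlinarith
  · have h2 : (A : ℝ) * r ≤ r + A * ((s w'').card + (Bad w'').card) := by exact_mod_cast h1
    have h3 : (r : ℝ) ≤ 1 / A * r + ((s w'').card + (Bad w'').card) := by
      have hA0 : (0 : ℝ) < A := by linarith
      have h6 : (A : ℝ) * r ≤ A * (1 / A * r + ((s w'').card + (Bad w'').card)) := by
        rw [mul_add, ← mul_assoc, mul_one_div_cancel hA0.ne', one_mul]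
        exact h2
      exact le_of_mul_le_mul_left h6 hA0
    show _ ≤ ((s w'').card : ℝ)
    nlinarith

/-- All but a `β`-fraction of the clusters of `Q` are starting points of long walks in `Q`. -/
theorem IsClusterGraph.card_start (h : IsClusterGraph H Ex d A δ L β) (Q T : Finset ρ)
    (hT : ∀ v ∈ Q, v ∉ T → ¬ ∃ w, Steps (Within Q H) (L + 2) v w) :
    (Q.card : ℝ) - β * Fintype.card ρ ≤ T.card := by
  classical
  by_contra! hcon
  have h1 : Q.card ≤ T.card + (Q \ T).card := by
    have := card_sdiff_add_card Q T
    have := card_le_card (subset_union_left (s₁ := Q) (s₂ := T))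
    omega
  have h2 : (Q.card : ℝ) ≤ T.card + (Q \ T).card := by exact_mod_cast h1
  obtain ⟨a, b, hab⟩ := h.walk (Q \ T) (by linarith)
  have hab' := hab
  obtain ⟨c, ⟨ha, -⟩, -⟩ := hab'
  rw [mem_sdiff] at ha
  exact hT a ha.1 ha.2 ⟨b, hab.mono fun x y ⟨hx, hy, hxy⟩ =>
    ⟨(mem_sdiff.1 hx).1, (mem_sdiff.1 hy).1, hxy⟩⟩

theorem IsClusterGraph.card_end (h : IsClusterGraph H Ex d A δ L β) (Q T : Finset ρ)
    (hT : ∀ v ∈ Q, v ∉ T → ¬ ∃ w, Steps (Within Q H) (L + 2) w v) :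
    (Q.card : ℝ) - β * Fintype.card ρ ≤ T.card := by
  classical
  by_contra! hcon
  have h1 : Q.card ≤ T.card + (Q \ T).card := by
    have := card_sdiff_add_card Q T
    have := card_le_card (subset_union_left (s₁ := Q) (s₂ := T))
    omega
  have h2 : (Q.card : ℝ) ≤ T.card + (Q \ T).card := by exact_mod_cast h1
  obtain ⟨a, b, hab⟩ := h.walk (Q \ T) (by linarith)
  obtain ⟨c, -, d, ⟨-, hd, -⟩, rfl⟩ := Steps.split (k := L + 1) (l := 1) hab
  rw [mem_sdiff] at hd
  exact hT d hd.1 hd.2 ⟨a, hab.mono fun x y ⟨hx, hy, hxy⟩ =>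
    ⟨(mem_sdiff.1 hx).1, (mem_sdiff.1 hy).1, hxy⟩⟩

end Growth

/-! ### Two copies joined by transposing edges. -/

section HalfCore

variable {ρ : Type} [Fintype ρ] {H Ex : ρ → ρ → Prop} {d A δ L : ℕ} {β : ℝ}

theorem card_not_le {ι : Type*} [Fintype ι] (D : ι → ℕ) (U : Finset ι) (t M : ℝ)
    (hU : ∀ v, v ∉ U → t ≤ D v) (hM : (∑ v, (D v : ℝ)) ≤ M) [DecidableEq ι] :
    (Uᶜ.card : ℝ) * t ≤ M := by
  refine le_trans ?_ hM
  rw [← nsmul_eq_mul]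
  exact (card_nsmul_le_sum Uᶜ (fun v => (D v : ℝ)) t fun v hv => hU v (mem_compl.1 hv)).trans
    (sum_le_sum_of_subset_of_nonneg (subset_univ _) fun _ _ _ => by positivity)

open Classical in
/-- Two copies `a`, `b` of a cluster graph, the position `p` of the cluster `v` of the first copy
being joined to the position `v` of those clusters `w` of the second copy with `Ex p w`. After the
deletion of few nodes nearly all nodes of the first copy reach most nodes of the second copy. -/
theorem half_core (h : IsClusterGraph H Ex d A δ L β) {c c₁ : ℝ}
    (hc₁ : 0 < c₁) (hc₁' : c₁ ≤ 1 / 32) (hβ : β ≤ 1 / 32)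
    {V : Type} (R : V → V → Prop) (hrefl : ∀ x, R x x) (htrans : ∀ x y z, R x y → R y z → R x z)
    (a b : ρ → ρ → V) (D₁ D₂ : ρ → Finset ρ)
    (hD₁ : ∑ v, ((D₁ v).card : ℝ) ≤ c * (Fintype.card ρ) ^ 2)
    (hD₂ : ∑ v, ((D₂ v).card : ℝ) ≤ c * (Fintype.card ρ) ^ 2)
    (ha : ∀ v v' p p', H v v' → Ex p p' → p ∉ D₁ v → p' ∉ D₁ v' → R (a v p) (a v' p'))
    (hb : ∀ v v' p p', H v v' → Ex p p' → p ∉ D₂ v → p' ∉ D₂ v' → R (b v p) (b v' p'))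
    (hab : ∀ v p w, Ex p w → p ∉ D₁ v → v ∉ D₂ w → R (a v p) (b w v)) :
    ∃ X : Finset (ρ × ρ),
      (Xᶜ.card : ℝ) ≤ (33 * (c / c₁) + 66 * c₁ + β) * (Fintype.card ρ) ^ 2 ∧
      (∀ x ∈ X, x.2 ∉ D₁ x.1) ∧
      ∀ x ∈ X, ∃ Y : Finset (ρ × ρ), 3 / 4 * ((Fintype.card ρ : ℝ)) ^ 2 ≤ Y.card ∧
        ∀ y ∈ Y, y.2 ∉ D₂ y.1 ∧ R (a x.1 x.2) (b y.1 y.2) := by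
  set r := Fintype.card ρ with hr
  have hr0 : (0 : ℝ) < r := by exact_mod_cast h.card_pos
  have hA16 : (16 : ℝ) ≤ A := by
    have := h.le_A
    exact_mod_cast (by omega : 16 ≤ A)
  have hA1 : 1 / (A : ℝ) ≤ 1 / 16 := one_div_le_one_div_of_le (by norm_num) hA16
  have hβ0 : 0 ≤ β := by
    by_contra! hneg
    obtain ⟨x, y, z, ⟨hx, -⟩, -⟩ := h.walk ∅ (by
      rw [Finset.card_empty, Nat.cast_zero]
      exact mul_nonpos_of_nonpos_of_nonneg hneg.le (by positivity))
    simp at hx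
  let U : (ρ → Finset ρ) → Finset ρ := fun D => univ.filter fun v => ((D v).card : ℝ) ≤ c₁ * r
  have hUc : ∀ D : ρ → Finset ρ, ∑ v, ((D v).card : ℝ) ≤ c * r ^ 2 →
      ((U D)ᶜ.card : ℝ) ≤ c / c₁ * r := by
    intro D hD
    have h1 := card_not_le (fun v => (D v).card) (U D) (c₁ * r) _ (fun v hv => by
      by_contra! hlt
      exact hv (mem_filter.2 ⟨mem_univ _, hlt.le⟩)) hD
    have h2 : ((U D)ᶜ.card : ℝ) * c₁ ≤ c * r := by
      apply le_of_mul_le_mul_right _ hr0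
      linarith
    rw [div_mul_eq_mul_div, le_div_iff₀ hc₁]
    exact h2
  have hU : ∀ (D : ρ → Finset ρ), ∀ v ∈ U D, ((D v).card : ℝ) ≤ c₁ * r := fun D v hv =>
    (mem_filter.1 hv).2
  obtain ⟨B₁, hB₁a, hB₁b, hB₁c⟩ := exists_bad_sets h D₁ c₁ hc₁.le hc₁' (U D₁) (hU D₁)
  obtain ⟨B₂, hB₂a, hB₂b, hB₂c⟩ := exists_bad_sets h D₂ c₁ hc₁.le hc₁' (U D₂) (hU D₂)
  -- `M v` collects the clusters of the second copy in which position `v` is no safe start: too much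
  -- is deleted there or `v` is bad. Double counting shows that most `v` have few such clusters.
  let M : ρ → Finset ρ := fun v => univ.filter fun w => w ∉ U D₂ ∨ v ∈ B₂ w
  let G : Finset ρ := univ.filter fun v => ((M v).card : ℝ) ≤ 1 / 32 * r
  have hG : (Gᶜ.card : ℝ) ≤ 32 * (c / c₁ + 2 * c₁) * r := by
    have h1 : ∑ v, ((M v).card : ℝ) ≤ (c / c₁ + 2 * c₁) * r * r := by
      have h2 := sum_card_bipartiteAbove_eq_sum_card_bipartiteBelow
        (s := (univ : Finset ρ)) (t := (univ : Finset ρ)) (fun v w => w ∉ U D₂ ∨ v ∈ B₂ w)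
      simp only [bipartiteAbove, bipartiteBelow] at h2
      have h3 : ∀ w : ρ, ((univ.filter fun v => w ∉ U D₂ ∨ v ∈ B₂ w).card : ℝ) ≤
          (if w ∈ (U D₂)ᶜ then (r : ℝ) else 0) + 2 * c₁ * r := by
        intro w
        by_cases hw : w ∈ U D₂
        · have : (univ.filter fun v => w ∉ U D₂ ∨ v ∈ B₂ w) = B₂ w := by ext; simp [hw]
          rw [this, if_neg (by simpa using hw), zero_add]
          exact hB₂b w hw
        · rw [if_pos (mem_compl.2 hw)]
          have : ((univ.filter fun v => w ∉ U D₂ ∨ v ∈ B₂ w).card : ℝ) ≤ r := by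
            exact_mod_cast card_le_univ _
          have : 0 ≤ 2 * c₁ * r := by positivity
          linarith
      have h4 : ∑ v, ((M v).card : ℝ) =
          ∑ w : ρ, ((univ.filter fun v => w ∉ U D₂ ∨ v ∈ B₂ w).card : ℝ) := by exact_mod_cast h2
      rw [h4]
      refine (sum_le_sum fun w _ => h3 w).trans ?_
      rw [sum_add_distrib, sum_ite_mem, univ_inter, sum_const, sum_const, card_univ, nsmul_eq_mul,
        nsmul_eq_mul, ← hr]
      have := hUc D₂ hD₂
      nlinarith
    have h2 := card_not_le (fun v => (M v).card) G (1 / 32 * r) _ (fun v hv => by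
      by_contra! hlt
      exact hv (mem_filter.2 ⟨mem_univ _, hlt.le⟩)) h1
    apply le_of_mul_le_mul_right _ hr0
    linarith
  set Q := U D₁ ∩ G with hQ
  let T : Finset ρ := Q.filter fun v => ∃ w, Steps (Within Q H) (L + 2) v w
  have hT := h.card_start Q T (fun v hv hvT hw => hvT (mem_filter.2 ⟨hv, hw⟩))
  have hTc : (Tᶜ.card : ℝ) ≤ (c / c₁ + 32 * (c / c₁ + 2 * c₁) + β) * r := by
    have h1 : Qᶜ.card ≤ (U D₁)ᶜ.card + Gᶜ.card := by
      rw [hQ, compl_inter]; exact card_union_le _ _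
    have h2 : (Qᶜ.card : ℝ) ≤ (U D₁)ᶜ.card + Gᶜ.card := by exact_mod_cast h1
    have h3 : (Qᶜ.card : ℝ) = r - Q.card := by
      rw [card_compl, Nat.cast_sub (card_le_univ _)]
    have h4 : (Tᶜ.card : ℝ) = r - T.card := by
      rw [card_compl, Nat.cast_sub (card_le_univ _)]
    have := hUc D₁ hD₁
    rw [← hr] at hT
    linarith
  let X : Finset (ρ × ρ) := univ.filter fun x => x.1 ∈ T ∧ x.2 ∉ B₁ x.1
  have hTQ : ∀ v ∈ T, v ∈ Q := fun v hv => (mem_filter.1 hv).1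
  refine ⟨X, ?_, fun x hx hxD => (mem_filter.1 hx).2.2 (hB₁a _ hxD), ?_⟩
  · have hsub : Xᶜ ⊆ (Tᶜ ×ˢ univ) ∪ (T.sigma fun v => B₁ v).map
        (Equiv.sigmaEquivProd ρ ρ).toEmbedding := by
      rintro ⟨v, p⟩ hx
      simp only [X, mem_compl, mem_filter, mem_univ, true_and, not_and, not_not] at hx
      by_cases hv : v ∈ T
      · refine mem_union_right _ (mem_map.2 ⟨⟨v, p⟩, mem_sigma.2 ⟨hv, hx hv⟩, rfl⟩)
      · exact mem_union_left _ (mem_product.2 ⟨mem_compl.2 hv, mem_univ _⟩)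
    have h1 := (card_le_card hsub).trans (card_union_le _ _)
    rw [card_product, card_map, card_sigma, card_univ, ← hr] at h1
    have h2 : (Xᶜ.card : ℝ) ≤ Tᶜ.card * r + ∑ v ∈ T, ((B₁ v).card : ℝ) := by exact_mod_cast h1
    have h3 : ∑ v ∈ T, ((B₁ v).card : ℝ) ≤ r * (2 * c₁ * r) := by
      refine (sum_le_card_nsmul T _ (2 * c₁ * r) fun v hv =>
        hB₁b v (mem_inter.1 (hTQ v hv)).1).trans ?_
      rw [nsmul_eq_mul]
      have : (T.card : ℝ) ≤ r := by exact_mod_cast card_le_univ T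
      gcongr
    nlinarith
  · rintro ⟨u, p⟩ hx
    obtain ⟨-, hu, hp⟩ := mem_filter.1 hx
    simp only at hu hp
    obtain ⟨huQ, v, huv⟩ := mem_filter.1 hu
    have hvG : v ∈ G := by
      obtain ⟨w, -, w', ⟨-, hw', -⟩, rfl⟩ := Steps.split (k := L + 1) (l := 1) huv
      exact (mem_inter.1 hw').2
    have huv' : Steps (Within (U D₁) H) (L + 2) u v := huv.mono fun x y ⟨hx, hy, hxy⟩ =>
      ⟨(mem_inter.1 hx).1, (mem_inter.1 hy).1, hxy⟩
    have hdense := dense_of_steps h hc₁' hB₁a hB₁b hB₁c (fun w q => R (a u p) (a w q))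
      (fun w w' q q' hw hq hqD hqD' hR => htrans _ _ _ hR (ha w w' q q' hw hq hqD hqD'))
      huv' ⟨p, hp, hrefl _⟩
    set Sv := univ.filter fun q => q ∉ B₁ v ∧ R (a u p) (a v q) with hSv
    -- The flooded cluster `v` reaches position `v` in every cluster of `W`. By expansion of `Sv`,
    -- the set `W` misses at most `r / A` clusters besides those of `M v`.
    let W : Finset ρ := univ.filter fun w => w ∈ U D₂ ∧ v ∉ B₂ w ∧ ∃ q ∈ Sv, Ex q w
    have hRW : ∀ w ∈ W, R (a u p) (b w v) := by
      intro w hw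
      obtain ⟨-, hwU, hwB, q, hq, hqw⟩ := mem_filter.1 hw
      obtain ⟨-, hq1, hq2⟩ := mem_filter.1 hq
      exact htrans _ _ _ hq2 (hab v q w hqw (fun h => hq1 (hB₁a _ h)) (fun h => hwB (hB₂a _ h)))
    have hWc : (1 - 1 / 32 - 1 / A) * r ≤ (W.card : ℝ) := by
      set Y := (M v ∪ W)ᶜ with hY
      have hYc : (Y.card : ℝ) = r - (M v ∪ W).card := by
        rw [hY, card_compl, Nat.cast_sub (card_le_univ _)]
      have hMv : ((M v).card : ℝ) ≤ 1 / 32 * r := (mem_filter.1 hvG).2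
      have hun : ((M v ∪ W).card : ℝ) ≤ (M v).card + W.card := by exact_mod_cast card_union_le _ _
      by_contra! hlt
      have hYA : (r : ℝ) < A * Y.card := by
        have h1 : 1 / (A : ℝ) * r < Y.card := by nlinarith
        have h2 : (A : ℝ) * (1 / A * r) < A * Y.card := by gcongr
        rwa [← mul_assoc, mul_one_div_cancel (by linarith), one_mul] at h2
      have hSA : (r : ℝ) < A * Sv.card := by
        have h1 : (1 / 2 : ℝ) * r ≤ Sv.card := by
          refine le_trans ?_ hdense
          gcongr
          linarith
        have h2 : (16 : ℝ) * (1 / 2 * r) ≤ A * Sv.card := by gcongr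
        linarith
      have hSA' : r < A * Sv.card := by exact_mod_cast hSA
      have hYA' : r < A * Y.card := by exact_mod_cast hYA
      obtain ⟨q, hq, w, hw, hqw⟩ := h.expander.edge Sv Y (by omega) hYA'
      simp only [hY, M, mem_compl, mem_union, mem_filter, mem_univ, true_and, not_or, not_not] at hw
      exact hw.2 (mem_filter.2 ⟨mem_univ _, hw.1.1, hw.1.2, q, hq, hqw⟩)
    let E : Finset ρ := W.filter fun w => ∃ w₀, Steps (Within W H) (L + 2) w₀ w
    have hE := h.card_end W E (fun w hw hwE hex => hwE (mem_filter.2 ⟨hw, hex⟩))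
    rw [← hr] at hE
    let Z : ρ → Finset ρ := fun w => univ.filter fun q => q ∉ B₂ w ∧ R (a u p) (b w q)
    have hZ : ∀ w ∈ E, (1 - 1 / A - 2 * c₁) * r ≤ ((Z w).card : ℝ) := by
      intro w hw
      obtain ⟨hwW, w₀, hw₀⟩ := mem_filter.1 hw
      have hw₀W : w₀ ∈ W := by
        obtain ⟨x, ⟨hx, -⟩, -⟩ := hw₀
        exact hx
      exact dense_of_steps h hc₁' hB₂a hB₂b hB₂c (fun w q => R (a u p) (b w q))
        (fun w w' q q' hw hq hqD hqD' hR => htrans _ _ _ hR (hb w w' q q' hw hq hqD hqD'))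
        (hw₀.mono fun x y ⟨hx, hy, hxy⟩ =>
          ⟨(mem_filter.1 hx).2.1, (mem_filter.1 hy).2.1, hxy⟩)
        ⟨v, (mem_filter.1 hw₀W).2.2.1, hRW w₀ hw₀W⟩
    refine ⟨(E.sigma Z).map (Equiv.sigmaEquivProd ρ ρ).toEmbedding, ?_, ?_⟩
    · rw [card_map, card_sigma]
      push_cast
      have h1 := card_nsmul_le_sum E (fun w => ((Z w).card : ℝ)) (7 / 8 * r) fun w hw => by
        refine le_trans ?_ (hZ w hw)
        gcongr
        linarith
      refine le_trans ?_ h1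
      rw [nsmul_eq_mul]
      -- `1 - 1/32 - 1/A - β ≥ 7/8`. Each of these clusters is reached in a `7/8`-fraction of its
      -- positions, and `(7/8)^2 ≥ 3/4`.
      have h2 : 7 / 8 * (r : ℝ) ≤ E.card := by nlinarith
      nlinarith
    · rintro ⟨w, q⟩ hy
      obtain ⟨⟨w', q'⟩, hy', heq⟩ := mem_map.1 hy
      cases heq
      obtain ⟨-, hq⟩ := mem_sigma.1 hy'
      obtain ⟨-, hq1, hq2⟩ := mem_filter.1 hq
      exact ⟨fun h => hq1 (hB₂a _ h), hq2⟩

end HalfCore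

/-! ### The core: three copies, loss `κ n`. -/

/-- The steps of `R` which avoid the deleted nodes `D`. -/
def Avoid {α : Type*} (D : Finset α) (R : α → α → Prop) (a b : α) : Prop :=
  a ∉ D ∧ b ∉ D ∧ R a b

section Core

variable {ρ : Type}

/-- Three copies of `ρ × ρ`, each with the edges of the product of `H` and `Ex`, which are joined
by transposing expanders. -/
def CoreEdge (H Ex : ρ → ρ → Prop) (x y : Fin 3 × ρ × ρ) : Prop :=
  (x.1 = y.1 ∧ H x.2.1 y.2.1 ∧ Ex x.2.2 y.2.2) ∨
  (∃ w, Ex x.2.2 w ∧ x.1 = 0 ∧ y = (1, w, x.2.1)) ∨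
  (∃ w, Ex w x.2.1 ∧ x.1 = 1 ∧ y = (2, x.2.2, w))

variable {H Ex : ρ → ρ → Prop}

theorem wellFounded_coreEdge (hH : WellFounded H) : WellFounded (CoreEdge H Ex) := by
  have hlt : WellFounded ((· < ·) : Fin 3 → Fin 3 → Prop) := wellFounded_lt
  refine Subrelation.wf ?_ (InvImage.wf (fun x : Fin 3 × ρ × ρ => (x.1, x.2.1))
    (WellFounded.prod_lex hlt hH))
  rintro ⟨i, v, p⟩ ⟨j, w, q⟩ (⟨h, h', -⟩ | ⟨w', -, h, h'⟩ | ⟨w', -, h, h'⟩)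
  · simp only at h; subst h
    exact Prod.Lex.right _ h'
  · simp only [Prod.mk.injEq] at h h'
    obtain ⟨rfl, rfl, rfl⟩ := h'
    subst h
    exact Prod.Lex.left _ _ (show (0 : Fin 3) < 1 by decide)
  · simp only [Prod.mk.injEq] at h h'
    obtain ⟨rfl, rfl, rfl⟩ := h'
    subst h
    exact Prod.Lex.left _ _ (show (1 : Fin 3) < 2 by decide)

theorem outDegLE_coreEdge {d δ : ℕ} (hH : OutDegLE d H) (hE : OutDegLE δ Ex)
    (hs : ∀ x y, Ex x y → Ex y x) : OutDegLE (d * δ + (δ + δ)) (CoreEdge H Ex) := by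
  refine OutDegLE.or ?_ (OutDegLE.or ?_ ?_)
  · simpa using (outDegLE_of_fun (id : Fin 3 → Fin 3)).prod (hH.prod hE)
  · have h1 : OutDegLE δ (fun (x : Fin 3 × ρ × ρ) w => Ex x.2.2 w) := fun x => hE x.2.2
    refine ((outDegLE_scale h1 (l := 1) (E' := fun w x (y : Fin 3 × ρ × ρ) => x.1 = 0 ∧ y = (1, w, x.2.1))
      fun w => ?_).mono (by omega : δ * 1 ≤ δ))
    exact (outDegLE_of_fun fun x : Fin 3 × ρ × ρ => ((1 : Fin 3), w, x.2.1)).sub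
      fun a b h => h.2.symm
  · have h1 : OutDegLE δ (fun (x : Fin 3 × ρ × ρ) w => Ex w x.2.1) := fun x => by
      obtain ⟨s, h1, h2⟩ := hE x.2.1
      exact ⟨s, h1, fun b hb => h2 b (hs _ _ hb)⟩
    refine ((outDegLE_scale h1 (l := 1) (E' := fun w x (y : Fin 3 × ρ × ρ) => x.1 = 1 ∧ y = (2, x.2.2, w))
      fun w => ?_).mono (by omega : δ * 1 ≤ δ))
    exact (outDegLE_of_fun fun x : Fin 3 × ρ × ρ => ((2 : Fin 3), x.2.2, w)).sub
      fun a b h => h.2.symm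

theorem inDegLE_coreEdge {d δ : ℕ} (hH : OutDegLE d (fun x y => H y x)) (hE : OutDegLE δ Ex)
    (hs : ∀ x y, Ex x y → Ex y x) :
    OutDegLE (d * δ + (δ + δ)) (fun x y => CoreEdge H Ex y x) := by
  have hE' : OutDegLE δ (fun x y => Ex y x) := hE.sub fun a b h => hs _ _ h
  refine OutDegLE.or ?_ (OutDegLE.or ?_ ?_)
  · exact ((outDegLE_of_fun (id : Fin 3 → Fin 3)).prod (hH.prod hE')).mono (by omega) |>.sub
      fun a b h => ⟨h.1.symm, h.2⟩
  · have h1 : OutDegLE δ (fun (x : Fin 3 × ρ × ρ) w => Ex w x.2.1) := fun x => hE' x.2.1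
    refine ((outDegLE_scale h1 (l := 1) (E' := fun w x (y : Fin 3 × ρ × ρ) => y = (0, x.2.2, w))
      fun w => ?_).mono (by omega : δ * 1 ≤ δ)).sub ?_
    · exact (outDegLE_of_fun fun x : Fin 3 × ρ × ρ => ((0 : Fin 3), x.2.2, w)).sub
        fun a b h => h.symm
    · rintro ⟨i, v, p⟩ ⟨j, w, q⟩ ⟨w', h1, h2, h3⟩
      simp only [Prod.mk.injEq] at h1 h2 h3 ⊢
      obtain ⟨rfl, rfl, rfl⟩ := h3
      exact ⟨q, h1, h2, rfl, rfl⟩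
  · have h1 : OutDegLE δ (fun (x : Fin 3 × ρ × ρ) w => Ex x.2.2 w) := fun x => hE x.2.2
    refine ((outDegLE_scale h1 (l := 1) (E' := fun w x (y : Fin 3 × ρ × ρ) => y = (1, w, x.2.1))
      fun w => ?_).mono (by omega : δ * 1 ≤ δ)).sub ?_
    · exact (outDegLE_of_fun fun x : Fin 3 × ρ × ρ => ((1 : Fin 3), w, x.2.1)).sub
        fun a b h => h.symm
    · rintro ⟨i, v, p⟩ ⟨j, w, q⟩ ⟨w', h1, h2, h3⟩
      simp only [Prod.mk.injEq] at h1 h2 h3 ⊢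
      obtain ⟨rfl, rfl, rfl⟩ := h3
      exact ⟨w, h1, h2, rfl, rfl⟩

theorem IsClusterGraph.flip [Fintype ρ] {d A δ L : ℕ} {β : ℝ}
    (h : IsClusterGraph H Ex d A δ L β) (hH : WellFounded H)
    (hd : OutDegLE d fun x y => H y x) : IsClusterGraph (fun x y => H y x) Ex d A δ L β where
  wf := hH
  deg := hd
  expander := h.expander
  le_A := h.le_A
  le_card := h.le_card
  card_le := h.card_le
  walk Q hQ := by
    obtain ⟨a, b, hab⟩ := h.walk Q hQ
    exact ⟨b, a, hab.flip.mono fun x y hxy => ⟨hxy.2.1, hxy.1, hxy.2.2⟩⟩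

-- `half_core` is applied forwards from copy `0` and, with all edges reversed, from copy `2`. Both
-- reach 3/4 of copy `1`, so the reached sets intersect.
open Classical in
theorem core_robust [Fintype ρ] {d A δ L : ℕ} {β c c₁ : ℝ}
    (h : IsClusterGraph H Ex d A δ L β) (hH : WellFounded H)
    (hd : OutDegLE d fun x y => H y x) (hc₁ : 0 < c₁) (hc₁' : c₁ ≤ 1 / 32)
    (hβ : β ≤ 1 / 32) (D : Finset (Fin 3 × ρ × ρ))
    (hD : (D.card : ℝ) ≤ c * (Fintype.card ρ) ^ 2) :
    ∃ X Z : Finset (ρ × ρ),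
      (Fintype.card ρ : ℝ) ^ 2 - (33 * (c / c₁) + 66 * c₁ + β) * (Fintype.card ρ) ^ 2 ≤ X.card ∧
      (Fintype.card ρ : ℝ) ^ 2 - (33 * (c / c₁) + 66 * c₁ + β) * (Fintype.card ρ) ^ 2 ≤ Z.card ∧
      ∀ x ∈ X, ∀ z ∈ Z, (0, x) ∉ D ∧ (2, z) ∉ D ∧
        Relation.ReflTransGen (Avoid D (CoreEdge H Ex)) (0, x) (2, z) := by
  have hr0 : (0 : ℝ) < Fintype.card ρ := by exact_mod_cast h.card_pos
  let Di : Fin 3 → ρ → Finset ρ := fun i v => univ.filter fun p => (i, v, p) ∈ D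
  have hDi : ∀ i, ∑ v, ((Di i v).card : ℝ) ≤ c * (Fintype.card ρ) ^ 2 := by
    intro i
    refine le_trans ?_ hD
    rw [← Nat.cast_sum, ← card_sigma]
    norm_cast
    refine card_le_card_of_injOn (fun x => (i, x.1, x.2)) (fun x hx => ?_) ?_
    · simpa [Di] using hx
    · rintro ⟨a, b⟩ _ ⟨a', b'⟩ _ hab
      simpa using hab
  have hmem : ∀ i v p, p ∉ Di i v ↔ (i, v, p) ∉ D := fun i v p => by simp [Di]
  have hcompl : ∀ X : Finset (ρ × ρ), (X.card : ℝ) = (Fintype.card ρ : ℝ) ^ 2 - Xᶜ.card := by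
    intro X
    have := card_add_card_compl X
    rw [Fintype.card_prod] at this
    have h2 : (X.card : ℝ) + Xᶜ.card = Fintype.card ρ * Fintype.card ρ := by exact_mod_cast this
    rw [sq]
    linarith
  let R := Relation.ReflTransGen (Avoid D (CoreEdge H Ex))
  have hs := h.expander.symm
  obtain ⟨X, hX, hX1, hX2⟩ := half_core h hc₁ hc₁' hβ R (fun _ => .refl)
    (fun _ _ _ => .trans) (fun v p => (0, v, p)) (fun v p => (1, v, p)) (Di 0) (Di 1)
    (hDi 0) (hDi 1)
    (fun v v' p p' h1 h2 h3 h4 => .single ⟨(hmem _ _ _).1 h3, (hmem _ _ _).1 h4,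
      Or.inl ⟨rfl, h1, h2⟩⟩)
    (fun v v' p p' h1 h2 h3 h4 => .single ⟨(hmem _ _ _).1 h3, (hmem _ _ _).1 h4,
      Or.inl ⟨rfl, h1, h2⟩⟩)
    (fun v p w h1 h2 h3 => .single ⟨(hmem _ _ _).1 h2, (hmem _ _ _).1 h3,
      Or.inr (Or.inl ⟨w, h1, rfl, rfl⟩)⟩)
  obtain ⟨Z, hZ, hZ1, hZ2⟩ := half_core (h.flip hH hd) hc₁ hc₁' hβ (fun x y => R y x)
    (fun _ => .refl) (fun _ _ _ h1 h2 => h2.trans h1) (fun v p => (2, v, p))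
    (fun v p => (1, v, p)) (Di 2) (Di 1) (hDi 2) (hDi 1)
    (fun v v' p p' h1 h2 h3 h4 => .single ⟨(hmem _ _ _).1 h4, (hmem _ _ _).1 h3,
      Or.inl ⟨rfl, h1, hs _ _ h2⟩⟩)
    (fun v v' p p' h1 h2 h3 h4 => .single ⟨(hmem _ _ _).1 h4, (hmem _ _ _).1 h3,
      Or.inl ⟨rfl, h1, hs _ _ h2⟩⟩)
    (fun v p w h1 h2 h3 => .single ⟨(hmem _ _ _).1 h3, (hmem _ _ _).1 h2,
      Or.inr (Or.inr ⟨p, h1, rfl, rfl⟩)⟩)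
  refine ⟨X, Z, by rw [hcompl X]; linarith, by rw [hcompl Z]; linarith, fun x hx z hz => ?_⟩
  obtain ⟨Y, hY, hY'⟩ := hX2 x hx
  obtain ⟨Y', hY1, hY1'⟩ := hZ2 z hz
  have hne : (Y ∩ Y').Nonempty := by
    rw [nonempty_iff_ne_empty]
    intro he
    have h1 := card_union_add_card_inter Y Y'
    have h2 := card_le_univ (Y ∪ Y')
    rw [he, card_empty] at h1
    rw [Fintype.card_prod] at h2
    have h3 : (Y.card : ℝ) + Y'.card ≤ Fintype.card ρ * Fintype.card ρ := by
      exact_mod_cast (by omega : Y.card + Y'.card ≤ _)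
    nlinarith
  obtain ⟨y, hy⟩ := hne
  rw [mem_inter] at hy
  exact ⟨(hmem _ _ _).1 (hX1 x hx), (hmem _ _ _).1 (hZ1 z hz),
    (hY' y hy.1).2.trans (hY1' y hy.2).2⟩

end Core

theorem exists_linear_le_exp (a x b : ℝ) (hx : 1 < x) (hb : 0 < b) :
    ∃ S₀ : ℕ, ∀ S : ℕ, S₀ ≤ S → a * S ≤ b * x ^ S := by
  have h := (tendsto_pow_const_div_const_pow_of_one_lt 1 hx).const_mul a
  rw [mul_zero] at h
  obtain ⟨S₀, hS⟩ := Filter.eventually_atTop.1 (h.eventually (gt_mem_nhds hb))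
  refine ⟨S₀, fun S h' => ?_⟩
  have := (hS S h').le
  rwa [pow_one, ← mul_div_assoc, div_le_iff₀ (by positivity)] at this

theorem exists_core (κ : ℝ) (hκ : 0 < κ) : ∃ (δ : ℕ) (c : ℝ) (S₀ : ℕ), 0 < c ∧
    ∀ S : ℕ, S₀ ≤ S → ∃ H Ex : (Fin S → Bool) × Fin S → (Fin S → Bool) × Fin S → Prop,
      WellFounded (CoreEdge H Ex) ∧ OutDegLE δ (CoreEdge H Ex) ∧
      OutDegLE δ (fun x y => CoreEdge H Ex y x) ∧
      ∀ D : Finset (Fin 3 × ((Fin S → Bool) × Fin S) × ((Fin S → Bool) × Fin S)),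
        (D.card : ℝ) ≤ c * ((2 ^ S * S : ℕ) : ℝ) ^ 2 →
        ∃ X Z : Finset (((Fin S → Bool) × Fin S) × ((Fin S → Bool) × Fin S)),
          ((2 ^ S * S : ℕ) : ℝ) ^ 2 - κ * ((2 ^ S * S : ℕ) : ℝ) ^ 2 ≤ X.card ∧
          ((2 ^ S * S : ℕ) : ℝ) ^ 2 - κ * ((2 ^ S * S : ℕ) : ℝ) ^ 2 ≤ Z.card ∧
          ∀ x ∈ X, ∀ z ∈ Z, (0, x) ∉ D ∧ (2, z) ∉ D ∧
            Relation.ReflTransGen (Avoid D (CoreEdge H Ex)) (0, x) (2, z) := by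
  set β : ℝ := min (1 / 32) (κ / 4) with hβ
  set c₁ : ℝ := min (1 / 32) (κ / 200) with hc₁
  have hβ0 : 0 < β := lt_min (by norm_num) (by positivity)
  have hc0 : 0 < c₁ := lt_min (by norm_num) (by positivity)
  have hβκ : β ≤ κ / 4 := min_le_right _ _
  have hcκ : c₁ ≤ κ / 200 := min_le_right _ _
  -- Depth is not needed here: only walks of length `2 * S + 2` are used, so any exponent below `1`
  -- would serve.
  obtain ⟨d, hd⟩ := exists_depthRobust (1 / 2) β (by norm_num) hβ0
  obtain ⟨δ, hδ⟩ := exists_isExpander (2 * d + 16)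
  have hx1 : (1 : ℝ) < 2 ^ (1 / 2 : ℝ) := Real.one_lt_rpow (by norm_num) (by norm_num)
  obtain ⟨S₀, hS₀⟩ := exists_linear_le_exp 5 _ (β / 4) hx1 (by positivity)
  -- With `c = c₁ ^ 2` the loss `33 * (c / c₁) + 66 * c₁ + β` becomes `99 * c₁ + β`, which is at
  -- most `κ`.
  refine ⟨d * δ + (δ + δ), c₁ ^ 2, max S₀ (4 * (2 * d + 16)), by positivity, fun S hS => ?_⟩
  have hS1 : S₀ ≤ S := (le_max_left _ _).trans hS
  have hS2 : 4 * (2 * d + 16) ≤ S := (le_max_right _ _).trans hS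
  obtain ⟨H, hwf, ho, hi, hwalk⟩ := hd S (by omega)
  obtain ⟨Ex, hEx⟩ := hδ ((Fin S → Bool) × Fin S)
  have hcard : Fintype.card ((Fin S → Bool) × Fin S) = 2 ^ S * S := by simp
  have h2S : S ≤ 2 ^ S := Nat.lt_two_pow_self.le
  have hcl : IsClusterGraph H Ex d (2 * d + 16) δ (2 * S) β :=
    { wf := wellFounded_flip_of_finite hwf
      deg := ho
      expander := hEx
      le_A := le_rfl
      le_card := by
        rw [hcard]
        exact hS2.trans (Nat.le_mul_of_pos_left _ (by positivity))
      card_le := by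
        rw [hcard, two_mul, pow_add]
        exact Nat.mul_le_mul_left _ h2S
      walk := fun Q hQ => by
        rw [hcard] at hQ
        push_cast at hQ
        obtain ⟨k, a, b, hk, hk'⟩ := hwalk Q hQ
        have h1 := hS₀ S hS1
        rw [← Real.rpow_mul_natCast (by norm_num)] at h1
        have h2 : (1 - 1 / 2 : ℝ) * S = 1 / 2 * S := by ring
        rw [h2] at hk'
        have h3 : 5 * S ≤ k + 1 := by
          exact_mod_cast h1.trans hk'
        obtain ⟨l, rfl⟩ : ∃ l, k = (2 * S + 2) + l := ⟨k - (2 * S + 2), by omega⟩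
        obtain ⟨b', hb', -⟩ := hk.split
        exact ⟨a, b', hb'⟩ }
  refine ⟨H, Ex, wellFounded_coreEdge hwf, outDegLE_coreEdge ho hEx.deg hEx.symm,
    inDegLE_coreEdge hi hEx.deg hEx.symm, fun D hD => ?_⟩
  rw [← hcard] at hD ⊢
  obtain ⟨X, Z, hX, hZ, h⟩ := core_robust (c := c₁ ^ 2) hcl hwf hi hc0
    (min_le_left _ _) (min_le_left _ _) D hD
  have hle : 33 * (c₁ ^ 2 / c₁) + 66 * c₁ + β ≤ κ := by
    rw [sq, mul_div_assoc, div_self hc0.ne', mul_one]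
    linarith
  have hle' := mul_le_mul_of_nonneg_right hle
    (by positivity : (0 : ℝ) ≤ (Fintype.card ((Fin S → Bool) × Fin S) : ℝ) ^ 2)
  exact ⟨X, Z, by linarith, by linarith, h⟩

/-! ### Series composition of digraphs. -/

section Chain

variable {α μ β : Type*}

/-- Three digraphs `E`, `F`, `G` in series, with the edges `I` and `O` between them. -/
def Chain (E : α → α → Prop) (I : α → μ → Prop) (F : μ → μ → Prop) (O : μ → β → Prop)
    (G : β → β → Prop) : α ⊕ μ ⊕ β → α ⊕ μ ⊕ β → Prop
  | .inl a, .inl a' => E a a'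
  | .inl a, .inr (.inl m) => I a m
  | .inr (.inl m), .inr (.inl m') => F m m'
  | .inr (.inl m), .inr (.inr b) => O m b
  | .inr (.inr b), .inr (.inr b') => G b b'
  | _, _ => False

variable {E : α → α → Prop} {I : α → μ → Prop} {F : μ → μ → Prop} {O : μ → β → Prop}
  {G : β → β → Prop}

theorem wellFounded_chain (hE : WellFounded E) (hF : WellFounded F) (hG : WellFounded G) :
    WellFounded (Chain E I F O G) := by
  have h1 : ∀ a, Acc (Chain E I F O G) (.inl a) := fun a => by
    induction a using hE.induction with
    | _ a ih =>
      refine ⟨_, fun y hy => ?_⟩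
      rcases y with a' | m | b
      · exact ih a' hy
      · exact hy.elim
      · exact hy.elim
  have h2 : ∀ m, Acc (Chain E I F O G) (.inr (.inl m)) := fun m => by
    induction m using hF.induction with
    | _ m ih =>
      refine ⟨_, fun y hy => ?_⟩
      rcases y with a' | m | b
      · exact h1 a'
      · exact ih m hy
      · exact hy.elim
  have h3 : ∀ b, Acc (Chain E I F O G) (.inr (.inr b)) := fun b => by
    induction b using hG.induction with
    | _ b ih =>
      refine ⟨_, fun y hy => ?_⟩
      rcases y with a' | m | b
      · exact hy.elim
      · exact h2 m
      · exact ih b hy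
  exact ⟨fun x => by rcases x with a | m | b; exacts [h1 a, h2 m, h3 b]⟩

theorem outDegLE_chain {k : ℕ}
    (h₁ : ∀ a, ∃ (s : Finset α) (t : Finset μ), s.card + t.card ≤ k ∧
      (∀ x, E a x → x ∈ s) ∧ ∀ x, I a x → x ∈ t)
    (h₂ : ∀ m, ∃ (s : Finset μ) (t : Finset β), s.card + t.card ≤ k ∧
      (∀ x, F m x → x ∈ s) ∧ ∀ x, O m x → x ∈ t)
    (h₃ : OutDegLE k G) : OutDegLE k (Chain E I F O G) := by
  classical
  rintro (a | m | b)
  · obtain ⟨s, t, h, hs, ht⟩ := h₁ a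
    refine ⟨s.disjSum (t.disjSum ∅), by simpa [card_disjSum] using h, ?_⟩
    rintro (x | x | x) hx
    · simpa using hs x hx
    · simpa using ht x hx
    · exact hx.elim
  · obtain ⟨s, t, h, hs, ht⟩ := h₂ m
    refine ⟨(∅ : Finset α).disjSum (s.disjSum t), by simpa [card_disjSum] using h, ?_⟩
    rintro (x | x | x) hx
    · exact hx.elim
    · simpa using hs x hx
    · simpa using ht x hx
  · obtain ⟨s, h, hs⟩ := h₃ b
    refine ⟨(∅ : Finset α).disjSum ((∅ : Finset μ).disjSum s), by simpa [card_disjSum] using h, ?_⟩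
    rintro (x | x | x) hx
    · exact hx.elim
    · exact hx.elim
    · simpa using hs x hx

theorem inDegLE_chain {k : ℕ} (h₁ : OutDegLE k fun x y => E y x)
    (h₂ : ∀ m, ∃ (s : Finset α) (t : Finset μ), s.card + t.card ≤ k ∧
      (∀ x, I x m → x ∈ s) ∧ ∀ x, F x m → x ∈ t)
    (h₃ : ∀ b, ∃ (s : Finset μ) (t : Finset β), s.card + t.card ≤ k ∧
      (∀ x, O x b → x ∈ s) ∧ ∀ x, G x b → x ∈ t) :
    OutDegLE k fun x y => Chain E I F O G y x := by
  classical
  rintro (a | m | b)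
  · obtain ⟨s, h, hs⟩ := h₁ a
    refine ⟨s.disjSum ((∅ : Finset μ).disjSum (∅ : Finset β)),
      by simpa [card_disjSum] using h, ?_⟩
    rintro (x | x | x) hx
    · simpa using hs x hx
    · exact hx.elim
    · exact hx.elim
  · obtain ⟨s, t, h, hs, ht⟩ := h₂ m
    refine ⟨s.disjSum (t.disjSum ∅), by simpa [card_disjSum] using h, ?_⟩
    rintro (x | x | x) hx
    · simpa using hs x hx
    · simpa using ht x hx
    · exact hx.elim
  · obtain ⟨s, t, h, hs, ht⟩ := h₃ b
    refine ⟨(∅ : Finset α).disjSum (s.disjSum t), by simpa [card_disjSum] using h, ?_⟩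
    rintro (x | x | x) hx
    · exact hx.elim
    · simpa using hs x hx
    · simpa using ht x hx

theorem avoid_chain_left {D : Finset (α ⊕ μ ⊕ β)} {D' : Finset α}
    (hD : ∀ x, .inl x ∈ D → x ∈ D') (x y : α) (h : Avoid D' E x y) :
    Avoid D (Chain E I F O G) (.inl x) (.inl y) :=
  ⟨fun h' => h.1 (hD _ h'), fun h' => h.2.1 (hD _ h'), h.2.2⟩

theorem avoid_chain_right {D : Finset (α ⊕ μ ⊕ β)} {D' : Finset β}
    (hD : ∀ x, .inr (.inr x) ∈ D → x ∈ D') (x y : β) (h : Avoid D' G x y) :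
    Avoid D (Chain E I F O G) (.inr (.inr x)) (.inr (.inr y)) :=
  ⟨fun h' => h.1 (hD _ h'), fun h' => h.2.1 (hD _ h'), h.2.2⟩

end Chain

/-! ### Cores for an arbitrary number of terminals. -/

theorem exists_between_of_growth (f : ℕ → ℕ) (M S₀ : ℕ) (hf : ∀ S, S₀ ≤ S → f (S + 1) ≤ M * f S)
    (hle : ∀ S, S ≤ f S) (n : ℕ) (hn : f S₀ ≤ n) :
    ∃ S, S₀ ≤ S ∧ f S ≤ n ∧ n < M * f S := by
  by_contra! hcon
  have h : ∀ k, f (S₀ + k) ≤ n := fun k => by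
    induction k with
    | zero => exact hn
    | succ k ih =>
      exact (hf _ (Nat.le_add_right _ _)).trans (hcon _ (Nat.le_add_right _ _) ih)
  have h1 := h (n + 1)
  have h2 := hle (S₀ + (n + 1))
  omega

theorem two_pow_mul_growth (S : ℕ) (hS : 1 ≤ S) :
    2 ^ (S + 1) * (S + 1) ≤ 4 * (2 ^ S * S) := by
  rw [pow_succ]
  have : 2 ^ S * (S + 1) ≤ 2 ^ S * (2 * S) := Nat.mul_le_mul_left _ (by omega)
  linarith

theorem le_two_pow_mul (S : ℕ) : S ≤ 2 ^ S * S := Nat.le_mul_of_pos_left _ (by positivity)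

/-- A map from `Fin n` with fibres of at most `M` elements. -/
theorem exists_balanced_map (T : Type) [Fintype T] (n M : ℕ) (hT : 0 < Fintype.card T)
    (hn : n ≤ M * Fintype.card T) :
    ∃ f : Fin n → T, OutDegLE M fun t i => f i = t := by
  classical
  let e := Fintype.equivFin T
  refine ⟨fun i => e.symm ⟨i.1 % Fintype.card T, Nat.mod_lt _ hT⟩, fun t =>
    ⟨univ.filter fun i : Fin n => i.1 % Fintype.card T = (e t).1, ?_, fun i hi => ?_⟩⟩
  · rw [← card_range M]
    refine card_le_card_of_injOn (fun i => i.1 / Fintype.card T) (fun i _ => ?_) ?_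
    · rw [mem_coe, mem_range]
      exact Nat.div_lt_of_lt_mul (by rw [mul_comm]; exact i.2.trans_le hn)
    · intro i hi j hj hij
      simp only [coe_filter, mem_univ, true_and, Set.mem_ofPred_eq] at hi hj
      have h1 := Nat.div_add_mod i.1 (Fintype.card T)
      have h2 := Nat.div_add_mod j.1 (Fintype.card T)
      simp only at hij
      rw [hi, hij] at h1
      rw [hj] at h2
      exact Fin.ext (h1.symm.trans h2)
  · simp [← hi]

theorem card_preimage_le {n M : ℕ} {T : Type} [Fintype T] {f : Fin n → T}
    (hf : OutDegLE M fun t i => f i = t) (B : Finset T) (Y : Finset (Fin n))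
    (h : ∀ i ∈ Y, f i ∈ B) : Y.card ≤ M * B.card := by
  classical
  choose s hs h' using hf
  have : Y ⊆ B.biUnion s := fun i hi => mem_biUnion.2 ⟨f i, h i hi, h' _ _ rfl⟩
  rw [mul_comm]
  exact (card_le_card this).trans (card_biUnion_le_card_mul _ _ _ fun t _ => hs t)

/-- The core sizes `r ^ 2` grow by a factor of at most 16 from one `S` to the next, so one with `r ^
2 ≤ n < 16 * r ^ 2` exists. Each core node serves at most 16 terminals, whence the divisions by 16.
-/
theorem exists_core_net (κ : ℝ) (hκ : 0 < κ) : ∃ (δ : ℕ) (c : ℝ) (n₀ : ℕ), 0 < c ∧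
    ∀ n : ℕ, n₀ ≤ n → ∃ (K : Type) (_ : Fintype K) (F : K → K → Prop) (s t : Fin n → K),
      WellFounded F ∧ OutDegLE δ F ∧ OutDegLE δ (fun x y => F y x) ∧
      OutDegLE 16 (fun k i => s i = k) ∧ OutDegLE 16 (fun k i => t i = k) ∧
      Fintype.card K ≤ 3 * n ∧
      ∀ D : Finset K, (D.card : ℝ) ≤ c * n → ∃ X Z : Finset (Fin n),
        (n : ℝ) ≤ X.card + κ * n ∧ (n : ℝ) ≤ Z.card + κ * n ∧
        ∀ x ∈ X, ∀ z ∈ Z, s x ∉ D ∧ t z ∉ D ∧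
          Relation.ReflTransGen (Avoid D F) (s x) (t z) := by
  classical
  obtain ⟨δ, c, S₀, hc, h⟩ := exists_core (κ / 16) (by positivity)
  refine ⟨δ, c / 16, (2 ^ (S₀ + 1) * (S₀ + 1)) ^ 2, by positivity, fun n hn => ?_⟩
  obtain ⟨S, hS, hS1, hS2⟩ := exists_between_of_growth (fun S => (2 ^ S * S) ^ 2) 16 (S₀ + 1)
    (fun S hS => by
      have := Nat.pow_le_pow_left (two_pow_mul_growth S (by omega)) 2
      calc _ ≤ _ := this
        _ = _ := by ring)
    (fun S => (le_two_pow_mul S).trans (Nat.le_self_pow (by norm_num) _)) n hn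
  obtain ⟨H, Ex, hwf, ho, hi, hrob⟩ := h S (by omega)
  set r := 2 ^ S * S with hr
  have hr0 : 0 < r := by rw [hr]; have : 0 < S := by omega
                         positivity
  let T := ((Fin S → Bool) × Fin S) × ((Fin S → Bool) × Fin S)
  have hT : Fintype.card T = r ^ 2 := by simp [T, hr, sq]
  obtain ⟨f, hf⟩ := exists_balanced_map T n 16 (by rw [hT]; positivity) (by rw [hT]; exact hS2.le)
  have hemb : ∀ i : Fin 3, OutDegLE 16 fun (k : Fin 3 × T) (x : Fin n) => (i, f x) = k := by
    intro i k
    obtain ⟨s, h1, h2⟩ := hf k.2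
    exact ⟨s, h1, fun x hx => h2 x (by rw [← hx])⟩
  refine ⟨Fin 3 × T, inferInstance, CoreEdge H Ex, fun i => (0, f i), fun i => (2, f i), hwf, ho,
    hi, hemb 0, hemb 2, ?_, fun D hD => ?_⟩
  · rw [Fintype.card_prod, hT, Fintype.card_fin]
    exact Nat.mul_le_mul_left 3 hS1
  · have hS2' : (n : ℝ) ≤ 16 * (r : ℝ) ^ 2 := by exact_mod_cast hS2.le
    have hS1' : (r : ℝ) ^ 2 ≤ n := by exact_mod_cast hS1
    obtain ⟨X, Z, hX, hZ, hXZ⟩ := hrob D (hD.trans (by nlinarith))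
    have hgood : ∀ X : Finset T, (r : ℝ) ^ 2 - κ / 16 * (r : ℝ) ^ 2 ≤ X.card →
        (n : ℝ) ≤ (univ.filter fun i => f i ∈ X).card + κ * n := by
      intro X hX
      have h1 := card_preimage_le hf Xᶜ (univ.filter fun i => f i ∈ X)ᶜ (fun i hi => by
        simpa using hi)
      rw [card_compl, card_compl, hT, Fintype.card_fin] at h1
      have h2 : X.card ≤ r ^ 2 := by rw [← hT]; exact card_le_univ _
      have h3 : n ≤ (univ.filter fun i => f i ∈ X).card + 16 * (r ^ 2 - X.card) := by omega
      have h4 : (n : ℝ) ≤ (univ.filter fun i => f i ∈ X).card +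
          16 * ((r : ℝ) ^ 2 - X.card) := by
        have := (Nat.cast_le (α := ℝ)).2 h3
        push_cast [Nat.cast_sub h2] at this
        exact this
      nlinarith
    exact ⟨_, _, hgood X hX, hgood Z hZ, fun x hx z hz =>
      hXZ _ (mem_filter.1 hx).2 _ (mem_filter.1 hz).2⟩

/-! ### Nets: loss proportional to the number of deletions. -/

/-- A digraph with the entries `ent` and the exits `ext` in which the deletion of `k ≤ c n` nodes
leaves all but `C k` entries joined to all but `C k` exits. -/
structure IsNet (n δ : ℕ) (c C : ℝ) {V : Type} (E : V → V → Prop) (ent ext : Fin n → V) :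
    Prop where
  wf : WellFounded E
  outDeg : OutDegLE δ E
  inDeg : OutDegLE δ fun x y => E y x
  ent_inj : Function.Injective ent
  ext_inj : Function.Injective ext
  no_edge_ent : ∀ i v, ¬ E v (ent i)
  no_edge_ext : ∀ i v, ¬ E (ext i) v
  robust : ∀ D : Finset V, (D.card : ℝ) ≤ c * n → ∃ X Z : Finset (Fin n),
    (n : ℝ) ≤ X.card + C * D.card ∧ (n : ℝ) ≤ Z.card + C * D.card ∧
    ∀ x ∈ X, ∀ z ∈ Z, ent x ∉ D ∧ ext z ∉ D ∧ Relation.ReflTransGen (Avoid D E) (ent x) (ext z)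

theorem IsExpander.card_unseen {α : Type*} [Fintype α] {A δ : ℕ} {E : α → α → Prop}
    (h : IsExpander A δ E) (X Y : Finset α) (hY : Fintype.card α < A * Y.card)
    (hXY : ∀ x ∈ X, ∀ y ∈ Y, ¬ E x y) : A * X.card + Y.card ≤ Fintype.card α := by
  by_contra! hlt
  obtain ⟨x, hx, y, hy, hxy⟩ := h.edge X Y hlt hY
  exact hXY x hx y hy hxy

open Classical in
/-- The elements of `α` which are sent to deleted nodes. -/
noncomputable def pull {α β : Type*} [Fintype α] (g : α → β) (D : Finset β) : Finset α :=
  univ.filter fun x => g x ∈ D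

theorem mem_pull {α β : Type*} [Fintype α] {g : α → β} {D : Finset β} {x : α} :
    x ∈ pull g D ↔ g x ∈ D := by simp [pull]

theorem card_pull_le {α β : Type*} [Fintype α] {g : α → β} (hg : Function.Injective g)
    (D : Finset β) : (pull g D).card ≤ D.card :=
  card_le_card_of_injOn g (fun _ hx => mem_pull.1 hx) hg.injOn

theorem wellFounded_false {α : Type*} : WellFounded (fun _ _ : α => False) :=
  ⟨fun _ => ⟨_, fun _ h => h.elim⟩⟩

theorem outDegLE_false {α β : Type*} (k : ℕ) : OutDegLE k (fun (_ : α) (_ : β) => False) :=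
  fun _ => ⟨∅, by simp, fun _ h => h.elim⟩

theorem wellFounded_liftRel {α β : Type*} {E : α → α → Prop} {F : β → β → Prop}
    (hE : WellFounded E) (hF : WellFounded F) : WellFounded (Sum.LiftRel E F) := by
  refine ⟨fun x => ?_⟩
  rcases x with a | b
  · induction a using hE.induction with
    | _ a ih =>
      refine ⟨_, fun y hy => ?_⟩
      rcases hy with ⟨hy⟩
      exact ih _ hy
  · induction b using hF.induction with
    | _ b ih =>
      refine ⟨_, fun y hy => ?_⟩
      rcases hy with _ | ⟨hy⟩
      exact ih _ hy

/-- The complete bipartite graph through a hub. -/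
theorem isNet_hub (n δ : ℕ) (c C : ℝ) (hn : n ≤ δ) (hδ : 1 ≤ δ) (hc : c * n < 1) :
    IsNet n δ c C (V := Fin n ⊕ Unit ⊕ Fin n)
      (Chain (fun _ _ => False) (fun _ _ => True) (fun _ _ => False) (fun _ _ => True)
        (fun _ _ => False)) Sum.inl (Sum.inr ∘ Sum.inr) where
  wf := wellFounded_chain wellFounded_false wellFounded_false wellFounded_false
  outDeg := outDegLE_chain (fun _ => ⟨∅, univ, by simpa using hδ, fun _ h => h.elim,
      fun _ _ => mem_univ _⟩)
    (fun _ => ⟨∅, univ, by simpa using hn, fun _ h => h.elim, fun _ _ => mem_univ _⟩)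
    (outDegLE_false _)
  inDeg := inDegLE_chain (outDegLE_false _)
    (fun _ => ⟨univ, ∅, by simpa using hn, fun _ _ => mem_univ _, fun _ h => h.elim⟩)
    (fun _ => ⟨univ, ∅, by simpa using hδ, fun _ _ => mem_univ _, fun _ h => h.elim⟩)
  ent_inj := Sum.inl_injective
  ext_inj := Sum.inr_injective.comp Sum.inr_injective
  no_edge_ent := by rintro i (v | v | v) h <;> exact h
  no_edge_ext := by rintro i (v | v | v) h <;> exact h
  robust D hD := by
    have : D = ∅ := by
      rw [← card_eq_zero]
      have : (D.card : ℝ) < 1 := hD.trans_lt hc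
      have h : D.card < 1 := by exact_mod_cast this
      omega
    subst this
    refine ⟨univ, univ, by simp, by simp, fun x _ z _ => ⟨by simp, by simp, ?_⟩⟩
    exact .head (b := Sum.inr (Sum.inl ())) ⟨by simp, by simp, trivial⟩
      (.single ⟨by simp, by simp, trivial⟩)

section Step

variable {K V' : Type} {n m : ℕ}

/-- Keeps `δ` fixed through the recursion. A node `g q` of the inner net has no edges of its own in
this direction, so its new edges do not add to old ones; other nodes of the net gain none. Applied
to exits with outgoing and to entries with incoming edges. -/
theorem degree_step {dK δ e : ℕ} {F : K → K → Prop} {E' : V' → V' → Prop} {t : Fin n → K}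
    {g : Fin m → V'} {R : Fin n → Fin m → Prop} (hF : OutDegLE dK F) (hE : OutDegLE δ E')
    (ht : OutDegLE 16 fun k i => t i = k) (hg : Function.Injective g)
    (hno : ∀ i v, ¬ E' (g i) v) (hR : OutDegLE e fun q i => R i q) (hdK : dK + 16 ≤ δ)
    (he : e ≤ δ) (x : K ⊕ V') :
    ∃ (s : Finset (K ⊕ V')) (u : Finset (Fin n)), s.card + u.card ≤ δ ∧
      (∀ y, Sum.LiftRel F E' x y → y ∈ s) ∧
      ∀ i, Sum.elim (fun k => t i = k) (fun v => ∃ q, R i q ∧ g q = v) x → i ∈ u := by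
  classical
  rcases x with k | v
  · obtain ⟨s, hs, hs'⟩ := hF k
    obtain ⟨u, hu, hu'⟩ := ht k
    refine ⟨s.map ⟨_, Sum.inl_injective⟩, u, by rw [card_map]; omega, fun y hy => ?_,
      fun i hi => hu' i hi⟩
    rcases hy with ⟨hy⟩
    exact mem_map.2 ⟨_, hs' _ hy, rfl⟩
  · by_cases h : ∃ q, g q = v
    · obtain ⟨q, rfl⟩ := h
      obtain ⟨u, hu, hu'⟩ := hR q
      refine ⟨∅, u, by simpa using hu.trans he, fun y hy => ?_, fun i hi => ?_⟩
      · rcases hy with _ | ⟨hy⟩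
        exact (hno _ _ hy).elim
      · obtain ⟨q', h1, h2⟩ := hi
        exact hu' i (hg h2 ▸ h1)
    · obtain ⟨s, hs, hs'⟩ := hE v
      refine ⟨s.map ⟨_, Sum.inr_injective⟩, ∅, by simpa using hs, fun y hy => ?_, fun i hi => ?_⟩
      · rcases hy with _ | ⟨hy⟩
        exact mem_map.2 ⟨_, hs' _ hy, rfl⟩
      · obtain ⟨q, -, hq⟩ := hi
        exact (h ⟨q, hq⟩).elim

theorem entry_step {δ e : ℕ} {t : Fin n → K} {g : Fin m → V'} {R : Fin n → Fin m → Prop}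
    (hR : OutDegLE e R) (he : e + 1 ≤ δ) (i : Fin n) : ∃ u : Finset (K ⊕ V'), u.card ≤ δ ∧
      ∀ x, Sum.elim (fun k => t i = k) (fun v => ∃ q, R i q ∧ g q = v) x → x ∈ u := by
  classical
  obtain ⟨s, hs, hs'⟩ := hR i
  refine ⟨({t i} : Finset K).disjSum (s.image g), ?_, ?_⟩
  · rw [card_disjSum, card_singleton]
    have := card_image_le (s := s) (f := g)
    omega
  · rintro (k | v) h
    · simpa using Eq.symm h
    · obtain ⟨q, hq, rfl⟩ := h
      simpa using ⟨q, hs' _ hq, rfl⟩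

open Classical in
/-- The terminals which see the good nodes of the next level. -/
theorem card_seeing {δ : ℕ} {Ex : Fin n → Fin n → Prop} (hEx : IsExpander 4 δ Ex)
    {f : Fin n → Fin m} (hf : OutDegLE 2 fun q i => f i = q) (hn : 1 ≤ n) (X : Finset (Fin m))
    (D : Finset (Fin n)) (C k : ℝ) (hX : (m : ℝ) ≤ X.card + C * k) (hk : 4 * (C * k) ≤ n)
    (hC : 2 ≤ C) (hDk : D.card ≤ k) :
    (n : ℝ) ≤ (univ.filter fun i => i ∉ D ∧ ∃ q, (∃ j, Ex i j ∧ f j = q) ∧ q ∈ X).card + C * k := by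
  set W := univ.filter fun i => i ∉ D ∧ ∃ q, (∃ j, Ex i j ∧ f j = q) ∧ q ∈ X with hW
  set Y := univ.filter fun j => f j ∈ X with hY
  have h1 := card_preimage_le hf Xᶜ Yᶜ (fun j hj => by simpa [hY] using hj)
  have h2 := card_add_card_compl X
  have h3 := card_add_card_compl Y
  rw [Fintype.card_fin] at h2 h3
  have h1' : (Yᶜ.card : ℝ) ≤ 2 * Xᶜ.card := by exact_mod_cast h1
  have h2' : (X.card : ℝ) + Xᶜ.card = m := by exact_mod_cast h2
  have h3' : (Y.card : ℝ) + Yᶜ.card = n := by exact_mod_cast h3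
  have hn' : (1 : ℝ) ≤ n := by exact_mod_cast hn
  set B := univ.filter fun i => ∀ j ∈ Y, ¬ Ex i j with hB
  have h4 := hEx.card_unseen B Y (by
    rw [Fintype.card_fin]
    have : (n : ℝ) < 4 * Y.card := by linarith
    exact_mod_cast this) (fun i hi => (mem_filter.1 hi).2)
  rw [Fintype.card_fin] at h4
  -- Since `|Yᶜ| ≤ 2 * C * k`, at most `C * k / 2` terminals are unseen; the at most `k` deleted
  -- ones add no more than `C * k / 2`, because `2 ≤ C`.
  have h4' : 4 * (B.card : ℝ) + Y.card ≤ n := by exact_mod_cast h4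
  have h5 : (univ : Finset (Fin n)) ⊆ W ∪ (D ∪ B) := by
    intro i _
    by_cases hi : i ∈ D
    · exact mem_union_right _ (mem_union_left _ hi)
    by_cases hi' : i ∈ B
    · exact mem_union_right _ (mem_union_right _ hi')
    · simp only [hB, mem_filter, mem_univ, true_and, not_forall, not_not, hY] at hi'
      obtain ⟨j, hj, hij⟩ := hi'
      exact mem_union_left _ (mem_filter.2 ⟨mem_univ _, hi, f j, ⟨j, hij, rfl⟩, hj⟩)
  have h6 : n ≤ W.card + (D.card + B.card) := by
    have := (card_le_card h5).trans (card_union_le _ _)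
    have h7 := card_union_le D B
    rw [card_univ, Fintype.card_fin] at this
    omega
  have h6' : (n : ℝ) ≤ W.card + (D.card + B.card) := by exact_mod_cast h6
  nlinarith

theorem isNet_step {dK δ e : ℕ} {c C κ : ℝ} [Fintype K] [Fintype V'] {F : K → K → Prop}
    {s t : Fin n → K}
    (hn : 1 ≤ n) (hc : 0 < c) (hC : 2 ≤ C) (hκ : 1 + 4 * κ / c ≤ C) (hκ0 : 0 ≤ κ)
    (hcC : C * c ≤ 1)
    (hF : WellFounded F) (hFo : OutDegLE dK F) (hFi : OutDegLE dK fun x y => F y x)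
    (hs : OutDegLE 16 fun k i => s i = k) (ht : OutDegLE 16 fun k i => t i = k)
    (hrob : ∀ D : Finset K, (D.card : ℝ) ≤ c * n → ∃ X Z : Finset (Fin n),
      (n : ℝ) ≤ X.card + κ * n ∧ (n : ℝ) ≤ Z.card + κ * n ∧
      ∀ x ∈ X, ∀ z ∈ Z, s x ∉ D ∧ t z ∉ D ∧ Relation.ReflTransGen (Avoid D F) (s x) (t z))
    {E' : V' → V' → Prop} {ent ext : Fin m → V'} (hnet : IsNet m δ c C E' ent ext)
    (hm : n ≤ 2 * m) (hm1 : 1 ≤ m) {Ex : Fin n → Fin n → Prop} (hEx : IsExpander 4 e Ex)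
    (hdK : dK + 16 ≤ δ) (he : 2 * e + 1 ≤ δ) :
    ∃ E : Fin n ⊕ (K ⊕ V') ⊕ Fin n → Fin n ⊕ (K ⊕ V') ⊕ Fin n → Prop,
      IsNet n δ c C E Sum.inl (Sum.inr ∘ Sum.inr) := by
  classical
  obtain ⟨f, hf⟩ := exists_balanced_map (Fin m) n 2 (by simpa using Nat.pos_of_ne_zero (by omega)) (by simpa using hm)
  let R : Fin n → Fin m → Prop := fun i q => ∃ j, Ex i j ∧ f j = q
  have hR : OutDegLE e R := by simpa using hEx.deg.comp (outDegLE_of_fun f)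
  have hR' : OutDegLE (2 * e) fun q i => R i q :=
    (hf.comp hEx.deg).sub fun q i ⟨j, h1, h2⟩ => ⟨j, h2, hEx.symm _ _ h1⟩
  let I : Fin n → K ⊕ V' → Prop := fun i x =>
    Sum.elim (fun k => s i = k) (fun v => ∃ q, R i q ∧ ent q = v) x
  let O : K ⊕ V' → Fin n → Prop := fun x i =>
    Sum.elim (fun k => t i = k) (fun v => ∃ q, R i q ∧ ext q = v) x
  refine ⟨Chain (fun _ _ => False) I (Sum.LiftRel F E') O (fun _ _ => False), ?_⟩
  have hlift : ∀ x y : K ⊕ V', Sum.LiftRel F E' y x →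
      Sum.LiftRel (fun a b => F b a) (fun a b => E' b a) x y := by
    rintro _ _ (⟨h⟩ | ⟨h⟩)
    · exact .inl h
    · exact .inr h
  refine
  { wf := wellFounded_chain wellFounded_false (wellFounded_liftRel hF hnet.wf) wellFounded_false
    outDeg := outDegLE_chain (fun i => ?_)
      (degree_step hFo hnet.outDeg ht hnet.ext_inj hnet.no_edge_ext hR' hdK (by omega))
      (outDegLE_false _)
    inDeg := inDegLE_chain (outDegLE_false _) (fun x => ?_) (fun i => ?_)
    ent_inj := Sum.inl_injective
    ext_inj := Sum.inr_injective.comp Sum.inr_injective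
    no_edge_ent := by rintro i (v | v | v) h <;> exact h
    no_edge_ext := by rintro i (v | v | v) h <;> exact h
    robust := fun D hD => ?_ }
  · obtain ⟨u, hu, hu'⟩ := entry_step (t := s) (g := ent) hR (by omega : e + 1 ≤ δ) i
    exact ⟨∅, u, by simpa using hu, fun _ h => h.elim, hu'⟩
  · obtain ⟨a, b, h1, h2, h3⟩ := degree_step hFi hnet.inDeg hs hnet.ent_inj hnet.no_edge_ent hR'
      hdK (by omega) x
    exact ⟨b, a, by omega, h3, fun y hy => h2 y (hlift _ _ hy)⟩
  · obtain ⟨u, hu, hu'⟩ := entry_step (t := t) (g := ext) hR (by omega : e + 1 ≤ δ) i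
    exact ⟨u, ∅, by simpa using hu, hu', fun _ h => h.elim⟩
  · let D₀ : Finset (Fin n) := pull Sum.inl D
    let D₁ : Finset (Fin n) := pull (Sum.inr ∘ Sum.inr) D
    have hn' : (1 : ℝ) ≤ n := by exact_mod_cast hn
    have hm' : (n : ℝ) ≤ 2 * m := by exact_mod_cast hm
    have hD₀ : (D₀.card : ℝ) ≤ D.card := by exact_mod_cast card_pull_le Sum.inl_injective D
    have hD₁ : (D₁.card : ℝ) ≤ D.card := by
      exact_mod_cast card_pull_le (Sum.inr_injective.comp Sum.inr_injective) D
    -- With many deletions the loss `κ * n` of the core is at most `4 * κ / c * |D|`. With few, `|D|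
    -- < c * n / 4 ≤ c * m`, so the smaller net applies, and the expander makes up for its fewer
    -- terminals.
    by_cases hbig : c * n ≤ 4 * D.card
    · let DK : Finset K := pull (Sum.inr ∘ Sum.inl ∘ Sum.inl) D
      have hDK : (DK.card : ℝ) ≤ D.card := by
        exact_mod_cast card_pull_le
          (Sum.inr_injective.comp (Sum.inl_injective.comp Sum.inl_injective)) D
      obtain ⟨X, Z, hX, hZ, hXZ⟩ := hrob DK (hDK.trans hD)
      have hloss : D.card + κ * n ≤ C * D.card := by
        have h1 : κ * n ≤ 4 * κ / c * D.card := by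
          rw [div_mul_eq_mul_div, le_div_iff₀ hc]
          nlinarith
        have h2 := mul_le_mul_of_nonneg_right hκ (Nat.cast_nonneg (α := ℝ) D.card)
        linarith
      have hsd : ∀ (X D' : Finset (Fin n)), (X.card : ℝ) ≤ (X \ D').card + D'.card := by
        intro X D'
        exact_mod_cast card_le_card_sdiff_add_card
      refine ⟨X \ D₀, Z \ D₁, ?_, ?_, fun x hx z hz => ?_⟩
      · have := hsd X D₀; linarith
      · have := hsd Z D₁; linarith
      · rw [mem_sdiff] at hx hz
        obtain ⟨h1, h2, h3⟩ := hXZ x hx.1 z hz.1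
        have h4 : Sum.inl x ∉ D := fun h => hx.2 (mem_pull.2 h)
        have h5 : Sum.inr (Sum.inr z) ∉ D := fun h => hz.2 (mem_pull.2 h)
        have h6 : ∀ k, k ∉ DK → Sum.inr (Sum.inl (Sum.inl k)) ∉ D := fun k hk h =>
          hk (mem_pull.2 h)
        refine ⟨h4, h5, .head (b := Sum.inr (Sum.inl (Sum.inl (s x)))) ⟨h4, h6 _ h1, rfl⟩
          (.tail (b := Sum.inr (Sum.inl (Sum.inl (t z)))) ?_ ⟨h6 _ h2, h5, rfl⟩)⟩
        exact h3.lift (fun k => Sum.inr (Sum.inl (Sum.inl k))) fun a b hab =>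
          ⟨h6 _ hab.1, h6 _ hab.2.1, Sum.LiftRel.inl hab.2.2⟩
    · push Not at hbig
      let DV : Finset V' := pull (Sum.inr ∘ Sum.inl ∘ Sum.inr) D
      have hDV : (DV.card : ℝ) ≤ D.card := by
        exact_mod_cast card_pull_le
          (Sum.inr_injective.comp (Sum.inl_injective.comp Sum.inr_injective)) D
      obtain ⟨X, Z, hX, hZ, hXZ⟩ := hnet.robust DV (by nlinarith)
      have hCD : 4 * (C * D.card) ≤ n := by
        have : C * (4 * D.card) ≤ C * (c * n) := mul_le_mul_of_nonneg_left hbig.le (by linarith)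
        nlinarith
      have hCV : C * (DV.card : ℝ) ≤ C * D.card := mul_le_mul_of_nonneg_left hDV (by linarith)
      refine ⟨_, _, card_seeing hEx hf hn X D₀ C D.card (by linarith) hCD hC hD₀,
        card_seeing hEx hf hn Z D₁ C D.card (by linarith) hCD hC hD₁, fun x hx z hz => ?_⟩
      obtain ⟨-, hx1, q, hxq, hq⟩ := mem_filter.1 hx
      obtain ⟨-, hz1, q', hzq, hq'⟩ := mem_filter.1 hz
      obtain ⟨h1, h2, h3⟩ := hXZ q hq q' hq'
      have h4 : Sum.inl x ∉ D := fun h => hx1 (mem_pull.2 h)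
      have h5 : Sum.inr (Sum.inr z) ∉ D := fun h => hz1 (mem_pull.2 h)
      have h6 : ∀ v, v ∉ DV → Sum.inr (Sum.inl (Sum.inr v)) ∉ D := fun k hk h =>
        hk (mem_pull.2 h)
      refine ⟨h4, h5, .head (b := Sum.inr (Sum.inl (Sum.inr (ent q)))) ⟨h4, h6 _ h1, q, hxq, rfl⟩
        (.tail (b := Sum.inr (Sum.inl (Sum.inr (ext q')))) ?_ ⟨h6 _ h2, h5, q', hzq, rfl⟩)⟩
      exact h3.lift (fun k => Sum.inr (Sum.inl (Sum.inr k))) fun a b hab =>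
        ⟨h6 _ hab.1, h6 _ hab.2.1, Sum.LiftRel.inr hab.2.2⟩

end Step

theorem exists_isNet : ∃ (δ : ℕ) (c C : ℝ), 0 < c ∧ 0 < C ∧ ∀ n : ℕ, 1 ≤ n →
    ∃ (V : Type) (_ : Fintype V) (E : V → V → Prop) (ent ext : Fin n → V),
      Fintype.card V ≤ 20 * n ∧ IsNet n δ c C E ent ext := by
  obtain ⟨dK, cK, n₀, hcK, hcore⟩ := exists_core_net (1 / 8) (by norm_num)
  obtain ⟨e, he⟩ := exists_isExpander 4
  -- The bound `1 / (n₀ + 3)` excludes deletions in the base case; `1 / 4` gives `C * c = 2 * c + 1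
  -- / 2 ≤ 1`.
  set c : ℝ := min cK (min (1 / 4) (1 / (n₀ + 3))) with hc
  have hc0 : 0 < c := lt_min hcK (lt_min (by norm_num) (by positivity))
  have hc1 : c ≤ cK := min_le_left _ _
  have hc2 : c ≤ 1 / 4 := (min_le_right _ _).trans (min_le_left _ _)
  have hc3 : c ≤ 1 / (n₀ + 3) := (min_le_right _ _).trans (min_le_right _ _)
  set C : ℝ := 2 + 4 * (1 / 8) / c with hC
  have hC2 : 2 ≤ C := by
    have : 0 ≤ 4 * (1 / 8) / c := by positivity
    linarith
  have hCc : C * c ≤ 1 := by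
    rw [hC, add_mul, div_mul_cancel₀ _ hc0.ne']
    linarith
  set δ := (dK + 16) + (2 * e + 1) + (n₀ + 2) with hδ
  refine ⟨δ, c, C, hc0, by linarith, fun n => ?_⟩
  induction n using Nat.strong_induction_on with
  | _ n ih =>
    intro hn
    by_cases hsmall : n < n₀ + 2
    · refine ⟨_, inferInstance, _, _, _, ?_, isNet_hub n δ c C (by omega) (by omega) ?_⟩
      · simp only [Fintype.card_sum, Fintype.card_fin, Fintype.card_unit]
        omega
      · have h1 : (n : ℝ) < n₀ + 3 := by exact_mod_cast (by omega : n < n₀ + 3)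
        calc c * n ≤ 1 / (n₀ + 3) * n := by gcongr
          _ < 1 / (n₀ + 3) * (n₀ + 3) := by gcongr
          _ = 1 := by field_simp
    · obtain ⟨K, _, F, s, t, hF, hFo, hFi, hs, ht, hK, hrob⟩ := hcore n (by omega)
      obtain ⟨V', _, E', ent, ext, hV, hnet⟩ := ih ((n + 1) / 2) (by omega) (by omega)
      obtain ⟨Ex, hEx⟩ := he (Fin n)
      obtain ⟨E, hE⟩ := isNet_step hn hc0 hC2 (by linarith) (by norm_num) hCc hF hFo hFi hs ht
        (fun D hD => hrob D (hD.trans (by gcongr))) hnet (by omega) (by omega) hEx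
        (by omega) (by omega)
      refine ⟨_, inferInstance, E, _, _, ?_, hE⟩
      -- `2n + 3n + 20⌈n/2⌉ ≤ 20n` because `n ≥ 2` here.
      simp only [Fintype.card_sum, Fintype.card_fin]
      omega

/-! ### From relations to DAGs. -/

theorem Steps.exists_relSeries {α : Type*} {R : α → α → Prop} : ∀ {k : ℕ} {a b : α},
    Steps R k a b → ∃ p : RelSeries {e : α × α | R e.1 e.2},
      p.head = a ∧ p.last = b ∧ p.length = k
  | 0, a, _, h => ⟨RelSeries.singleton _ a, rfl, h, rfl⟩
  | k + 1, a, b, ⟨c, hc, hk⟩ => by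
      obtain ⟨p, h1, h2, h3⟩ := hk.exists_relSeries
      refine ⟨p.cons a (by rw [h1]; exact hc), rfl, by rw [RelSeries.last_cons, h2], ?_⟩
      rw [RelSeries.cons_length, h3]

section Dag

variable {n : ℕ} {μ : Type} [Fintype μ]

/-- The subgraph which is induced by a set of nodes. -/
def inducedSubgraph (G : DAG) (W : Set G.V) : G.Subgraph where
  verts := W
  Adj u v := G.toDigraph.Adj u v ∧ u ∈ W ∧ v ∈ W
  adj_sub h := h.1
  fst_mem h := h.2.1
  snd_mem h := h.2.2

/-- `hI` and `hO'` ensure that only the left terminals are inputs, `hI'` and `hO` that only the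
right ones are outputs. The subgraph is induced by the undeleted inner nodes and the good terminals.
-/
theorem exists_dag_of_chain {δ : ℕ} {I : Fin n → μ → Prop} {F : μ → μ → Prop}
    {O : μ → Fin n → Prop} {c d : ℝ} (hF : WellFounded F)
    (hin : OutDegLE δ fun x y => Chain (fun _ _ => False) I F O (fun _ _ => False) y x)
    (hI : ∀ m, ∃ i, I i m) (hI' : ∀ i, ∃ m, I i m) (hO : ∀ m, ∃ i, O m i) (hO' : ∀ i, ∃ m, O m i)
    (hc : 0 < c) (hc1 : c ≤ 1)
    (hrob : ∀ D : Finset (Fin n ⊕ μ ⊕ Fin n), (D.card : ℝ) ≤ c * n → ∃ X Z : Finset (Fin n),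
      n ≤ X.card + D.card ∧ n ≤ Z.card + D.card ∧ ∀ x ∈ X, ∀ z ∈ Z,
        .inl x ∉ D ∧ .inr (.inr z) ∉ D ∧ ∃ (k : ℕ) (m m' : μ), I x m ∧ O m' z ∧ .inr (.inl m) ∉ D ∧
          .inr (.inl m') ∉ D ∧ d ≤ (k : ℝ) + 1 ∧
          Steps (Avoid (pull (Sum.inr ∘ Sum.inl) D) F) k m m') :
    ∃ G : DAG, G.IsMaximallySTRobust n c d ∧ Fintype.card G.V = 2 * n + Fintype.card μ ∧
      ∀ v, G.indegree v ≤ δ := by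
  classical
  have hwf : WellFounded (Chain (fun _ _ => False) I F O (fun _ _ => False)) :=
    wellFounded_chain wellFounded_false hF wellFounded_false
  let G : DAG :=
    { V := Fin n ⊕ μ ⊕ Fin n
      toDigraph := ⟨Chain (fun _ _ => False) I F O (fun _ _ => False)⟩
      acyclic := fun v h => hwf.transGen.irrefl.irrefl v h }
  have hinp : G.inputs = Set.range (Sum.inl : Fin n → Fin n ⊕ μ ⊕ Fin n) := by
    ext v
    constructor
    · intro hv
      rcases v with i | m | i
      · exact ⟨i, rfl⟩
      · obtain ⟨i, hi⟩ := hI m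
        exact (hv (.inl i) hi).elim
      · obtain ⟨m, hm⟩ := hO' i
        exact (hv (.inr (.inl m)) hm).elim
    · rintro ⟨i, rfl⟩ (v | v | v) h <;> exact h
  have hout : G.outputs = Set.range (Sum.inr ∘ Sum.inr : Fin n → Fin n ⊕ μ ⊕ Fin n) := by
    ext v
    constructor
    · intro hv
      rcases v with i | m | i
      · obtain ⟨m, hm⟩ := hI' i
        exact (hv (.inr (.inl m)) hm).elim
      · obtain ⟨i, hi⟩ := hO m
        exact (hv (.inr (.inr i)) hi).elim
      · exact ⟨i, rfl⟩
    · rintro ⟨i, rfl⟩ (v | v | v) h <;> exact h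
  have hinj : Function.Injective (Sum.inr ∘ Sum.inr : Fin n → Fin n ⊕ μ ⊕ Fin n) :=
    Sum.inr_injective.comp Sum.inr_injective
  refine ⟨G, ⟨hc, hc1, ?_, ?_, fun k hk D hD => ?_⟩, ?_, fun v => ?_⟩
  · rw [hinp, Set.ncard_range_of_injective Sum.inl_injective, Nat.card_fin]
  · rw [hout, Set.ncard_range_of_injective hinj, Nat.card_fin]
  · obtain ⟨X, Z, hX, hZ, hXZ⟩ := hrob D ((Nat.cast_le.2 hD).trans hk)
    let W : Set G.V := {v | v ∉ D ∧ (∀ i, v = Sum.inl i → i ∈ X) ∧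
      ∀ i, v = Sum.inr (Sum.inr i) → i ∈ Z}
    by_cases hne : X.Nonempty ∧ Z.Nonempty
    · obtain ⟨⟨x₀, hx₀⟩, ⟨z₀, hz₀⟩⟩ := hne
      have hXW : ∀ x ∈ X, (Sum.inl x : G.V) ∈ W := fun x hx =>
        ⟨(hXZ x hx z₀ hz₀).1, fun i hi => Sum.inl_injective hi ▸ hx, fun i hi => (by cases hi)⟩
      have hZW : ∀ z ∈ Z, (Sum.inr (Sum.inr z) : G.V) ∈ W := fun z hz =>
        ⟨(hXZ x₀ hx₀ z hz).2.1, fun i hi => (by cases hi), fun i hi =>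
          (hinj (a₁ := z) (a₂ := i) hi) ▸ hz⟩
      refine ⟨inducedSubgraph G W, fun v hv h => h.1 hv, ?_, ?_, ?_⟩
      · have h1 : (Sum.inl '' (X : Set (Fin n)) : Set G.V) ⊆ G.inputs ∩ W := by
          rintro _ ⟨x, hx, rfl⟩
          exact ⟨hinp ▸ ⟨x, rfl⟩, hXW x hx⟩
        have h2 := Set.ncard_le_ncard h1 (Set.toFinite _)
        rw [Set.ncard_image_of_injective _ Sum.inl_injective, Set.ncard_coe_finset] at h2
        exact le_trans (by omega) h2
      · have h1 : (Sum.inr ∘ Sum.inr '' (Z : Set (Fin n)) : Set G.V) ⊆ G.outputs ∩ W := by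
          rintro _ ⟨x, hx, rfl⟩
          exact ⟨hout ▸ ⟨x, rfl⟩, hZW x hx⟩
        have h2 := Set.ncard_le_ncard h1 (Set.toFinite _)
        rw [Set.ncard_image_of_injective _ hinj, Set.ncard_coe_finset] at h2
        exact le_trans (by omega) h2
      · rintro s ⟨hs, hsW⟩ t ⟨ht, htW⟩
        rw [hinp] at hs
        rw [hout] at ht
        obtain ⟨x, rfl⟩ := hs
        obtain ⟨z, rfl⟩ := ht
        obtain ⟨-, -, k, m, m', h1, h2, h3, h4, h5, h6⟩ :=
          hXZ x (hsW.2.1 x rfl) z (htW.2.2 z rfl)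
        have hmW : ∀ m : μ, Sum.inr (Sum.inl m) ∉ D → (Sum.inr (Sum.inl m) : G.V) ∈ W :=
          fun m hm => ⟨hm, fun i hi => (by cases hi), fun i hi => (by cases hi)⟩
        have hst : Steps (inducedSubgraph G W).Adj k (Sum.inr (Sum.inl m))
            (Sum.inr (Sum.inl m')) :=
          h6.lift (fun m => Sum.inr (Sum.inl m)) fun a b hab =>
            ⟨hab.2.2, hmW a fun h => hab.1 (mem_pull.2 h),
              hmW b fun h => hab.2.1 (mem_pull.2 h)⟩
        have hall : Steps (inducedSubgraph G W).Adj (k + 1 + 1) (Sum.inl x)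
            (Sum.inr (Sum.inr z)) :=
          ⟨Sum.inr (Sum.inl m), ⟨h1, hsW, hmW m h3⟩,
            hst.trans (Steps.single ⟨h2, hmW m' h4, htW⟩)⟩
        obtain ⟨p, hp1, hp2, hp3⟩ := hall.exists_relSeries
        refine ⟨hsW, htW, p, hp1, hp2, ?_⟩
        rw [hp3]
        push_cast
        linarith
    -- If `X` or `Z` is empty, then `n ≤ |D| ≤ k`, nothing is required, and the empty subgraph
    -- serves.
    · have hnk : n - k = 0 := by
        rw [not_and_or, not_nonempty_iff_eq_empty, not_nonempty_iff_eq_empty] at hne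
        rcases hne with h | h
        · rw [h, card_empty] at hX; omega
        · rw [h, card_empty] at hZ; omega
      refine ⟨inducedSubgraph G ∅, fun v _ h => h, by omega, by omega, ?_⟩
      rintro s ⟨_, hs⟩
      exact hs.elim
  · change Fintype.card (Fin n ⊕ μ ⊕ Fin n) = _
    simp only [Fintype.card_sum, Fintype.card_fin]
    omega
  · obtain ⟨s, hs, hs'⟩ := hin v
    have h1 : {u | G.toDigraph.Adj u v} ⊆ (s : Set G.V) := fun u hu => hs' u hu
    have h2 := Set.ncard_le_ncard h1 (Set.toFinite _)
    rw [Set.ncard_coe_finset] at h2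
    exact h2.trans hs

end Dag

/-! ### The depth-robust middle part and the terminals. -/

/-- Depth-robustness is used with `ε / 2`: the spare factor `2 ^ (ε / 2 * S)` absorbs the
logarithmic factor in `n ≤ 4 * S * 2 ^ S` and the constant `1 / 8`. -/
theorem exists_long_range (ε : ℝ) (hε : 0 < ε) (hε1 : ε < 1) : ∃ δ n₀ : ℕ, ∀ n, n₀ ≤ n →
    ∃ (ρ : Type) (_ : Fintype ρ) (H : ρ → ρ → Prop) (φ : ρ → Fin n), WellFounded H ∧
      OutDegLE δ (fun x y => H y x) ∧ Function.Injective φ ∧ n ≤ 4 * Fintype.card ρ ∧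
      ∀ Q : Finset ρ, Fintype.card ρ ≤ 2 * Q.card →
        ∃ k a b, Steps (Within Q H) k a b ∧ (n : ℝ) ^ (1 - ε) ≤ (k : ℝ) + 1 := by
  obtain ⟨δ, hδ⟩ := exists_depthRobust (ε / 2) (1 / 2) (by positivity) (by norm_num)
  have hx1 : (1 : ℝ) < 2 ^ (ε / 2) := Real.one_lt_rpow (by norm_num) (by positivity)
  obtain ⟨S₀, hS₀⟩ := exists_linear_le_exp 4 _ (1 / 8) hx1 (by norm_num)
  refine ⟨δ, 2 ^ (S₀ + 1) * (S₀ + 1), fun n hn => ?_⟩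
  obtain ⟨S, hS, hS1, hS2⟩ := exists_between_of_growth (fun S => 2 ^ S * S) 4 (S₀ + 1)
    (fun S hS => two_pow_mul_growth S (by omega)) le_two_pow_mul n hn
  have hSpos : 1 ≤ S := by omega
  obtain ⟨H, hwf, -, hi, hwalk⟩ := hδ S hSpos
  have hcard : Fintype.card ((Fin S → Bool) × Fin S) = 2 ^ S * S := by simp
  refine ⟨(Fin S → Bool) × Fin S, inferInstance, H,
    fun z => Fin.castLE (by rw [hcard]; exact hS1) (Fintype.equivFin _ z), hwf, hi,
    fun a b hab => (Fintype.equivFin _).injective (Fin.castLE_injective _ hab),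
    by rw [hcard]; exact hS2.le, fun Q hQ => ?_⟩
  rw [hcard] at hQ
  have hQ' : ((2 ^ S * S : ℕ) : ℝ) ≤ 2 * Q.card := by exact_mod_cast hQ
  push_cast at hQ'
  obtain ⟨k, a, b, hk, hk'⟩ := hwalk Q (by linarith)
  refine ⟨k, a, b, hk, le_trans ?_ hk'⟩
  have hS' : (1 : ℝ) ≤ S := by exact_mod_cast hSpos
  have hn' : (n : ℝ) ≤ 2 ^ (S : ℝ) * (4 * S) := by
    have : ((n : ℕ) : ℝ) ≤ ((4 * (2 ^ S * S) : ℕ) : ℝ) := by exact_mod_cast hS2.le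
    push_cast at this
    rw [Real.rpow_natCast]
    linarith
  have h4 := hS₀ S (by omega)
  rw [← Real.rpow_mul_natCast (by norm_num)] at h4
  calc (n : ℝ) ^ (1 - ε) ≤ (2 ^ (S : ℝ) * (4 * S)) ^ (1 - ε) :=
        Real.rpow_le_rpow (by positivity) hn' (by linarith)
    _ = (2 ^ (S : ℝ)) ^ (1 - ε) * (4 * (S : ℝ)) ^ (1 - ε) :=
        Real.mul_rpow (by positivity) (by positivity)
    _ ≤ (2 ^ (S : ℝ)) ^ (1 - ε) * (4 * S) := by
        gcongr
        exact Real.rpow_le_self_of_one_le (by linarith) (by linarith)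
    _ ≤ (2 ^ (S : ℝ)) ^ (1 - ε) * (1 / 8 * 2 ^ (ε / 2 * S)) := by gcongr
    _ = 1 / 2 / 4 * 2 ^ ((1 - ε / 2) * S) := by
        rw [← Real.rpow_mul (by norm_num)]
        have : (1 - ε / 2) * (S : ℝ) = S * (1 - ε) + ε / 2 * S := by ring
        rw [this, Real.rpow_add (by norm_num)]
        ring

theorem card_pull_add_card_pull_le {α β γ : Type*} [Fintype α] [Fintype β] {f : α → γ}
    {g : β → γ} (hf : Function.Injective f) (hg : Function.Injective g) (hfg : ∀ a b, f a ≠ g b)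
    (D : Finset γ) : (pull f D).card + (pull g D).card ≤ D.card := by
  rw [← card_disjSum]
  refine card_le_card_of_injOn (Sum.elim f g) (fun x hx => ?_) (hf.sumElim hg hfg).injOn
  rcases x with a | b
  · exact (mem_pull (g := f)).1 (inl_mem_disjSum.1 (mem_coe.1 hx))
  · exact (mem_pull (g := g)).1 (inr_mem_disjSum.1 (mem_coe.1 hx))

-- Improves the loss `C k` to `k`, as maximal robustness requires: the set `B` of unseen terminals
-- satisfies `A|B| + |X| ≤ n`, so `A|B| ≤ C k ≤ A k`.
open Classical in
theorem card_terminals {n A e : ℕ} {Ex : Fin n → Fin n → Prop} (hEx : IsExpander A e Ex)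
    (hA : 3 ≤ A) (hn : 1 ≤ n) {C : ℝ} (hC : C ≤ A) (X D : Finset (Fin n)) (k : ℕ)
    (hX : (n : ℝ) ≤ X.card + C * k) (hk : 2 * (C * k) ≤ n) :
    n ≤ (univ.filter fun i => i ∉ D ∧ ∃ j ∈ X, Ex i j).card + (D.card + k) := by
  have hA' : (3 : ℝ) ≤ A := by exact_mod_cast hA
  have hn' : (1 : ℝ) ≤ n := by exact_mod_cast hn
  set W := univ.filter fun i => i ∉ D ∧ ∃ j ∈ X, Ex i j with hW
  set B := univ.filter fun i => ∀ j ∈ X, ¬ Ex i j with hB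
  have h4 := hEx.card_unseen B X (by
    rw [Fintype.card_fin]
    have : (n : ℝ) < A * X.card := by nlinarith
    exact_mod_cast this) (fun i hi => (mem_filter.1 hi).2)
  rw [Fintype.card_fin] at h4
  have h4' : (A : ℝ) * B.card + X.card ≤ n := by exact_mod_cast h4
  have hBk : B.card ≤ k := by
    have h1 : (A : ℝ) * B.card ≤ A * k := by
      have : C * k ≤ A * (k : ℝ) := mul_le_mul_of_nonneg_right hC (Nat.cast_nonneg _)
      linarith
    have h2 := le_of_mul_le_mul_left h1 (by linarith)
    exact_mod_cast h2
  have h5 : (univ : Finset (Fin n)) ⊆ W ∪ (D ∪ B) := by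
    intro i _
    by_cases hi : i ∈ D
    · exact mem_union_right _ (mem_union_left _ hi)
    by_cases hi' : i ∈ B
    · exact mem_union_right _ (mem_union_right _ hi')
    · simp only [hB, mem_filter, mem_univ, true_and, not_forall, not_not] at hi'
      obtain ⟨j, hj, hij⟩ := hi'
      exact mem_union_left _ (mem_filter.2 ⟨mem_univ _, hi, j, hj, hij⟩)
  have h6 := (card_le_card h5).trans (card_union_le _ _)
  have h7 := card_union_le D B
  rw [card_univ, Fintype.card_fin] at h6
  omega

/-- As `c * n < 1`, nothing can be deleted; a directed path on `n + 1` nodes, all joined to every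
input and output, suffices. -/
theorem exists_dag_small (n N : ℕ) (hn : 1 ≤ n) (hN : n + 1 ≤ N) {c d : ℝ} (hc : 0 < c)
    (hc1 : c ≤ 1) (hcn : c * n < 1) (hd : d ≤ n) :
    ∃ G : DAG, G.IsMaximallySTRobust n c d ∧ Fintype.card G.V ≤ 4 * n ∧
      ∀ v, G.indegree v ≤ N := by
  have hF : WellFounded fun a b : Fin (n + 1) => a.1 + 1 = b.1 :=
    Subrelation.wf (r := fun a b : Fin (n + 1) => a < b)
      (fun {a b} (h : a.1 + 1 = b.1) => Fin.lt_def.2 (by omega)) wellFounded_lt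
  have hinj : Function.Injective (fun b : Fin (n + 1) => b.1 + 1) := fun a b h =>
    Fin.ext (Nat.succ_injective h)
  obtain ⟨G, h1, h2, h3⟩ := exists_dag_of_chain (n := n) (δ := N) (I := fun _ _ => True)
    (F := fun a b : Fin (n + 1) => a.1 + 1 = b.1) (O := fun _ _ => True) (c := c) (d := d) hF
    (inDegLE_chain (outDegLE_false _) (fun m => by
      obtain ⟨s, hs, hs'⟩ := outDegLE_of_injective hinj m.1
      exact ⟨univ, s, by rw [card_univ, Fintype.card_fin]; omega, fun _ _ => mem_univ _, hs'⟩)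
      (fun b => ⟨univ, ∅, by simpa using hN, fun _ _ => mem_univ _, fun _ h => h.elim⟩))
    (fun _ => ⟨⟨0, hn⟩, trivial⟩) (fun _ => ⟨0, trivial⟩) (fun _ => ⟨⟨0, hn⟩, trivial⟩)
    (fun _ => ⟨0, trivial⟩) hc hc1 (fun D hD => by
      have : D = ∅ := by
        rw [← card_eq_zero]
        have : (D.card : ℝ) < 1 := hD.trans_lt hcn
        have h : D.card < 1 := by exact_mod_cast this
        omega
      subst this
      refine ⟨univ, univ, by simp, by simp, fun x _ z _ => ⟨by simp, by simp, n, 0, Fin.last n,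
        trivial, trivial, by simp, by simp, by linarith, ?_⟩⟩
      have key : ∀ k (hk : k < n + 1), Steps (Avoid (pull (Sum.inr ∘ Sum.inl)
          (∅ : Finset (Fin n ⊕ Fin (n + 1) ⊕ Fin n))) fun a b : Fin (n + 1) => a.1 + 1 = b.1) k 0
          ⟨k, hk⟩ := fun k => by
        induction k with
        | zero => exact fun _ => rfl
        | succ k ih =>
          exact fun hk => (ih (by omega)).trans (Steps.single ⟨by simp [mem_pull],
            by simp [mem_pull], rfl⟩)
      exact key n (Nat.lt_succ_self n))
  refine ⟨G, h1, ?_, h3⟩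
  rw [h2, Fintype.card_fin]
  omega

/-- A walk of length `0` says nothing about membership in `Q`; in that case any point of `Q`
replaces it. -/
theorem Steps.exists_mem {α : Type*} {R : α → α → Prop} {Q : Finset α} {k : ℕ} {a b : α}
    (h : Steps (Within Q R) k a b) (hQ : Q.Nonempty) :
    ∃ a ∈ Q, ∃ b ∈ Q, Steps (Within Q R) k a b := by
  rcases Nat.eq_zero_or_pos k with rfl | hk
  · obtain ⟨x, hx⟩ := hQ
    exact ⟨x, hx, x, hx, rfl⟩
  · obtain ⟨l, rfl⟩ : ∃ l, k = l + 1 := ⟨k - 1, by omega⟩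
    obtain ⟨c, -, y, hy, rfl⟩ := h.split
    obtain ⟨x, hx, -⟩ := id h
    exact ⟨a, hx.1, _, hy.2.1, h⟩

/-! ### Assembly of the final graph. -/

section Assembly

variable {n δ δ' A e : ℕ} {c C d : ℝ} {V ρ : Type}
  {E : V → V → Prop} {ent ext : Fin n → V} {H : ρ → ρ → Prop} {φ : ρ → Fin n}
  {Ex : Fin n → Fin n → Prop}

/-- Two nets with a depth-robust graph between them. -/
def Inner (E : V → V → Prop) (ent ext : Fin n → V) (H : ρ → ρ → Prop) (φ : ρ → Fin n) :
    V ⊕ ρ ⊕ V → V ⊕ ρ ⊕ V → Prop :=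
  Chain E (fun v z => ext (φ z) = v) H (fun z v => ent (φ z) = v) E

theorem inDegLE_inner (hnet : IsNet n δ c C E ent ext) (hH : OutDegLE δ' fun x y => H y x)
    (hφ : Function.Injective φ) : OutDegLE (δ + δ' + 1) fun x y => Inner E ent ext H φ y x := by
  refine inDegLE_chain (hnet.inDeg.mono (by omega)) (fun z => ?_) (fun v => ?_)
  · obtain ⟨t, ht, ht'⟩ := hH z
    exact ⟨{ext (φ z)}, t, by rw [card_singleton]; omega, fun x hx => by simp [← hx], ht'⟩
  · obtain ⟨t, ht, ht'⟩ := hnet.inDeg v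
    obtain ⟨s, hs, hs'⟩ := outDegLE_of_injective (hnet.ent_inj.comp hφ) v
    exact ⟨s, t, by omega, hs', ht'⟩

open Classical in
/-- All but few of the terminals on both sides are joined through the inner graph. -/
theorem assembly_robust [Fintype V] [Fintype ρ] (hnet : IsNet n δ c C E ent ext) (hφ : Function.Injective φ) (hn : 1 ≤ n)
    (hC : 0 < C) (hA : 3 ≤ A) (hCA : C ≤ A) (hEx : IsExpander A e Ex)
    (hρ : n ≤ 4 * Fintype.card ρ)
    (hwalk : ∀ Q : Finset ρ, Fintype.card ρ ≤ 2 * Q.card →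
      ∃ k a b, Steps (Within Q H) k a b ∧ d ≤ (k : ℝ) + 1)
    (D : Finset (Fin n ⊕ (V ⊕ ρ ⊕ V) ⊕ Fin n)) (hD : (D.card : ℝ) ≤ c * n)
    (hD' : 8 * (1 + 2 * C) * D.card ≤ n) :
    ∃ X Z : Finset (Fin n), n ≤ X.card + D.card ∧ n ≤ Z.card + D.card ∧ ∀ x ∈ X, ∀ z ∈ Z,
      .inl x ∉ D ∧ .inr (.inr z) ∉ D ∧ ∃ (k : ℕ) (j j' : Fin n), Ex x j ∧ Ex z j' ∧
        .inr (.inl (.inl (ent j))) ∉ D ∧ .inr (.inl (.inr (.inr (ext j')))) ∉ D ∧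
        d ≤ (k : ℝ) + 1 ∧ Steps (Avoid (pull (Sum.inr ∘ Sum.inl) D) (Inner E ent ext H φ)) k
          (.inl (ent j)) (.inr (.inr (ext j'))) := by
  set DM : Finset (V ⊕ ρ ⊕ V) := pull (Sum.inr ∘ Sum.inl) D with hDM
  set D₁ : Finset V := pull (Sum.inr ∘ Sum.inl ∘ Sum.inl) D with hD₁
  set D₂ : Finset V := pull (Sum.inr ∘ Sum.inl ∘ Sum.inr ∘ Sum.inr) D with hD₂
  set Dρ : Finset ρ := pull (Sum.inr ∘ Sum.inl ∘ Sum.inr ∘ Sum.inl) D with hDρ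
  set DI : Finset (Fin n) := pull Sum.inl D with hDI
  set DO : Finset (Fin n) := pull (Sum.inr ∘ Sum.inr) D with hDO
  have i₁ : Function.Injective
      (Sum.inr ∘ Sum.inl ∘ Sum.inl : V → Fin n ⊕ (V ⊕ ρ ⊕ V) ⊕ Fin n) :=
    Sum.inr_injective.comp (Sum.inl_injective.comp Sum.inl_injective)
  have i₂ : Function.Injective
      (Sum.inr ∘ Sum.inl ∘ Sum.inr ∘ Sum.inr : V → Fin n ⊕ (V ⊕ ρ ⊕ V) ⊕ Fin n) :=
    Sum.inr_injective.comp (Sum.inl_injective.comp (Sum.inr_injective.comp Sum.inr_injective))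
  have i₃ : Function.Injective
      (Sum.inr ∘ Sum.inl ∘ Sum.inr ∘ Sum.inl : ρ → Fin n ⊕ (V ⊕ ρ ⊕ V) ⊕ Fin n) :=
    Sum.inr_injective.comp (Sum.inl_injective.comp (Sum.inr_injective.comp Sum.inl_injective))
  have iO : Function.Injective (Sum.inr ∘ Sum.inr : Fin n → Fin n ⊕ (V ⊕ ρ ⊕ V) ⊕ Fin n) :=
    Sum.inr_injective.comp Sum.inr_injective
  have c₁ : (D₁.card : ℝ) ≤ D.card := by exact_mod_cast card_pull_le i₁ D
  have c₂ : (D₂.card : ℝ) ≤ D.card := by exact_mod_cast card_pull_le i₂ D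
  have c₃ : (Dρ.card : ℝ) ≤ D.card := by exact_mod_cast card_pull_le i₃ D
  -- Deleted inputs and deleted nodes of the first net are disjoint parts of `D`, so their losses
  -- together cost at most `|D|` inputs; likewise for outputs below.
  have cI : DI.card + D₁.card ≤ D.card :=
    card_pull_add_card_pull_le Sum.inl_injective i₁ (fun a b h => by cases h) D
  have cO : DO.card + D₂.card ≤ D.card :=
    card_pull_add_card_pull_le iO i₂ (fun a b h => by cases h) D
  obtain ⟨X₁, Z₁, hX₁, hZ₁, hXZ₁⟩ := hnet.robust D₁ (c₁.trans hD)
  obtain ⟨X₂, Z₂, hX₂, hZ₂, hXZ₂⟩ := hnet.robust D₂ (c₂.trans hD)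
  have hD0 : (0 : ℝ) ≤ D.card := Nat.cast_nonneg _
  have e₁ : C * D₁.card ≤ C * D.card := mul_le_mul_of_nonneg_left c₁ hC.le
  have e₂ : C * D₂.card ≤ C * D.card := mul_le_mul_of_nonneg_left c₂ hC.le
  have hCD : 0 ≤ C * D.card := mul_nonneg hC.le hD0
  have tX := card_terminals hEx hA hn hCA X₁ DI D₁.card hX₁ (by linarith)
  have tZ := card_terminals hEx hA hn hCA Z₂ DO D₂.card hZ₂ (by linarith)
  have hρ' : (n : ℝ) ≤ 4 * Fintype.card ρ := by exact_mod_cast hρ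
  set Q : Finset ρ := univ.filter fun z => z ∉ Dρ ∧ φ z ∈ Z₁ ∧ φ z ∈ X₂ with hQ
  have hQc : Qᶜ ⊆ Dρ ∪ (pull φ Z₁ᶜ ∪ pull φ X₂ᶜ) := fun z hz => by
    simp only [mem_union, mem_pull, mem_compl]
    by_contra! h
    obtain ⟨h1, h2, h3⟩ := h
    exact mem_compl.1 hz (mem_filter.2 ⟨mem_univ _, h1, h2, h3⟩)
  have hQ1 : (Qᶜ.card : ℝ) ≤ Dρ.card + (Z₁ᶜ.card + X₂ᶜ.card) := by
    have h1 := (card_le_card hQc).trans (card_union_le _ _)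
    have h2 := card_union_le (pull φ Z₁ᶜ) (pull φ X₂ᶜ)
    have h3 := card_pull_le hφ Z₁ᶜ
    have h4 := card_pull_le hφ X₂ᶜ
    exact_mod_cast (by omega : Qᶜ.card ≤ Dρ.card + (Z₁ᶜ.card + X₂ᶜ.card))
  have hcomp : ∀ Y : Finset (Fin n), (Y.card : ℝ) + Yᶜ.card = n := fun Y => by
    have := card_add_card_compl Y
    rw [Fintype.card_fin] at this
    exact_mod_cast this
  have hQcomp : (Q.card : ℝ) + Qᶜ.card = Fintype.card ρ := by
    exact_mod_cast card_add_card_compl Q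
  -- At most `(1 + 2 * C) * |D| ≤ n / 8 ≤ |ρ| / 2` middle nodes are lost.
  have hQbig : Fintype.card ρ ≤ 2 * Q.card := by
    have h1 := hcomp Z₁
    have h2 := hcomp X₂
    have : (Fintype.card ρ : ℝ) ≤ 2 * Q.card := by linarith
    exact_mod_cast this
  obtain ⟨k, a', b', hk', hkd⟩ := hwalk Q hQbig
  obtain ⟨a, ha, b, hb, hk⟩ := hk'.exists_mem (card_pos.1 (by omega))
  have hn' : (1 : ℝ) ≤ n := by exact_mod_cast hn
  refine ⟨_, _, tX.trans (Nat.add_le_add_left cI _), tZ.trans (Nat.add_le_add_left cO _),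
    fun x hx z hz => ?_⟩
  obtain ⟨-, hx1, j, hj, hxj⟩ := mem_filter.1 hx
  obtain ⟨-, hz1, j', hj', hzj'⟩ := mem_filter.1 hz
  have hQmem : ∀ y ∈ Q, y ∉ Dρ ∧ φ y ∈ Z₁ ∧ φ y ∈ X₂ := fun y hy => (mem_filter.1 hy).2
  obtain ⟨a1, a2, -⟩ := hQmem a ha
  obtain ⟨b1, -, b3⟩ := hQmem b hb
  obtain ⟨p1, p2, p3⟩ := hXZ₁ j hj (φ a) a2
  obtain ⟨q1, q2, q3⟩ := hXZ₂ (φ b) b3 j' hj'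
  obtain ⟨l₁, w₁⟩ := exists_steps_of_reflTransGen p3
  obtain ⟨l₂, w₂⟩ := exists_steps_of_reflTransGen q3
  have m₁ : ∀ v, v ∉ D₁ → Sum.inl v ∉ DM := fun v hv h =>
    hv (mem_pull.2 ((mem_pull (g := Sum.inr ∘ Sum.inl)).1 h))
  have m₂ : ∀ v, v ∉ D₂ → Sum.inr (Sum.inr v) ∉ DM := fun v hv h =>
    hv (mem_pull.2 ((mem_pull (g := Sum.inr ∘ Sum.inl)).1 h))
  have m₃ : ∀ v, v ∉ Dρ → Sum.inr (Sum.inl v) ∉ DM := fun v hv h =>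
    hv (mem_pull.2 ((mem_pull (g := Sum.inr ∘ Sum.inl)).1 h))
  have s₁ : Steps (Avoid DM (Inner E ent ext H φ)) l₁ (.inl (ent j)) (.inl (ext (φ a))) :=
    w₁.lift Sum.inl (avoid_chain_left fun v hv => by_contra fun h => m₁ v h hv)
  have s₂ : Steps (Avoid DM (Inner E ent ext H φ)) l₂ (.inr (.inr (ent (φ b))))
      (.inr (.inr (ext j'))) :=
    w₂.lift (Sum.inr ∘ Sum.inr) (avoid_chain_right fun v hv => by_contra fun h => m₂ v h hv)
  have s₃ : Steps (Avoid DM (Inner E ent ext H φ)) k (.inr (.inl a)) (.inr (.inl b)) :=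
    hk.lift (Sum.inr ∘ Sum.inl) fun y y' h => ⟨m₃ _ (hQmem _ h.1).1, m₃ _ (hQmem _ h.2.1).1, h.2.2⟩
  have t₁ : Avoid DM (Inner E ent ext H φ) (.inl (ext (φ a))) (.inr (.inl a)) :=
    ⟨m₁ _ p2, m₃ _ a1, rfl⟩
  have t₂ : Avoid DM (Inner E ent ext H φ) (.inr (.inl b)) (.inr (.inr (ent (φ b)))) :=
    ⟨m₃ _ b1, m₂ _ q1, rfl⟩
  refine ⟨fun h => hx1 (mem_pull.2 h), fun h => hz1 (mem_pull.2 h), _, j, j', hxj, hzj',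
    fun h => p1 (mem_pull.2 h), fun h => q2 (mem_pull.2 h), ?_,
    s₁.trans ((Steps.single t₁).trans (s₃.trans ((Steps.single t₂).trans s₂)))⟩
  push_cast
  have : (0 : ℝ) ≤ l₁ := Nat.cast_nonneg _
  have : (0 : ℝ) ≤ l₂ := Nat.cast_nonneg _
  linarith

theorem exists_dag_assembly [Fintype V] [Fintype ρ] (hV : Fintype.card V ≤ 20 * n)
    (hnet : IsNet n δ c C E ent ext)
    (hφ : Function.Injective φ) (hn : 1 ≤ n) (hC : 0 < C) (hA : 3 ≤ A) (hCA : C ≤ A)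
    (hEx : IsExpander A e Ex) (hH : WellFounded H) (hHi : OutDegLE δ' fun x y => H y x)
    (hρ : n ≤ 4 * Fintype.card ρ)
    (hwalk : ∀ Q : Finset ρ, Fintype.card ρ ≤ 2 * Q.card →
      ∃ k a b, Steps (Within Q H) k a b ∧ d ≤ (k : ℝ) + 1)
    {c' : ℝ} (hc'0 : 0 < c') (hc'1 : c' ≤ 1) (hc'c : c' ≤ c) (hc'C : 8 * (1 + 2 * C) * c' ≤ 1) :
    ∃ G : DAG, G.IsMaximallySTRobust n c' d ∧ Fintype.card G.V ≤ 43 * n ∧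
      ∀ v, G.indegree v ≤ (e + 42) + (δ + δ' + 1) := by
  classical
  let M := V ⊕ ρ ⊕ V
  have hρn : Fintype.card ρ ≤ n := by simpa using Fintype.card_le_of_injective φ hφ
  have hM : Fintype.card M ≤ 41 * n := by
    simp only [M, Fintype.card_sum]
    omega
  obtain ⟨g, hg⟩ := exists_balanced_map (Fin n) (Fintype.card M) 41
    (by simpa using Nat.pos_of_ne_zero (by omega))
    (by simpa using hM)
  let f : M → Fin n := fun m => g (Fintype.equivFin M m)
  have hf : OutDegLE 41 fun i m => f m = i := fun i => by
    obtain ⟨s, hs, hs'⟩ := hg i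
    exact ⟨s.map (Fintype.equivFin M).symm.toEmbedding, by rwa [card_map], fun m hm =>
      mem_map.2 ⟨_, hs' _ hm, by simp⟩⟩
  have hin := inDegLE_inner hnet hHi hφ
  have hwf : WellFounded (Inner E ent ext H φ) := wellFounded_chain hnet.wf hH hnet.wf
  have hinj₁ : Function.Injective (fun j => (Sum.inl (ent j) : M)) :=
    Sum.inl_injective.comp hnet.ent_inj
  -- Besides the expander edges, input `0` points to every inner node, so that none of these is an
  -- input, and each input points to its own entry, so that it is not an output. Only indegrees are
  -- bounded, so the outdegree of input `0` is harmless.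
  have hI : OutDegLE (e + 2) fun (m : M) (i : Fin n) =>
      (∃ j, Ex i j ∧ Sum.inl (ent j) = m) ∨ Sum.inl (ent i) = m ∨ i = ⟨0, hn⟩ := by
    have h1 : OutDegLE (1 * e) fun (m : M) (i : Fin n) => ∃ j, Sum.inl (ent j) = m ∧ Ex j i :=
      (outDegLE_of_injective hinj₁).comp hEx.deg
    refine ((h1.sub ?_).or ((outDegLE_of_injective hinj₁).or
      ((outDegLE_of_fun fun _ : M => (⟨0, hn⟩ : Fin n)).sub fun _ _ h => h.symm))).mono (by omega)
    rintro m i ⟨j, h2, h3⟩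
    exact ⟨j, h3, hEx.symm _ _ h2⟩
  -- Dually, each inner node `m` points to the output `f m`. As `|M| ≤ 20n + n + 20n`, the balanced
  -- map `f` costs each output at most 41 incoming edges.
  have hO : OutDegLE (e + 42) fun (i : Fin n) (m : M) =>
      (∃ j, Ex i j ∧ Sum.inr (Sum.inr (ext j)) = m) ∨ Sum.inr (Sum.inr (ext i)) = m ∨ f m = i :=
    ((hEx.deg.comp (outDegLE_of_fun fun j => (Sum.inr (Sum.inr (ext j)) : M))).or
      ((outDegLE_of_fun fun j => (Sum.inr (Sum.inr (ext j)) : M)).or hf)).mono (by omega)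
  obtain ⟨G, h1, h2, h3⟩ := exists_dag_of_chain (c := c') (d := d) hwf
    (I := fun (i : Fin n) (m : M) =>
      (∃ j, Ex i j ∧ Sum.inl (ent j) = m) ∨ Sum.inl (ent i) = m ∨ i = ⟨0, hn⟩)
    (O := fun (m : M) (i : Fin n) =>
      (∃ j, Ex i j ∧ Sum.inr (Sum.inr (ext j)) = m) ∨ Sum.inr (Sum.inr (ext i)) = m ∨ f m = i)
    (δ := (e + 42) + (δ + δ' + 1))
    (inDegLE_chain (outDegLE_false _) (fun m => by
      obtain ⟨s, hs, hs'⟩ := hI m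
      obtain ⟨t, ht, ht'⟩ := hin m
      exact ⟨s, t, by omega, hs', ht'⟩) (fun i => by
      obtain ⟨s, hs, hs'⟩ := hO i
      exact ⟨s, ∅, by simpa using hs.trans (by omega), hs', fun _ h => h.elim⟩))
    (fun m => ⟨⟨0, hn⟩, Or.inr (Or.inr rfl)⟩) (fun i => ⟨_, Or.inr (Or.inl rfl)⟩)
    (fun m => ⟨f m, Or.inr (Or.inr rfl)⟩) (fun i => ⟨_, Or.inr (Or.inl rfl)⟩) hc'0 hc'1
    (fun D hD => by
      have hD1 : (D.card : ℝ) ≤ c * n := hD.trans (by gcongr)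
      have hD2 : 8 * (1 + 2 * C) * D.card ≤ n := by
        calc 8 * (1 + 2 * C) * D.card ≤ 8 * (1 + 2 * C) * (c' * n) := by gcongr
          _ = (8 * (1 + 2 * C) * c') * n := by ring
          _ ≤ 1 * n := by gcongr
          _ = n := one_mul _
      obtain ⟨X, Z, hX, hZ, h⟩ := assembly_robust hnet hφ hn hC hA hCA hEx hρ hwalk D hD1 hD2
      refine ⟨X, Z, hX, hZ, fun x hx z hz => ?_⟩
      obtain ⟨h1, h2, k, j, j', h3, h4, h5, h6, h7, h8⟩ := h x hx z hz
      exact ⟨h1, h2, k, _, _, Or.inl ⟨j, h3, rfl⟩, Or.inl ⟨j', h4, rfl⟩, h5, h6, h7, h8⟩)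
  exact ⟨G, h1, by rw [h2]; omega, h3⟩

end Assembly

theorem exists_dag_of_lt_one (ε : ℝ) (hε : 0 < ε) (hε1 : ε < 1) : ∃ (c : ℝ) (N : ℕ),
    ∀ n : ℕ, 1 ≤ n → ∃ G : DAG, G.IsMaximallySTRobust n c ((n : ℝ) ^ (1 - ε)) ∧
      Fintype.card G.V ≤ 43 * n ∧ ∀ v, G.indegree v ≤ N := by
  obtain ⟨δ, c, C, hc, hC, hnet⟩ := exists_isNet
  obtain ⟨δ', n₀, hlong⟩ := exists_long_range ε hε hε1
  obtain ⟨A, hA⟩ := exists_nat_ge (max C 3)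
  have hA3 : 3 ≤ A := by exact_mod_cast (le_max_right C 3).trans hA
  have hCA : C ≤ A := (le_max_left C 3).trans hA
  obtain ⟨e, he⟩ := exists_isExpander A
  set c' : ℝ := min (min 1 c) (min (1 / (8 * (1 + 2 * C))) (1 / (n₀ + 1))) with hc'
  have hc'0 : 0 < c' := lt_min (lt_min one_pos hc) (lt_min (by positivity) (by positivity))
  have h1 : c' ≤ 1 := (min_le_left _ _).trans (min_le_left _ _)
  have h2 : c' ≤ c := (min_le_left _ _).trans (min_le_right _ _)
  have h3 : c' ≤ 1 / (8 * (1 + 2 * C)) := (min_le_right _ _).trans (min_le_left _ _)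
  have h4 : c' ≤ 1 / (n₀ + 1) := (min_le_right _ _).trans (min_le_right _ _)
  refine ⟨c', (e + 42) + (δ + δ' + 1) + (n₀ + 1), fun n hn => ?_⟩
  by_cases hsmall : n < n₀
  · have hn' : (1 : ℝ) ≤ n := by exact_mod_cast hn
    have hlt : c' * n < 1 := by
      have h5 : (n : ℝ) < n₀ + 1 := by exact_mod_cast (by omega : n < n₀ + 1)
      calc c' * n ≤ 1 / (n₀ + 1) * n := by gcongr
        _ < 1 / (n₀ + 1) * (n₀ + 1) := by gcongr
        _ = 1 := by field_simp
    have hd : (n : ℝ) ^ (1 - ε) ≤ n := Real.rpow_le_self_of_one_le hn' (by linarith)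
    obtain ⟨G, g1, g2, g3⟩ := exists_dag_small n ((e + 42) + (δ + δ' + 1) + (n₀ + 1)) hn (by omega)
      hc'0 h1 hlt hd
    exact ⟨G, g1, g2.trans (by omega), g3⟩
  · obtain ⟨V, _, E, ent, ext, hV, hN⟩ := hnet n hn
    obtain ⟨ρ, _, H, φ, hH, hHi, hφ, hρ, hwalk⟩ := hlong n (by omega)
    obtain ⟨Ex, hEx⟩ := he (Fin n)
    obtain ⟨G, g1, g2, g3⟩ := exists_dag_assembly hV hN hφ hn hC hA3 hCA hEx hH hHi hρ hwalk
      hc'0 h1 h2 (by rwa [le_div_iff₀' (by positivity)] at h3)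
    exact ⟨G, g1, g2, fun v => (g3 v).trans (by omega)⟩

theorem isSTRobust_mono_depth {G : DAG} {k₁ k₂ : ℕ} {d d' : ℝ} (hd : d' ≤ d)
    (h : G.IsSTRobust k₁ k₂ d) : G.IsSTRobust k₁ k₂ d' := fun D hD => by
  obtain ⟨H, h1, h2, h3, h4⟩ := h D hD
  refine ⟨H, h1, h2, h3, fun s hs t ht => ?_⟩
  obtain ⟨h5, h6, p, h7, h8, h9⟩ := h4 s hs t ht
  exact ⟨h5, h6, p, h7, h8, hd.trans h9⟩

end STRobust

theorem mainTheorem8 (ε : ℝ) (hε : 0 < ε) :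
    ∃ c C : ℝ, ∃ M : ℕ → DAG, ∀ n : ℕ, 1 ≤ n →
      (M n).IsMaximallySTRobust n c ((n : ℝ) ^ (1 - ε)) ∧
      (Fintype.card (M n).V : ℝ) ≤ C * n ∧
      ∀ v : (M n).V, ((M n).indegree v : ℝ) ≤ C := by
  -- A smaller exponent loss gives more depth, so `ε ≥ 1` is covered by `1 / 2`.
  obtain ⟨c, N, h⟩ := STRobust.exists_dag_of_lt_one (min ε (1 / 2))
    (lt_min hε (by norm_num)) ((min_le_right _ _).trans_lt (by norm_num))
  have : Nonempty DAG := ⟨(h 1 le_rfl).choose⟩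
  choose! M hM using fun n (hn : 1 ≤ n) => h n hn
  refine ⟨c, 43 + N, M, fun n hn => ?_⟩
  obtain ⟨⟨h1, h2, h3, h4, h5⟩, h6, h7⟩ := hM n hn
  have hn' : (1 : ℝ) ≤ n := by exact_mod_cast hn
  refine ⟨⟨h1, h2, h3, h4, fun k hk => STRobust.isSTRobust_mono_depth ?_ (h5 k hk)⟩, ?_,
    fun v => ?_⟩
  · exact Real.rpow_le_rpow_of_exponent_le hn' (by linarith [min_le_left ε (1 / 2)])
  · have h8 : (Fintype.card (M n).V : ℝ) ≤ 43 * n := by exact_mod_cast h6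
    have h9 : (0 : ℝ) ≤ N * n := by positivity
    linarith
  · have h8 : ((M n).indegree v : ℝ) ≤ N := by exact_mod_cast h7 v
    linarith
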